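/- **Setting.** Let $\rho\ge 1$, let $\mathcal M=(\mu_1\ge\mu_2\ge\dots\ge\mu_\rho\ge 1)$ be integers with $\mu_1+\dots+\mu_\rho=n$, and put $\nu_l=\mu_1+\dots+\mu_{l-1}$ (so $\nu_1=0$). Say that we are in case (E) if $\rho\ge2$ and $\mu_2=\mu_1$, and in case (G) otherwise. Put $\ell=\mu_1+1$ in case (E) and $\ell=\mu_1$ in case (G). For $0\le k\le\mu_1-1$ let $\mathcal P'_k=\{\nu_l+i : 1\le l\le\rho,\ 1\le i\le\min(k,\mu_l)\}$; in case (E) let moreover $\mathcal P'_{\mu_1}=\{1,\dots,n\}\setminus\{\nu_2+\mu_2\}$. Let $\mathcal P''_k$ be the complement of $\mathcal P'_k$ in $\{1,\dots,n\}$. *Blow-ups.* The blow-up of a complex $n$-manifold $M$ along a closed complex submanifold $X$ is $\tilde M_X=(M\setminus X)\cup\bigcup_{p\in X}\mathbb P(T_pM/T_pX)$, with projection $\sigma:\tilde M_X\to M$ and exceptional divisor $\sigma^{-1}(X)$. Its charts are those of $M\setminus X$ together with, for every chart $\varphi=(z_1,\dots,z_n)$ of $M$ with domain $V$ and every set $S$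 of indices with $V\cap X=\{z_h=0\ \forall h\in S\}$, and every $j\in S$, the chart $\chi_j$ with components $z_h$ ($h\notin S$ or $h=j$) and $z_h/z_j$ ($h\in S\setminus\{j\}$) on $\{z_j\ne 0\}\subset V$, extended to the points $[v]$, $v\in T_pM/T_pX$ with $p\in V\cap X$ and $d(z_j)_p(v)\neq0$, by the components $z_h(p)$ ($h\notin S$), $0$ ($h=j$), $d(z_h)_p(v)/d(z_j)_p(v)$ ($h\in S\setminus\{j\}$). The proper transform of $Y\subseteq M$ is $\overline{\sigma^{-1}(Y\setminus X)}$. *The canonical sequence.* Put $M^0=\mathbb C^n$, $X^0=\{O\}$, $\mathbf e_0=O$, $\chi_0=\mathrm{id}$. Let $\sigma_{k+1}:M^{k+1}\to M^k$ ($0\le k<\ell$) be the blow-up of $M^k$ along $X^k$, with exceptional divisor $E^{k+1}$, and let $\pi_k=\sigma_1\circ\dots\circ\sigma_k:M^k\to\mathbb C^n$; the singular divisor of $M^k$ is $\pi_k^{-1}(O)$. Here, for $1\le k<\ell$, $X^k\subset M^k$ is the iterated proper transform (under $\sigma_2,\dots,\sigma_k$) of the linear subspace $Y^k$ of $E^1=\mathbb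 P^{n-1}(\mathbb C)$ spanned by $[e_h]$, $h\in\mathcal P'_k$. The point $\mathbf e_{k}\in E^{k}$ ($1\le k\le\ell$) is the normal direction at $\mathbf e_{k-1}$ of the coordinate vector $\partial/\partial w_{j}$ of the chart $\chi_{k-1}$, with $j=k$ if $k\le\mu_1$ and $j=\nu_2+\mu_2$ if $k=\mu_1+1$, and $\chi_{k}$ is the chart $\chi_j$ of the blow-up attached to $\varphi=\chi_{k-1}$ and to $S=\{1\}\cup\mathcal P''_{k-1}$. **Theorem (Diagonalization Theorem).** Let $F=(f_1,\dots,f_n)$ be a germ at $O$ of a holomorphic self-map of $\mathbb C^n$ with $F(O)=O$, such that $dF_O$ is invertible and not diagonalizable, and is in Jordan canonical form with blocks of lengths $\mu_1\ge\dots\ge\mu_\rho\ge1$ (in this order, with entries $1$ just above the diagonal) and respective eigenvalues $\lambda_1,\dots,\lambda_\rho$. Then: 1. For $0\le k<\ell$, $X^k$ is a closed complex submanifold of $M^k$, of codimension $\#(\{1\}\cup\mathcal P''_k)$. For $0\le k\le\ell$, $M^k$ is a (Hausdorff, second countable) complex $n$-manifold, $\pi_k$ is holomorphic and restricts to a biholomorphism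 $M^k\setminus\pi_k^{-1}(O)\to\mathbb C^n\setminus\{O\}$, and $\chi_k$ is a holomorphic chart of $M^k$ with image $\mathbb C^n$, centred at $\mathbf e_k$. 2. For $1\le k\le\ell$ there is a unique germ $\tilde F_k$ at $E^k$ of a holomorphic self-map of $M^k$ with $\tilde F_k(E^k)\subseteq E^k$ and $F\circ\pi_k=\pi_k\circ\tilde F_k$. It is the restriction of a unique germ at $\pi_k^{-1}(O)$ of a holomorphic self-map of $M^k$ which sends $\pi_k^{-1}(O)$ into itself and satisfies the same equation. Moreover $\tilde F_k(\mathbf e_k)=\mathbf e_k$. 3. The differential $d(\tilde F_\ell)_{\mathbf e_\ell}$ is diagonalizable, with eigenvalues $\tilde\lambda_1,\ 1,\ \lambda_2/\lambda_1,\dots,\lambda_\rho/\lambda_1$ of multiplicities $1,\ \mu_1-1,\ \mu_2,\dots,\mu_\rho$ respectively (multiplicities of coinciding values add up), where $\tilde\lambda_1=\lambda_1$ in case (G) and $\tilde\lambda_1=\lambda_1^2/\lambda_2$ in case (E). 4. Write $\chi_\ell\circ\tilde F_\ell\circ\chi_\ell^{-1}=(\tilde f_1,\dots,\tilde f_n)$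 near the origin, and let $a^j_{11}$ be the coefficient of $z_1^2$ in the power series of $f_j$ at $O$. In case (G), as $w\to0$, $$\tilde f_j(w)=\begin{cases} w_1\bigl(\lambda_1-a_{11}^{\mu_1}w_1+2w_2+O(\|w\|^2)\bigr)& j=1,\\ w_j\bigl(1-\frac1{\lambda_1}w_j+\frac1{\lambda_1}w_{j+1}+O(\|w\|^2)\bigr)& 2\le j\le\mu_1-1,\\ w_{\mu_1}\bigl(1+\frac{a_{11}^{\mu_1}}{\lambda_1}w_1-\frac1{\lambda_1}w_{\mu_1}+O(\|w\|^2)\bigr)& j=\mu_1,\\ \frac{\lambda_l}{\lambda_1}w_j-\frac{\lambda_l}{\lambda_1^2}w_{j-\nu_l+1}w_j+\frac1{\lambda_1}w_{j-\nu_l+1}w_{j+1}+O(\|w\|^3)& \nu_l<j<\nu_l+\mu_l,\ l\ge2,\\ \frac{\lambda_l}{\lambda_1}w_j-\frac{\lambda_l}{\lambda_1^2}w_{\mu_l+1}w_j+O(\|w\|^3)& j=\nu_l+\mu_l,\ l\ge 2,\ \mu_l<\mu_1-1,\\ \frac{\lambda_l}{\lambda_1}w_j+\frac{a_{11}^j}{\lambda_1}w_1w_{\mu_1}-\frac{\lambda_l}{\lambda_1^2}w_{\mu_1}w_j+O(\|w\|^3)&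 j=\nu_l+\mu_l,\ l\ge 2,\ \mu_l=\mu_1-1. \end{cases}$$ In case (E), as $w\to0$, $$\tilde f_j(w)=\begin{cases} w_1\bigl(\frac{\lambda_1^2}{\lambda_2}-\frac{\lambda_1^2}{\lambda_2^2}a_{11}^{\nu_2+\mu_2}w_1+\frac{2\lambda_1}{\lambda_2}w_2+O(\|w\|^2)\bigr)& j=1,\\ w_j\bigl(1-\frac1{\lambda_1}w_j+\frac1{\lambda_1}w_{j+1}+O(\|w\|^2)\bigr)& 2\le j\le\mu_1-1,\\ w_{\mu_1}\bigl(1-\frac1{\lambda_1}w_{\mu_1}+O(\|w\|^2)\bigr)& j=\mu_1,\\ \frac{\lambda_l}{\lambda_1}w_j-\frac{\lambda_l}{\lambda_1^2}w_{j-\nu_l+1}w_j+\frac1{\lambda_1}w_{j-\nu_l+1}w_{j+1}+O(\|w\|^3)& \nu_l<j<\nu_l+\mu_l,\ l\ge2,\\ w_{\nu_2+\mu_2}\bigl(\frac{\lambda_2}{\lambda_1}+\frac{a_{11}^{\nu_2+\mu_2}}{\lambda_1}w_1+O(\|w\|^2)\bigr)& j=\nu_2+\mu_2,\\ \frac{\lambda_l}{\lambda_1}w_j-\frac{\lambda_l}{\lambda_1^2}w_{\mu_l+1}w_j+O(\|w\|^3)&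 j=\nu_l+\mu_l,\ \mu_l<\mu_1,\\ \frac{\lambda_l}{\lambda_1}w_j+\frac{a_{11}^j}{\lambda_1}w_1w_{\nu_2+\mu_2}+O(\|w\|^3)& j=\nu_l+\mu_l,\ \mu_l=\mu_1,\ l\ge3. \end{cases}$$ -/

import Mathlib

open scoped Manifold Topology ContDiff LinearAlgebra.Projectivization
open Filter Set

set_option linter.unusedSectionVars false

/-!
Complex manifolds of dimension `n = card ι` are Mathlib manifolds modelled on `ι → ℂ`, analytic
over `ℂ`.  The first part constructs the blow-up of such a manifold along a closed submanifold, the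
second part the sequence of blow-ups attached to a partition.
-/

namespace HolBlowUp

section BlowUp

variable {ι : Type} [Fintype ι] {M : Type} [TopologicalSpace M]
  [ChartedSpace (ι → ℂ) M]

/-- A chart `φ = (z_1, …, z_n)` of `M` with domain `V` is adapted to `X`, with set of normal indices
`S`, if `V ∩ X = {z_h = 0 for all h ∈ S}`. -/
structure IsAdapted (X : Set M) (φ : OpenPartialHomeomorph M (ι → ℂ)) (S : Finset ι) : Prop where
  mem_maximalAtlas : φ ∈ IsManifold.maximalAtlas 𝓘(ℂ, ι → ℂ) ω M
  mem_iff : ∀ q ∈ φ.source, (q ∈ X ↔ ∀ h ∈ S, φ q h = 0)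

/-- The differential `dφ_p : T_p M → ℂⁿ` of a `ℂⁿ`-valued map (in practice a chart) at `p`. -/
noncomputable def dchart (φ : M → ι → ℂ) (p : M) :
    TangentSpace 𝓘(ℂ, ι → ℂ) p →ₗ[ℂ] (ι → ℂ) :=
  (mfderiv 𝓘(ℂ, ι → ℂ) 𝓘(ℂ, ι → ℂ) φ p : TangentSpace 𝓘(ℂ, ι → ℂ) p →L[ℂ] (ι → ℂ)).toLinearMap

/-- The tangent space `T_p X ⊆ T_p M`: the vectors killed by the `d(z_h)_p`, `h` a normal index, for
all adapted charts around `p` (for one of them: see `mem_tangentOf`). -/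
noncomputable def tangentOf (X : Set M) (p : M) : Submodule ℂ (TangentSpace 𝓘(ℂ, ι → ℂ) p) :=
  ⨅ (φ : OpenPartialHomeomorph M (ι → ℂ)) (S : Finset ι) (_ : IsAdapted X φ S)
    (_ : p ∈ φ.source) (h : ι) (_ : h ∈ S), LinearMap.ker (LinearMap.proj h ∘ₗ dchart φ p)

/-- The normal space `T_p M / T_p X`. -/
abbrev NormalSpace (X : Set M) (p : M) : Type :=
  TangentSpace 𝓘(ℂ, ι → ℂ) p ⧸ tangentOf (ι := ι) X p

variable (ι) in
/-- `X` is a complex submanifold near its point `p`. -/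
def IsSubmanifoldAt (X : Set M) (p : M) : Prop :=
  ∃ (φ : OpenPartialHomeomorph M (ι → ℂ)) (S : Finset ι), IsAdapted X φ S ∧ p ∈ φ.source

variable (ι) in
/-- `X` is a closed complex submanifold of `M`, everywhere of codimension `c`. -/
def IsClosedSubmanifold (X : Set M) (c : ℕ) : Prop :=
  IsClosed X ∧ ∀ p ∈ X, ∃ (φ : OpenPartialHomeomorph M (ι → ℂ)) (S : Finset ι),
    IsAdapted X φ S ∧ p ∈ φ.source ∧ S.card = c

theorem chart_cocycle {φ φ' : OpenPartialHomeomorph M (ι → ℂ)}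
    (hφ : φ ∈ IsManifold.maximalAtlas 𝓘(ℂ, ι → ℂ) ω M)
    (hφ' : φ' ∈ IsManifold.maximalAtlas 𝓘(ℂ, ι → ℂ) ω M) {p : M} (hp : p ∈ φ.source)
    (hp' : p ∈ φ'.source) (u : TangentSpace 𝓘(ℂ, ι → ℂ) p) :
    dchart φ' p u = fderiv ℂ (φ' ∘ φ.symm) (φ p) (dchart φ p u) := by
  have h1 := IsManifold.maximalAtlas_subset_of_le (n := ω) (m := 1) le_top hφ
  have h1' := IsManifold.maximalAtlas_subset_of_le (n := ω) (m := 1) le_top hφ'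
  have d1 := mdifferentiableAt_of_mem_maximalAtlas h1 hp
  have d2 := mdifferentiableAt_of_mem_maximalAtlas h1' hp'
  have d3 := mdifferentiableAt_symm_of_mem_maximalAtlas h1 (φ.map_source hp)
  have e : φ.symm (φ p) = p := φ.left_inv hp
  have d4 : MDifferentiableAt 𝓘(ℂ, ι → ℂ) 𝓘(ℂ, ι → ℂ) (φ' ∘ φ.symm) (φ p) :=
    MDifferentiableAt.comp _ (by rw [e]; exact d2) d3
  have d5 := mfderiv_comp p d4 d1
  have d6 : mfderiv 𝓘(ℂ, ι → ℂ) 𝓘(ℂ, ι → ℂ) φ' p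
      = mfderiv 𝓘(ℂ, ι → ℂ) 𝓘(ℂ, ι → ℂ) ((φ' ∘ φ.symm) ∘ φ) p := by
    apply Filter.EventuallyEq.mfderiv_eq
    filter_upwards [φ.open_source.mem_nhds hp] with q hq
    simp [φ.left_inv hq]
  rw [dchart, dchart]
  change mfderiv 𝓘(ℂ, ι → ℂ) 𝓘(ℂ, ι → ℂ) φ' p u = _
  rw [← mfderiv_eq_fderiv]
  have := congrArg (fun T => T u) (d6.trans d5)
  exact this

theorem transition_contDiffAt {φ φ' : OpenPartialHomeomorph M (ι → ℂ)}
    (hφ : φ ∈ IsManifold.maximalAtlas 𝓘(ℂ, ι → ℂ) ω M)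
    (hφ' : φ' ∈ IsManifold.maximalAtlas 𝓘(ℂ, ι → ℂ) ω M) {p : M} (hp : p ∈ φ.source)
    (hp' : p ∈ φ'.source) : ContDiffAt ℂ 1 (φ' ∘ φ.symm) (φ p) := by
  have h := IsManifold.compatible_of_mem_maximalAtlas hφ hφ'
  have h2 : ContDiffOn ℂ ω _ _ := (mem_groupoid_of_pregroupoid.1 h).1
  have h3 : ContDiffAt ℂ ω (φ' ∘ φ.symm) (φ p) := by
    refine (h2.contDiffAt ?_)
    simp only [modelWithCornersSelf_coe_symm, preimage_id_eq, id_eq, range_id, inter_univ,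
      modelWithCornersSelf_coe]
    refine (OpenPartialHomeomorph.open_source _).mem_nhds ?_
    simp [φ.map_source hp, φ.left_inv hp, hp']
  exact h3.of_le le_top

theorem dchart_bijective {φ : OpenPartialHomeomorph M (ι → ℂ)}
    (hφ : φ ∈ IsManifold.maximalAtlas 𝓘(ℂ, ι → ℂ) ω M) {p : M} (hp : p ∈ φ.source) :
    Function.Bijective (dchart φ p) := by
  have h1 := IsManifold.maximalAtlas_subset_of_le (n := ω) (m := 1) le_top hφ
  have : φ.MDifferentiable 𝓘(ℂ, ι → ℂ) 𝓘(ℂ, ι → ℂ) :=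
    ⟨fun q hq => (mdifferentiableAt_of_mem_maximalAtlas h1 hq).mdifferentiableWithinAt,
     fun q hq => (mdifferentiableAt_symm_of_mem_maximalAtlas h1 hq).mdifferentiableWithinAt⟩
  exact this.mfderiv_bijective hp

/-- The differential of a transition map between adapted charts preserves the tangent
directions. -/
theorem transition_tangent {X : Set M} {φ φ' : OpenPartialHomeomorph M (ι → ℂ)} {S S' : Finset ι}
    (hφ : IsAdapted X φ S) (hφ' : IsAdapted X φ' S') {p : M} (hp : p ∈ φ.source)
    (hp' : p ∈ φ'.source) (hX : p ∈ X) {u : ι → ℂ} (hu : ∀ h ∈ S, u h = 0) {h : ι} (hh : h ∈ S') :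
    fderiv ℂ (φ' ∘ φ.symm) (φ p) u h = 0 := by
  have hd := (transition_contDiffAt hφ.1 hφ'.1 hp hp').differentiableAt one_ne_zero
  have hl : HasDerivAt (fun t : ℂ => φ p + t • u) u 0 := by
    simpa using ((hasDerivAt_id (0 : ℂ)).smul_const u).const_add (φ p)
  have h0 : φ p + (0 : ℂ) • u = φ p := by simp
  have hc : HasDerivAt ((φ' ∘ φ.symm) ∘ fun t : ℂ => φ p + t • u)
      (fderiv ℂ (φ' ∘ φ.symm) (φ p) u) 0 := by
    apply HasFDerivAt.comp_hasDerivAt (0 : ℂ) _ hl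
    rw [h0]; exact hd.hasFDerivAt
  have hh' := hasDerivAt_pi.1 hc h
  have hz : (fun t : ℂ => ((φ' ∘ φ.symm) ∘ fun t : ℂ => φ p + t • u) t h) =ᶠ[𝓝 0] fun _ => 0 := by
    have ct : ContinuousAt (fun t : ℂ => φ p + t • u) 0 := hl.continuousAt
    have m1 : ∀ᶠ t in 𝓝 (0 : ℂ), φ p + t • u ∈ φ.target :=
      ct.eventually_mem (by rw [h0]; exact φ.open_target.mem_nhds (φ.map_source hp))
    have m2 : ∀ᶠ t in 𝓝 (0 : ℂ), φ.symm (φ p + t • u) ∈ φ'.source := by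
      have : ContinuousAt (fun t : ℂ => φ.symm (φ p + t • u)) 0 := by
        refine ContinuousAt.comp (g := φ.symm) ?_ ct
        rw [h0]; exact φ.continuousAt_symm (φ.map_source hp)
      refine this.eventually_mem ?_
      rw [h0, φ.left_inv hp]; exact φ'.open_source.mem_nhds hp'
    filter_upwards [m1, m2] with t ht1 ht2
    have hx : φ.symm (φ p + t • u) ∈ X := by
      rw [hφ.2 _ (φ.map_target ht1), φ.right_inv ht1]
      intro i hi
      have := (hφ.2 p hp).1 hX i hi
      simp [this, hu i hi]
    exact (hφ'.2 _ ht2).1 hx h hh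
  rw [← hh'.deriv, hz.deriv_eq]
  simp

theorem mem_tangentOf {X : Set M} {φ : OpenPartialHomeomorph M (ι → ℂ)} {S : Finset ι}
    (hφ : IsAdapted X φ S) {p : M} (hp : p ∈ φ.source) (hX : p ∈ X)
    (u : TangentSpace 𝓘(ℂ, ι → ℂ) p) :
    u ∈ tangentOf X p ↔ ∀ h ∈ S, dchart φ p u h = 0 := by
  simp only [tangentOf, Submodule.mem_iInf, LinearMap.mem_ker, LinearMap.comp_apply,
    LinearMap.proj_apply]
  constructor
  · intro H h hh
    exact H φ S hφ hp h hh
  · intro H φ' S' hφ' hp' h hh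
    rw [chart_cocycle hφ.1 hφ'.1 hp hp']
    exact transition_tangent hφ hφ' hp hp' hX H hh

/-- The blow-up of `M` along `X`, as a set: `(M ∖ X) ∪ ⋃_{p ∈ X} ℙ(T_p M / T_p X)`.  The condition `hs`
holds for every `p ∈ X` when `X` is a submanifold. -/
inductive BlowUp (ι : Type) [Fintype ι] {M : Type} [TopologicalSpace M] [ChartedSpace (ι → ℂ) M]
    (X : TopologicalSpace.Closeds M) : Type
  | off (q : M) (hq : q ∉ X) : BlowUp ι X
  | exc (p : M) (hp : p ∈ X) (hs : IsSubmanifoldAt ι (X : Set M) p)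
      (v : ℙ ℂ (NormalSpace (ι := ι) (X : Set M) p)) : BlowUp ι X

/-- `dφ_p` evaluated on a representative of a normal vector.  For an adapted chart the normal
components do not depend on the representative: see `dnormal_mk`. -/
noncomputable def dnormal {X : Set M} (φ : M → ι → ℂ) (p : M) (v : NormalSpace (ι := ι) X p) :
    ι → ℂ := dchart φ p (Quotient.out v)

theorem dnormal_mk {X : Set M} {φ : OpenPartialHomeomorph M (ι → ℂ)} {S : Finset ι}
    (hφ : IsAdapted X φ S) {p : M} (hp : p ∈ φ.source) (hX : p ∈ X)
    (u : TangentSpace 𝓘(ℂ, ι → ℂ) p) {h : ι} (hh : h ∈ S) :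
    dnormal φ p (Submodule.Quotient.mk u : NormalSpace (ι := ι) X p) h = dchart φ p u h := by
  have h1 : (Submodule.Quotient.mk (Quotient.out (Submodule.Quotient.mk u : NormalSpace (ι := ι) X p)) : NormalSpace (ι := ι) X p)
      = Submodule.Quotient.mk u := Quotient.out_eq _
  rw [Submodule.Quotient.eq, mem_tangentOf hφ hp hX] at h1
  have := h1 h hh
  rw [map_sub, Pi.sub_apply, sub_eq_zero] at this
  exact this

variable {X : TopologicalSpace.Closeds M}

namespace BlowUp

/-- The projection `σ` of the blow-up. -/
def proj : BlowUp ι X → M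
  | off q _ => q
  | exc p _ _ _ => p

open Classical in
/-- The map `χ_j` attached to an adapted chart `φ` with normal indices `S` and to `j ∈ S`: on `M ∖ X`
it divides the normal coordinates other than `z_j` by `z_j`, and on the exceptional divisor it
takes the corresponding quotients of differentials. -/
noncomputable def chartFun (φ : M → ι → ℂ) (S : Finset ι) (j : ι) : BlowUp ι X → ι → ℂ
  | off q _ => fun h => if h ∈ S ∧ h ≠ j then φ q h / φ q j else φ q h
  | exc p _ _ v => fun h =>
      if h = j then 0
      else if h ∈ S then dnormal φ p v.rep h / dnormal φ p v.rep j
      else φ p h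

/-- The domain `V_j` of `χ_j`, where `V` is the domain of `φ`: the points of `V ∖ X` with `z_j ≠ 0` and
the normal directions `[v]` over `V ∩ X` with `d(z_j)(v) ≠ 0`. -/
def chartDom (φ : M → ι → ℂ) (V : Set M) (j : ι) : Set (BlowUp ι X) :=
  {x | match x with
    | off q _ => q ∈ V ∧ φ q j ≠ 0
    | exc p _ _ v => p ∈ V ∧ dnormal φ p v.rep j ≠ 0}

/-- The part of the blow-up over `V ∖ X`. -/
def offDom (V : Set M) : Set (BlowUp ι X) :=
  {x | x.proj ∈ V ∧ x.proj ∉ X}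

/-- The charts of the blow-up, as maps with a domain: an atlas of `M ∖ X`, together with the
`(V_j, χ_j)` for all charts adapted to `X` and all normal indices `j`. -/
inductive IsPreChart : (BlowUp ι X → ι → ℂ) → Set (BlowUp ι X) → Prop
  | ofOff (φ : OpenPartialHomeomorph M (ι → ℂ))
      (hφ : φ ∈ atlas (ι → ℂ) M) :
      IsPreChart (fun x => φ x.proj) (offDom φ.source)
  | ofExc (φ : OpenPartialHomeomorph M (ι → ℂ)) (S : Finset ι) (hφ : IsAdapted (X : Set M) φ S)
      (j : ι) (hj : j ∈ S) : IsPreChart (chartFun φ S j) (chartDom φ φ.source j)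

open Classical in
/-- The expression `φ ∘ σ ∘ χ_j⁻¹` of the projection in coordinates. -/
noncomputable def blowMap (S : Finset ι) (j : ι) (w : ι → ℂ) : ι → ℂ :=
  fun h => if h ∈ S ∧ h ≠ j then w j * w h else w h

open Classical in
/-- A vector spanning the normal direction of the point with coordinates `w`, `w_j = 0`. -/
noncomputable def dirOf (S : Finset ι) (j : ι) (w : ι → ℂ) : ι → ℂ :=
  fun h => if h = j then 1 else if h ∈ S then w h else 0

theorem continuous_blowMap (S : Finset ι) (j : ι) : Continuous (blowMap S j) := by
  refine continuous_pi fun h => ?_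
  unfold blowMap
  split_ifs <;> fun_prop

theorem continuous_dirOf (S : Finset ι) (j : ι) : Continuous (dirOf S j) := by
  refine continuous_pi fun h => ?_
  unfold dirOf
  split_ifs <;> fun_prop

theorem exists_dnormal_rep {φ : OpenPartialHomeomorph M (ι → ℂ)} {S : Finset ι}
    (hφ : IsAdapted (X : Set M) φ S) {p : M} (hp : p ∈ φ.source) (hX : p ∈ X) {w : ι → ℂ} {j : ι}
    (hj : j ∈ S) :
    ∃ v : ℙ ℂ (NormalSpace (ι := ι) (X : Set M) p), dnormal φ p v.rep j ≠ 0 ∧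
      ∀ h ∈ S, h ≠ j → dnormal φ p v.rep h / dnormal φ p v.rep j = w h := by
  obtain ⟨u, hu⟩ := (dchart_bijective hφ.1 hp).2 (dirOf S j w)
  have hne : (Submodule.Quotient.mk u : NormalSpace (ι := ι) (X : Set M) p) ≠ 0 := by
    intro h0
    rw [Submodule.Quotient.mk_eq_zero, mem_tangentOf hφ hp hX] at h0
    have := h0 j hj
    rw [hu] at this
    simp [dirOf] at this
  obtain ⟨a, ha⟩ := Projectivization.exists_smul_eq_mk_rep ℂ _ hne
  have ha' : (Projectivization.mk ℂ _ hne).rep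
      = (Submodule.Quotient.mk ((a : ℂ) • u) : NormalSpace (ι := ι) (X : Set M) p) := by
    rw [← ha, Units.smul_def, Submodule.Quotient.mk_smul]
  have key : ∀ h ∈ S, dnormal φ p (Projectivization.mk ℂ _ hne).rep h = a * dirOf S j w h := by
    intro h hh
    rw [ha', dnormal_mk hφ hp hX _ hh, map_smul, hu]
    rfl
  refine ⟨Projectivization.mk ℂ _ hne, ?_, fun h hh hhj => ?_⟩
  · rw [key j hj]; simp [dirOf]
  · rw [key j hj, key h hh]; simp [dirOf, hhj, hh]

theorem injOn_chartFun {φ : OpenPartialHomeomorph M (ι → ℂ)} {S : Finset ι}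
    (hφ : IsAdapted (X : Set M) φ S) {j : ι} (hj : j ∈ S) :
    InjOn (chartFun φ S j) (chartDom φ φ.source j : Set (BlowUp ι X)) := by
  intro x hx y hy hxy
  have hz : ∀ p ∈ φ.source, p ∈ X → ∀ h ∈ S, φ p h = 0 := fun p hp hX => (hφ.2 p hp).1 hX
  cases x with
  | off q hq =>
    cases y with
    | off q' hq' =>
      have hjj : φ q j = φ q' j := by simpa [chartFun] using congrFun hxy j
      have : φ q = φ q' := by
        funext h
        have := congrFun hxy h
        simp only [chartFun] at this
        split_ifs at this with hc
        · rw [← hjj] at this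
          exact (div_left_inj' hx.2).1 this
        · exact this
      have := φ.injOn hx.1 hy.1 this
      subst this
      rfl
    | exc p hp hs v =>
      exfalso
      have := congrFun hxy j
      simp [chartFun] at this
      exact hx.2 this
  | exc p hp hs v =>
    cases y with
    | off q' hq' =>
      exfalso
      have := congrFun hxy j
      simp [chartFun] at this
      exact hy.2 this.symm
    | exc p' hp' hs' v' =>
      have hpp : φ p = φ p' := by
        funext h
        by_cases hh : h ∈ S
        · rw [hz p hx.1 hp h hh, hz p' hy.1 hp' h hh]
        · have := congrFun hxy h
          have hne : h ≠ j := fun e => hh (e ▸ hj)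
          simpa [chartFun, hh, hne] using this
      have := φ.injOn hx.1 hy.1 hpp
      subst this
      congr 1
      set a := dnormal φ p v.rep j with ha
      set b := dnormal φ p v'.rep j with hb
      have hx2 : a ≠ 0 := hx.2
      have hy2 : b ≠ 0 := hy.2
      obtain ⟨u, hu⟩ := Submodule.Quotient.mk_surjective _ v.rep
      obtain ⟨u', hu'⟩ := Submodule.Quotient.mk_surjective _ v'.rep
      have hku : ∀ h ∈ S, dnormal φ p v.rep h = dchart φ p u h := fun h hh => by
        rw [← hu, dnormal_mk hφ hx.1 hp _ hh]
      have hku' : ∀ h ∈ S, dnormal φ p v'.rep h = dchart φ p u' h := fun h hh => by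
        rw [← hu', dnormal_mk hφ hx.1 hp _ hh]
      rw [← v.mk_rep, ← v'.mk_rep, Projectivization.mk_eq_mk_iff']
      refine ⟨a / b, ?_⟩
      rw [← hu, ← hu', ← Submodule.Quotient.mk_smul, Submodule.Quotient.eq,
        mem_tangentOf hφ hx.1 hp]
      intro h hh
      rw [map_sub, map_smul, Pi.sub_apply, Pi.smul_apply, ← hku h hh, ← hku' h hh, smul_eq_mul]
      by_cases hhj : h = j
      · subst hhj
        rw [← ha, ← hb]; field_simp; simp
      · have := congrFun hxy h
        simp only [chartFun, hhj, hh, if_true, if_false, ← ha, ← hb] at this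
        rw [div_eq_div_iff hx2 hy2] at this
        field_simp
        linear_combination -this

theorem exists_chartFun_eq {φ : OpenPartialHomeomorph M (ι → ℂ)} {S : Finset ι}
    (hφ : IsAdapted (X : Set M) φ S) {j : ι} (hj : j ∈ S) {w : ι → ℂ}
    (hw : blowMap S j w ∈ φ.target) :
    ∃ y ∈ (chartDom φ φ.source j : Set (BlowUp ι X)), chartFun φ S j y = w ∧
      y.proj = φ.symm (blowMap S j w) := by
  have hq := φ.map_target hw
  have hr := φ.right_inv hw
  by_cases h0 : w j = 0
  · have hX : φ.symm (blowMap S j w) ∈ X := by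
      refine (hφ.2 _ hq).2 fun h hh => ?_
      rw [hr]
      by_cases hhj : h = j
      · simp [blowMap, hhj, h0]
      · simp [blowMap, hhj, h0, hh]
    obtain ⟨v, hv, hv'⟩ := exists_dnormal_rep (w := w) hφ hq hX hj
    refine ⟨exc _ hX ⟨φ, S, hφ, hq⟩ v, ⟨hq, hv⟩, ?_, rfl⟩
    funext h
    simp only [chartFun]
    split_ifs with h1 h2
    · rw [h1, h0]
    · exact hv' h h2 h1
    · rw [hr]; simp [blowMap, h2]
  · have hX : φ.symm (blowMap S j w) ∉ X := by
      intro hX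
      have := (hφ.2 _ hq).1 hX j hj
      rw [hr] at this
      exact h0 (by simpa [blowMap] using this)
    have hjv : φ (φ.symm (blowMap S j w)) j = w j := by rw [hr]; simp [blowMap]
    refine ⟨off _ hX, ⟨hq, by rw [hjv]; exact h0⟩, ?_, rfl⟩
    funext h
    simp only [chartFun, hjv]
    rw [hr]
    split_ifs with h1
    · simp only [blowMap, if_pos h1]; field_simp
    · simp only [blowMap, if_neg h1]

theorem IsPreChart.injOn {f : BlowUp ι X → ι → ℂ} {V : Set (BlowUp ι X)} (h : IsPreChart f V) :
    InjOn f V := by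
  cases h with
  | ofOff φ hφ =>
    intro x hx y hy hxy
    have : x.proj = y.proj := φ.injOn hx.1 hy.1 hxy
    cases x with
    | off q hq =>
      cases y with
      | off q' hq' => simp only [proj] at this; subst this; rfl
      | exc p hp hs v => exact absurd hp hy.2
    | exc p hp hs v => exact absurd hp hx.2
  | ofExc φ S hφ j hj => exact injOn_chartFun hφ hj

theorem IsPreChart.off_right {f : BlowUp ι X → ι → ℂ} {V : Set (BlowUp ι X)} (h : IsPreChart f V)
    {q : M} {hq : q ∉ X} (hV : off q hq ∈ V) :
    ∃ a : M → ι → ℂ, ContinuousAt a q ∧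
      ∀ᶠ q' in 𝓝 q, ∀ h' : q' ∉ X, off q' h' ∈ V ∧ f (off q' h') = a q' := by
  cases h with
  | ofOff φ hφ =>
    refine ⟨φ, φ.continuousAt hV.1, ?_⟩
    filter_upwards [φ.open_source.mem_nhds hV.1] with q' hq' h'
    exact ⟨⟨hq', h'⟩, rfl⟩
  | ofExc φ S hφ j hj =>
    have c : ∀ h, ContinuousAt (fun q => φ q h) q := fun h =>
      (continuous_apply h).continuousAt.comp (φ.continuousAt hV.1)
    classical
    refine ⟨fun q' h => if h ∈ S ∧ h ≠ j then φ q' h / φ q' j else φ q' h, ?_, ?_⟩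
    · refine continuousAt_pi.2 fun h => ?_
      split_ifs
      · exact (c h).div (c j) hV.2
      · exact c h
    · filter_upwards [φ.open_source.mem_nhds hV.1, (c j).eventually_ne hV.2] with q' h1 h2 h'
      refine ⟨⟨h1, h2⟩, ?_⟩
      funext h
      simp only [chartFun]

theorem IsPreChart.off_left {f : BlowUp ι X → ι → ℂ} {V : Set (BlowUp ι X)} (h : IsPreChart f V)
    {q : M} {hq : q ∉ X} (hV : off q hq ∈ V) :
    ∃ r : (ι → ℂ) → M, ContinuousAt r (f (off q hq)) ∧ r (f (off q hq)) = q ∧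
      ∀ᶠ w in 𝓝 (f (off q hq)), ∃ h' : r w ∉ X, off (r w) h' ∈ V ∧ f (off (r w) h') = w := by
  cases h with
  | ofOff φ hφ =>
    have hc := φ.continuousAt_symm (φ.map_source hV.1)
    refine ⟨φ.symm, hc, φ.left_inv hV.1, ?_⟩
    have : ∀ᶠ w in 𝓝 (φ q), φ.symm w ∉ X := by
      refine hc.eventually_mem (X.isClosed.isOpen_compl.mem_nhds ?_)
      rw [φ.left_inv hV.1]; exact hq
    filter_upwards [this, φ.open_target.mem_nhds (φ.map_source hV.1)] with w h1 h2
    exact ⟨h1, ⟨φ.map_target h2, h1⟩, φ.right_inv h2⟩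
  | ofExc φ S hφ j hj =>
    have hV2 : φ q j ≠ 0 := hV.2
    have hb : blowMap S j (chartFun φ S j (off q hq : BlowUp ι X)) = φ q := by
      funext h
      simp only [blowMap, chartFun]
      by_cases h1 : h ∈ S ∧ h ≠ j
      · simp [h1.1, h1.2]; field_simp
      · simp only [if_neg h1]
    have hc : ContinuousAt (fun w => φ.symm (blowMap S j w))
        (chartFun φ S j (off q hq : BlowUp ι X)) := by
      refine ContinuousAt.comp (g := φ.symm) ?_ (continuous_blowMap S j).continuousAt
      rw [hb]; exact φ.continuousAt_symm (φ.map_source hV.1)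
    refine ⟨fun w => φ.symm (blowMap S j w), hc, by simp only [hb]; exact φ.left_inv hV.1, ?_⟩
    have e1 : ∀ᶠ w in 𝓝 (chartFun φ S j (off q hq : BlowUp ι X)), blowMap S j w ∈ φ.target := by
      refine (continuous_blowMap S j).continuousAt.eventually_mem (φ.open_target.mem_nhds ?_)
      rw [hb]; exact φ.map_source hV.1
    have e2 : ∀ᶠ w in 𝓝 (chartFun φ S j (off q hq : BlowUp ι X)), w j ≠ 0 := by
      refine (continuous_apply j).continuousAt.eventually_ne ?_
      simpa [chartFun] using hV2
    filter_upwards [e1, e2] with w h1 h2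
    obtain ⟨y, hy, hy2, hy3⟩ := exists_chartFun_eq (X := X) hφ hj h1
    cases y with
    | off q' hq' =>
      simp only [proj] at hy3
      subst hy3
      exact ⟨hq', hy, hy2⟩
    | exc p hp hs v =>
      exfalso
      apply h2
      rw [← hy2]; simp [chartFun]


/-- The quotient of the normal coordinates of the transition map by the equation of the exceptional
divisor. -/
theorem continuousAt_quotient {φ φ' : OpenPartialHomeomorph M (ι → ℂ)} {S S' : Finset ι}
    (hφ : IsAdapted (X : Set M) φ S) (hφ' : IsAdapted (X : Set M) φ' S') {j : ι} (hj : j ∈ S)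
    {p : M} (hp : p ∈ φ.source) (hp' : p ∈ φ'.source) {w₀ : ι → ℂ}
    (hw₀ : w₀ j = 0) (hb : blowMap S j w₀ = φ p) {h : ι} (hh : h ∈ S') :
    ContinuousAt (fun w => if w j = 0
      then fderiv ℂ (φ' ∘ φ.symm) (blowMap S j w) (dirOf S j w) h
      else (φ' ∘ φ.symm) (blowMap S j w) h / w j) w₀ := by
  set g := φ' ∘ φ.symm with hg
  have hcd := transition_contDiffAt hφ.1 hφ'.1 hp hp'
  have hs : HasStrictFDerivAt g (fderiv ℂ g (φ p)) (φ p) := hcd.hasStrictFDerivAt one_ne_zero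
  have cb : Tendsto (blowMap S j) (𝓝 w₀) (𝓝 (φ p)) := by
    rw [← hb]; exact (continuous_blowMap S j).continuousAt
  have cd : Tendsto (dirOf S j) (𝓝 w₀) (𝓝 (dirOf S j w₀)) := (continuous_dirOf S j).continuousAt
  classical
  let b0 : (ι → ℂ) → ι → ℂ := fun w => blowMap S j (Function.update w j 0)
  have hupd : Function.update w₀ j 0 = w₀ := by
    rw [← hw₀]; exact Function.update_eq_self j w₀
  have cb0 : Tendsto b0 (𝓝 w₀) (𝓝 (φ p)) := by
    have : Continuous b0 := (continuous_blowMap S j).comp (continuous_id.update j continuous_const)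
    have h1 := this.tendsto w₀
    simpa only [b0, hupd, hb] using h1
  have hdiff : ∀ w, blowMap S j w - b0 w = w j • dirOf S j w := by
    intro w
    funext i
    simp only [b0, blowMap, dirOf, Pi.sub_apply, Pi.smul_apply, smul_eq_mul]
    by_cases hij : i = j
    · subst hij; simp
    · by_cases hiS : i ∈ S <;> simp [hij, hiS]
  have hb0X : ∀ᶠ w in 𝓝 w₀, g (b0 w) h = 0 := by
    have m1 : ∀ᶠ z in 𝓝 (φ p), z ∈ φ.target := φ.open_target.mem_nhds (φ.map_source hp)
    have m2 : ∀ᶠ z in 𝓝 (φ p), φ.symm z ∈ φ'.source := by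
      refine (φ.continuousAt_symm (φ.map_source hp)).eventually_mem ?_
      rw [φ.left_inv hp]; exact φ'.open_source.mem_nhds hp'
    filter_upwards [cb0.eventually m1, cb0.eventually m2] with w h1 h2
    have hx : φ.symm (b0 w) ∈ (X : Set M) := by
      rw [hφ.2 _ (φ.map_target h1), φ.right_inv h1]
      intro i hi
      by_cases hij : i = j
      · subst hij; simp [b0, blowMap]
      · simp [b0, blowMap, hij, hi]
    exact (hφ'.2 _ h2).1 hx h hh
  have hL : (fun w => g (blowMap S j w) - g (b0 w) - fderiv ℂ g (φ p) (w j • dirOf S j w))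
      =o[𝓝 w₀] fun w => w j := by
    have h1 := (hs.isLittleO).comp_tendsto (cb.prodMk_nhds cb0)
    have h2 : (fun w => w j • dirOf S j w) =O[𝓝 w₀] fun w => w j := by
      have := (Asymptotics.isBigO_refl (fun w : ι → ℂ => w j) (𝓝 w₀)).smul (cd.isBigO_one ℂ)
      simpa using this
    refine Asymptotics.IsLittleO.trans_isBigO (g := fun w => w j • dirOf S j w) ?_ h2
    refine h1.congr (fun w => ?_) (fun w => ?_)
    · change g (blowMap S j w) - g (b0 w) - fderiv ℂ g (φ p) (blowMap S j w - b0 w) = _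
      rw [hdiff]
    · exact hdiff w
  have hLh : Tendsto (fun w => (g (blowMap S j w) - g (b0 w)
      - fderiv ℂ g (φ p) (w j • dirOf S j w)) h / w j) (𝓝 w₀) (𝓝 0) := by
    refine Asymptotics.IsLittleO.tendsto_div_nhds_zero ?_
    exact (Asymptotics.isLittleO_pi.1 hL) h
  have cfix : Tendsto (fun w => fderiv ℂ g (φ p) (dirOf S j w) h) (𝓝 w₀)
      (𝓝 (fderiv ℂ g (φ p) (dirOf S j w₀) h)) := by
    have : Continuous fun v => fderiv ℂ g (φ p) v h :=
      (continuous_apply h).comp (fderiv ℂ g (φ p)).continuous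
    exact (this.tendsto _).comp cd
  have cA : Tendsto (fun w => fderiv ℂ g (blowMap S j w) (dirOf S j w) h) (𝓝 w₀)
      (𝓝 (fderiv ℂ g (φ p) (dirOf S j w₀) h)) := by
    have h1 : ContinuousAt (fderiv ℂ g) (φ p) :=
      (hcd.fderiv_right (m := 0) (by norm_num)).continuousAt
    have h2 : Tendsto (fun w => fderiv ℂ g (blowMap S j w)) (𝓝 w₀) (𝓝 (fderiv ℂ g (φ p))) :=
      h1.tendsto.comp cb
    exact ((continuous_apply h).tendsto _).comp
      ((isBoundedBilinearMap_apply.continuous.tendsto (fderiv ℂ g (φ p), dirOf S j w₀)).comp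
        (h2.prodMk_nhds cd))
  have cB : Tendsto (fun w => (g (blowMap S j w) - g (b0 w)
      - fderiv ℂ g (φ p) (w j • dirOf S j w)) h / w j + fderiv ℂ g (φ p) (dirOf S j w) h) (𝓝 w₀)
      (𝓝 (fderiv ℂ g (φ p) (dirOf S j w₀) h)) := by
    simpa using hLh.add cfix
  have := Tendsto.if' (p := fun w : ι → ℂ => w j = 0) cA cB
  rw [ContinuousAt, if_pos hw₀, hb]
  refine this.congr' ?_
  filter_upwards [hb0X] with w hw
  by_cases hwj : w j = 0
  · simp [hwj]
  · simp only [if_neg hwj, Pi.sub_apply, hw, map_smul, Pi.smul_apply, smul_eq_mul]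
    field_simp
    ring

open Classical in
theorem chartFun_transition {φ φ' : OpenPartialHomeomorph M (ι → ℂ)} {S S' : Finset ι}
    (hφ : IsAdapted (X : Set M) φ S) (hφ' : IsAdapted (X : Set M) φ' S') {j k : ι} (hj : j ∈ S)
    (hk : k ∈ S') {y : BlowUp ι X} (hy : y ∈ (chartDom φ φ.source j : Set (BlowUp ι X)))
    (hy' : y.proj ∈ φ'.source) {H : ι → ℂ}
    (hH : ∀ h, H h = if chartFun φ S j y j = 0
      then fderiv ℂ (φ' ∘ φ.symm) (φ y.proj) (dirOf S j (chartFun φ S j y)) h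
      else φ' y.proj h / chartFun φ S j y j) :
    (y ∈ (chartDom φ' φ'.source k : Set (BlowUp ι X)) ↔ H k ≠ 0) ∧
      ∀ h, chartFun φ' S' k y h = if h ∈ S' ∧ h ≠ k then H h / H k else φ' y.proj h := by
  cases y with
  | off q hq =>
    have h0 : chartFun φ S j (off q hq : BlowUp ι X) j = φ q j := by simp [chartFun]
    have hj0 : φ q j ≠ 0 := hy.2
    simp only [h0, if_neg hj0, proj] at hH
    constructor
    · rw [hH]
      simp only [proj] at hy'
      simp [chartDom, hy', hj0]
    · intro h
      simp only [chartFun, proj, hH]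
      split_ifs with h1
      · field_simp
      · rfl
  | exc p hp hs v =>
    have h0 : chartFun φ S j (exc p hp hs v : BlowUp ι X) j = 0 := by simp [chartFun]
    simp only [h0, if_true, proj] at hH
    simp only [proj] at hy'
    set c := dnormal φ p v.rep j with hc
    have hc0 : c ≠ 0 := hy.2
    obtain ⟨u, hu⟩ := Submodule.Quotient.mk_surjective _ v.rep
    have key : ∀ h ∈ S', dnormal φ' p v.rep h = c * H h := by
      intro h hh
      have e1 : ∀ i ∈ S, (dchart φ p u - c • dirOf S j
          (chartFun φ S j (exc p hp hs v : BlowUp ι X))) i = 0 := by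
        intro i hi
        have hki : dnormal φ p v.rep i = dchart φ p u i := by
          rw [← hu, dnormal_mk hφ hy.1 hp _ hi]
        simp only [Pi.sub_apply, Pi.smul_apply, smul_eq_mul, dirOf, chartFun]
        by_cases hij : i = j
        · subst hij; simp [hc, hki]
        · simp only [hij, hi, if_true, if_false, hki, ← hc]
          field_simp
          simp
      have e2 := transition_tangent hφ hφ' hy.1 hy' hp e1 hh
      rw [← hu, dnormal_mk hφ' hy' hp _ hh, chart_cocycle hφ.1 hφ'.1 hy.1 hy', hH]
      rw [map_sub, map_smul, Pi.sub_apply, Pi.smul_apply, sub_eq_zero] at e2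
      exact e2
    constructor
    · simp [chartDom, hy', key k hk, hc0]
    · intro h
      simp only [chartFun, proj]
      by_cases hhk : h = k
      · subst hhk
        simp only [if_true, ne_eq, not_true, and_false, if_false]
        exact ((hφ'.2 p hy').1 hp h hk).symm
      · by_cases hh : h ∈ S'
        · simp only [hhk, hh, if_true, if_false, key h hh, key k hk, ne_eq, not_false_eq_true,
            and_self]
          rw [mul_div_mul_left _ _ hc0]
        · simp [hhk, hh]

theorem IsPreChart.compat {f f' : BlowUp ι X → ι → ℂ} {V V' : Set (BlowUp ι X)}
    (h : IsPreChart f V) (h' : IsPreChart f' V') {x : BlowUp ι X} (hx : x ∈ V) (hx' : x ∈ V') :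
    ∃ T : (ι → ℂ) → ι → ℂ, ContinuousAt T (f x) ∧
      ∀ᶠ w in 𝓝 (f x), ∃ y ∈ V ∩ V', f y = w ∧ f' y = T w := by
  cases x with
  | off q hq =>
    obtain ⟨r, hr, hrq, hr'⟩ := h.off_left hx
    obtain ⟨a, ha, ha'⟩ := h'.off_right hx'
    rw [← hrq] at ha ha'
    refine ⟨a ∘ r, ContinuousAt.comp ha hr, ?_⟩
    filter_upwards [hr', hr.eventually ha'] with w h1 h2
    obtain ⟨h3, h4, h5⟩ := h1
    exact ⟨off (r w) h3, ⟨h4, (h2 h3).1⟩, h5, (h2 h3).2⟩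
  | exc p hp hs v =>
    cases h with
    | ofOff φ hφ => exact absurd hp hx.2
    | ofExc φ S hφ j hj =>
    cases h' with
    | ofOff φ' hφ' => exact absurd hp hx'.2
    | ofExc φ' S' hφ' k hk =>
    classical
    have h0 : chartFun φ S j (exc p hp hs v : BlowUp ι X) j = 0 := by simp [chartFun]
    set w₀ := chartFun φ S j (exc p hp hs v : BlowUp ι X) with hw₀
    have hb : blowMap S j w₀ = φ p := by
      funext i
      simp only [blowMap, h0, zero_mul]
      by_cases hi : i ∈ S
      · rw [(hφ.2 p hx.1).1 hp i hi]
        by_cases hij : i = j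
        · subst hij; simp [h0]
        · simp [hi, hij]
      · have hij : i ≠ j := fun e => hi (e ▸ hj)
        simp [hi, hw₀, chartFun, hij]
    let H : (ι → ℂ) → ι → ℂ := fun w h => if w j = 0
      then fderiv ℂ (φ' ∘ φ.symm) (blowMap S j w) (dirOf S j w) h
      else (φ' ∘ φ.symm) (blowMap S j w) h / w j
    have hHc : ∀ h ∈ S', ContinuousAt (fun w => H w h) w₀ := fun h hh =>
      continuousAt_quotient hφ hφ' hj hx.1 hx'.1 h0 hb hh
    have cb : Tendsto (blowMap S j) (𝓝 w₀) (𝓝 (φ p)) := by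
      rw [← hb]; exact (continuous_blowMap S j).continuousAt
    have hHk : H w₀ k ≠ 0 := by
      refine ((chartFun_transition hφ hφ' hj hk hx hx'.1 (H := H w₀) fun i => ?_).1).1 hx'
      simp only [H, ← hw₀, h0, if_true, hb, proj]
    refine ⟨fun w h => if h ∈ S' ∧ h ≠ k then H w h / H w k else (φ' ∘ φ.symm) (blowMap S j w) h,
      ?_, ?_⟩
    · refine continuousAt_pi.2 fun i => ?_
      split_ifs with hi
      · exact (hHc i hi.1).div (hHc k hk) hHk
      · have h1 := (transition_contDiffAt hφ.1 hφ'.1 hx.1 hx'.1).continuousAt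
        rw [ContinuousAt, hb]
        exact ((continuous_apply i).tendsto _).comp (h1.tendsto.comp cb)
    · have m1 : ∀ᶠ z in 𝓝 (φ p), z ∈ φ.target := φ.open_target.mem_nhds (φ.map_source hx.1)
      have m2 : ∀ᶠ z in 𝓝 (φ p), φ.symm z ∈ φ'.source := by
        refine (φ.continuousAt_symm (φ.map_source hx.1)).eventually_mem ?_
        rw [φ.left_inv hx.1]; exact φ'.open_source.mem_nhds hx'.1
      filter_upwards [cb.eventually m1, cb.eventually m2, (hHc k hk).eventually_ne hHk] with
        w h1 h2 h3
      obtain ⟨y, hy, hyw, hyp⟩ := exists_chartFun_eq (X := X) hφ hj h1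
      have hφy : φ y.proj = blowMap S j w := by rw [hyp, φ.right_inv h1]
      obtain ⟨t1, t2⟩ := chartFun_transition hφ hφ' hj hk hy (by rw [hyp]; exact h2) (H := H w)
        (fun i => by simp only [H, hyw, hφy]; rw [hyp]; rfl)
      refine ⟨y, ⟨hy, t1.2 h3⟩, hyw, ?_⟩
      funext i
      rw [t2 i, hyp]
      rfl

theorem exists_isPreChart (x : BlowUp ι X) :
    ∃ (f : BlowUp ι X → ι → ℂ) (V : Set (BlowUp ι X)), IsPreChart f V ∧ x ∈ V := by
  cases x with
  | off q hq => exact ⟨_, _, .ofOff (chartAt _ q) (chart_mem_atlas _ q), mem_chart_source _ q, hq⟩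
  | exc p hp hs v =>
    obtain ⟨φ, S, hφ, hpφ⟩ := id hs
    obtain ⟨u, hu⟩ := Submodule.Quotient.mk_surjective _ v.rep
    have : ∃ j ∈ S, dnormal φ p v.rep j ≠ 0 := by
      by_contra! hcon
      refine v.rep_nonzero ?_
      rw [← hu, Submodule.Quotient.mk_eq_zero, mem_tangentOf hφ hpφ hp]
      intro h hh
      rw [← dnormal_mk hφ hpφ hp u hh, hu]
      exact hcon h hh
    obtain ⟨j, hj, hne⟩ := this
    exact ⟨_, _, .ofExc φ S hφ j hj, hpφ, hne⟩

variable (ι X) in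
/-- The atlas of the blow-up: all bijections given by the maps of `IsPreChart`. -/
def preAtlas : Set (PartialEquiv (BlowUp ι X) (ι → ℂ)) :=
  {e | ∃ f V, IsPreChart f V ∧ e.source = V ∧ EqOn e f V}

theorem exists_mem_preAtlas (x : BlowUp ι X) : ∃ e ∈ preAtlas ι X, x ∈ e.source := by
  obtain ⟨f, V, h, hx⟩ := exists_isPreChart x
  have : Nonempty (BlowUp ι X) := ⟨x⟩
  exact ⟨(h.injOn.bijOn_image).toPartialEquiv f V _, ⟨f, V, h, rfl, fun _ _ => rfl⟩, hx⟩

theorem preAtlas_compat {e e' : PartialEquiv (BlowUp ι X) (ι → ℂ)} (he : e ∈ preAtlas ι X)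
    (he' : e' ∈ preAtlas ι X) {w : ι → ℂ} (hw : w ∈ (e.symm.trans e').source) :
    (e.symm.trans e').source ∈ 𝓝 w ∧ ContinuousAt (e.symm.trans e') w := by
  obtain ⟨f, V, h, hs, hf⟩ := he
  obtain ⟨f', V', h', hs', hf'⟩ := he'
  rw [PartialEquiv.trans_source] at hw
  have hx : e.symm w ∈ V := hs ▸ e.map_target hw.1
  have hx' : e.symm w ∈ V' := hs' ▸ hw.2
  have hfw : f (e.symm w) = w := by rw [← hf hx]; exact e.right_inv hw.1
  obtain ⟨T, hT, hT'⟩ := h.compat h' hx hx'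
  rw [hfw] at hT hT'
  have key : ∀ᶠ z in 𝓝 w, z ∈ (e.symm.trans e').source ∧ e.symm.trans e' z = T z := by
    filter_upwards [hT'] with z hz
    obtain ⟨y, hy, hyz, hyT⟩ := hz
    have hys : y ∈ e.source := hs ▸ hy.1
    have hez : e y = z := by rw [hf hy.1, hyz]
    have hyz' : e.symm z = y := by rw [← hez]; exact e.left_inv hys
    refine ⟨?_, ?_⟩
    · rw [PartialEquiv.trans_source]
      refine ⟨by rw [← hez]; exact e.map_source hys, ?_⟩
      change e.symm z ∈ e'.source
      rw [hyz', hs']; exact hy.2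
    · change e' (e.symm z) = T z
      rw [hyz', hf' hy.2, hyT]
  refine ⟨key.mono fun z hz => hz.1, ?_⟩
  exact hT.congr (key.mono fun z hz => hz.2.symm)

variable (ι X) in
noncomputable def core : ChartedSpaceCore (ι → ℂ) (BlowUp ι X) where
  atlas := preAtlas ι X
  chartAt x := (exists_mem_preAtlas x).choose
  mem_chart_source x := (exists_mem_preAtlas x).choose_spec.2
  chart_mem_atlas x := (exists_mem_preAtlas x).choose_spec.1
  open_source _ _ he he' := isOpen_iff_mem_nhds.2 fun _ hw => (preAtlas_compat he he' hw).1
  continuousOn_toFun _ _ he he' := fun _ hw => (preAtlas_compat he he' hw).2.continuousWithinAt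

/-- The topology of the blow-up is the one given by its charts. -/
noncomputable instance : TopologicalSpace (BlowUp ι X) := (core ι X).toTopologicalSpace

noncomputable instance : ChartedSpace (ι → ℂ) (BlowUp ι X) := (core ι X).toChartedSpace

/-- The proper transform of `Y`: the closure of `σ⁻¹(Y ∖ X)`. -/
noncomputable def properTransform (Y : Set M) : TopologicalSpace.Closeds (BlowUp ι X) :=
  .closure (proj ⁻¹' (Y \ X))

end BlowUp

end BlowUp

section Tower

/-- A `ρ`-partition: block lengths `μ_1 ≥ ⋯ ≥ μ_ρ ≥ 1`.  Blocks are numbered from `0` to `ρ - 1`. -/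
structure RhoPartition (ρ : ℕ) where
  μ : Fin ρ → ℕ
  antitone : Antitone μ
  pos : ∀ l, 1 ≤ μ l

namespace RhoPartition

variable {ρ : ℕ} (P : RhoPartition ρ)

/-- The index set of the coordinates of `ℂⁿ`, `n = μ_1 + ⋯ + μ_ρ`: pairs of a block and a position in
it.  The pair `(l, i)`, positions being numbered from `0`, is the coordinate of number
`ν_l + i + 1`, where `ν_l` is the sum of the lengths of the preceding blocks. -/
abbrev Idx : Type := (l : Fin ρ) × Fin (P.μ l)

/-- The coordinate number `ν_l + i`, for `1 ≤ i ≤ μ_l`. -/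
def idx (l : Fin ρ) (i : ℕ) : P.Idx := ⟨l, ⟨min (i - 1) (P.μ l - 1), by have := P.pos l; omega⟩⟩

/-- The matrix in Jordan form with eigenvalue `lam l` on the block `l`, entries `1` just above the
diagonal. -/
def jordan (lam : Fin ρ → ℂ) : Matrix P.Idx P.Idx ℂ :=
  Matrix.of fun x y =>
    if x = y then lam x.1 else if x.1 = y.1 ∧ (y.2 : ℕ) = x.2 + 1 then 1 else 0

variable [NeZero ρ]

/-- `μ_2 = μ_1` (in particular there are at least two blocks). -/
abbrev EqualTop : Prop := 1 < ρ ∧ P.μ 1 = P.μ 0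

/-- The length of the partition, which is the number of blow-ups. -/
def length : ℕ := if P.EqualTop then P.μ 0 + 1 else P.μ 0

/-- The index sets `P'_k`: the first `min(k, μ_l)` coordinates of every block if `k < μ_1`, and all
coordinates but the last one of the second block if `k = μ_1 = μ_2`. -/
def split (k : ℕ) : Finset P.Idx :=
  if k < P.μ 0 then Finset.univ.filter fun x => (x.2 : ℕ) < k
  else Finset.univ.erase (P.idx 1 (P.μ 1))

/-- The normal indices of the `k`-th center in the `k`-th canonical chart: the first coordinate and
the complement of `P'_k`. -/
def normalIdx (k : ℕ) : Finset P.Idx := insert (P.idx 0 1) (P.split k)ᶜ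

/-- The coordinate which defines the exceptional divisor of the `k`-th blow-up in the `k`-th
canonical chart: the `k`-th one of the first block, or the last one of the second block if
`k = μ_1 + 1`. -/
def pivot (k : ℕ) : P.Idx := if k ≤ P.μ 0 then P.idx 0 k else P.idx 1 (P.μ 1)

end RhoPartition

/-- A manifold of the sequence of blow-ups, with the objects that it carries. -/
structure Stage (ι : Type) [Fintype ι] where
  carrier : Type
  [top : TopologicalSpace carrier]
  [charted : ChartedSpace (ι → ℂ) carrier]
  /-- the projection `π_k` to `ℂⁿ` -/
  proj : carrier → ι → ℂ
  /-- the exceptional divisor of the last blow-up -/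
  exc : Set carrier
  /-- the iterated proper transform of the linear subspace of index `h` -/
  sub : ℕ → TopologicalSpace.Closeds carrier
  /-- the distinguished point (as a predicate) -/
  isBase : carrier → Prop
  /-- the canonical chart -/
  chart : carrier → ι → ℂ
  /-- the domain of the canonical chart -/
  dom : Set carrier

attribute [instance] Stage.top Stage.charted

namespace RhoPartition

variable {ρ : ℕ} [NeZero ρ] (P : RhoPartition ρ)

/-- The sequence of blow-ups.  It starts with `ℂⁿ`, where the center is the origin.  The stage `k + 1`
is the blow-up of the stage `k` along `sub k`.  In the first blow-up, `sub h` is the linear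
subspace `Y^h` of the exceptional divisor `ℙ(ℂⁿ)` spanned by the `[e_x]`, `x ∈ P'_h`; afterwards
proper transforms are taken. The distinguished point is the normal direction of the coordinate
vector `∂/∂w_j` at the previous distinguished point, `j` being the pivot, and the canonical chart
is the corresponding chart `χ_j`. -/
noncomputable def tower : ℕ → Stage P.Idx
  | 0 =>
    { carrier := P.Idx → ℂ
      proj := id
      exc := {0}
      sub := fun _ => ⟨{0}, isClosed_singleton⟩
      isBase := fun x => x = 0
      chart := id
      dom := Set.univ }
  | k + 1 =>
    let N := tower k
    { carrier := BlowUp P.Idx (N.sub k)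
      proj := fun x => N.proj x.proj
      exc := {x | x.proj ∈ N.sub k}
      sub := fun h =>
        if k = 0 then
          .closure {x | ∃ p hp hs v, x = BlowUp.exc p hp hs v ∧
            ∀ i, i ∉ P.split h → dnormal N.chart p v.rep i = 0}
        else BlowUp.properTransform (N.sub h)
      isBase := fun x => ∃ p hp hs, N.isBase p ∧
        ∃ (u : TangentSpace 𝓘(ℂ, P.Idx → ℂ) p) (hu : Submodule.Quotient.mk u ≠ 0),
          dchart N.chart p u = Pi.single (P.pivot (k + 1)) 1 ∧
          x = BlowUp.exc p hp hs (Projectivization.mk ℂ (Submodule.Quotient.mk u) hu)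
      chart := BlowUp.chartFun N.chart (P.normalIdx k) (P.pivot (k + 1))
      dom := BlowUp.chartDom N.chart N.dom (P.pivot (k + 1)) }

/-- The `k`-th manifold `M^k` of the sequence. -/
abbrev Mfd (k : ℕ) : Type := (P.tower k).carrier

/-- The projection `π_k : M^k → ℂⁿ`. -/
noncomputable abbrev proj (k : ℕ) : P.Mfd k → P.Idx → ℂ := (P.tower k).proj

/-- The center `X^k ⊆ M^k` of the next blow-up. -/
noncomputable abbrev center (k : ℕ) : Set (P.Mfd k) := (P.tower k).sub k

/-- The exceptional divisor `E^k ⊆ M^k`. -/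
abbrev exc (k : ℕ) : Set (P.Mfd k) := (P.tower k).exc

/-- The singular divisor `π_k⁻¹(O)`. -/
abbrev singularDivisor (k : ℕ) : Set (P.Mfd k) := {x | P.proj k x = 0}

/-- `χ` is the canonical chart of `M^k`, as a chart of the complex manifold `M^k`. -/
structure IsCanonicalChart (k : ℕ) (χ : OpenPartialHomeomorph (P.Mfd k) (P.Idx → ℂ)) : Prop where
  mem_maximalAtlas : χ ∈ IsManifold.maximalAtlas 𝓘(ℂ, P.Idx → ℂ) ω (P.Mfd k)
  source_eq : χ.source = (P.tower k).dom
  target_eq : χ.target = Set.univ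
  eqOn : Set.EqOn χ (P.tower k).chart (P.tower k).dom

/-- `π_k` is holomorphic, and restricts to a biholomorphism from the complement of the singular
divisor onto `ℂⁿ ∖ {O}`. -/
def IsBiholomorphicOff (k : ℕ) : Prop :=
  MDifferentiable 𝓘(ℂ, P.Idx → ℂ) 𝓘(ℂ, P.Idx → ℂ) (P.proj k) ∧
  ∃ g : (P.Idx → ℂ) → P.Mfd k,
    MDifferentiableOn 𝓘(ℂ, P.Idx → ℂ) 𝓘(ℂ, P.Idx → ℂ) g {0}ᶜ ∧
    (∀ z, z ≠ 0 → P.proj k (g z) = z) ∧ ∀ x, P.proj k x ≠ 0 → g (P.proj k x) = x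

/-- `G` represents an element of `End(M^k, E)`, that is the germ at the closed set `E` of a
holomorphic self-map of `M^k` sending `E` into itself, and `F ∘ π_k = π_k ∘ G` as germs at `E`. -/
structure IsLift (k : ℕ) (F : (P.Idx → ℂ) → P.Idx → ℂ) (E : Set (P.Mfd k))
    (G : P.Mfd k → P.Mfd k) : Prop where
  mapsTo : Set.MapsTo G E E
  holomorphic : ∀ᶠ x in 𝓝ˢ E, MDifferentiableAt 𝓘(ℂ, P.Idx → ℂ) 𝓘(ℂ, P.Idx → ℂ) G x
  semiconj : ∀ᶠ x in 𝓝ˢ E, F (P.proj k x) = P.proj k (G x)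

/-- The differential of `G` at `x`, for a fixed point `x` of `G`; the tangent space at `x` is `ℂⁿ` by
means of the preferred chart at `x`. -/
noncomputable def differentialAt (k : ℕ) (G : P.Mfd k → P.Mfd k) (x : P.Mfd k) :
    Module.End ℂ (P.Idx → ℂ) :=
  (mfderiv 𝓘(ℂ, P.Idx → ℂ) 𝓘(ℂ, P.Idx → ℂ) G x : (P.Idx → ℂ) →L[ℂ] (P.Idx → ℂ)).toLinearMap

/-- The coefficient `a_{11}^x` of `(z_1)^2` in the power series of the component `F_x` at `O`. -/
noncomputable def quadCoeff (F : (P.Idx → ℂ) → P.Idx → ℂ) (x : P.Idx) : ℂ :=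
  iteratedDeriv 2 (fun t : ℂ => F (Pi.single (P.idx 0 1) t) x) 0 / 2

/-- The eigenvalue `λ̃_1`. -/
noncomputable def lamTilde (lam : Fin ρ → ℂ) : ℂ :=
  if P.EqualTop then lam 0 ^ 2 / lam 1 else lam 0

/-- The expansion at the origin of the last lift `f` in the canonical chart when `μ_1 > μ_2`, or when
there is only one block.  A factored term `w_j (⋯ + O(‖w‖²))` is expressed by the error bound
`O(|w_j| ‖w‖²)`. -/
def ExpansionOfGt (lam : Fin ρ → ℂ) (a : P.Idx → ℂ) (f : (P.Idx → ℂ) → P.Idx → ℂ) : Prop :=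
  ((fun w => f w (P.idx 0 1) -
      w (P.idx 0 1) * (lam 0 - a (P.idx 0 (P.μ 0)) * w (P.idx 0 1) + 2 * w (P.idx 0 2)))
    =O[𝓝 0] fun w => ‖w (P.idx 0 1)‖ * ‖w‖ ^ 2) ∧
  (∀ i, 2 ≤ i → i + 1 ≤ P.μ 0 →
    (fun w => f w (P.idx 0 i) -
      w (P.idx 0 i) * (1 - 1 / lam 0 * w (P.idx 0 i) + 1 / lam 0 * w (P.idx 0 (i + 1))))
    =O[𝓝 0] fun w => ‖w (P.idx 0 i)‖ * ‖w‖ ^ 2) ∧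
  ((fun w => f w (P.idx 0 (P.μ 0)) -
      w (P.idx 0 (P.μ 0)) * (1 + a (P.idx 0 (P.μ 0)) / lam 0 * w (P.idx 0 1)
        - 1 / lam 0 * w (P.idx 0 (P.μ 0))))
    =O[𝓝 0] fun w => ‖w (P.idx 0 (P.μ 0))‖ * ‖w‖ ^ 2) ∧
  (∀ l ≠ 0, ∀ i, 1 ≤ i → i < P.μ l →
    (fun w => f w (P.idx l i) -
      (lam l / lam 0 * w (P.idx l i)
        - lam l / lam 0 ^ 2 * w (P.idx 0 (i + 1)) * w (P.idx l i)
        + 1 / lam 0 * w (P.idx 0 (i + 1)) * w (P.idx l (i + 1))))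
    =O[𝓝 0] fun w => ‖w‖ ^ 3) ∧
  (∀ l ≠ 0, P.μ l + 1 < P.μ 0 →
    (fun w => f w (P.idx l (P.μ l)) -
      (lam l / lam 0 * w (P.idx l (P.μ l))
        - lam l / lam 0 ^ 2 * w (P.idx 0 (P.μ l + 1)) * w (P.idx l (P.μ l))))
    =O[𝓝 0] fun w => ‖w‖ ^ 3) ∧
  (∀ l ≠ 0, P.μ l + 1 = P.μ 0 →
    (fun w => f w (P.idx l (P.μ l)) -
      (lam l / lam 0 * w (P.idx l (P.μ l))
        + a (P.idx l (P.μ l)) / lam 0 * w (P.idx 0 1) * w (P.idx 0 (P.μ 0))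
        - lam l / lam 0 ^ 2 * w (P.idx 0 (P.μ 0)) * w (P.idx l (P.μ l))))
    =O[𝓝 0] fun w => ‖w‖ ^ 3)

/-- The expansion at the origin of the last lift `f` in the canonical chart when `μ_1 = μ_2`, with the same
convention. -/
def ExpansionOfEq (lam : Fin ρ → ℂ) (a : P.Idx → ℂ) (f : (P.Idx → ℂ) → P.Idx → ℂ) : Prop :=
  ((fun w => f w (P.idx 0 1) -
      w (P.idx 0 1) * (lam 0 ^ 2 / lam 1
        - lam 0 ^ 2 / lam 1 ^ 2 * a (P.idx 1 (P.μ 1)) * w (P.idx 0 1)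
        + 2 * lam 0 / lam 1 * w (P.idx 0 2)))
    =O[𝓝 0] fun w => ‖w (P.idx 0 1)‖ * ‖w‖ ^ 2) ∧
  (∀ i, 2 ≤ i → i + 1 ≤ P.μ 0 →
    (fun w => f w (P.idx 0 i) -
      w (P.idx 0 i) * (1 - 1 / lam 0 * w (P.idx 0 i) + 1 / lam 0 * w (P.idx 0 (i + 1))))
    =O[𝓝 0] fun w => ‖w (P.idx 0 i)‖ * ‖w‖ ^ 2) ∧
  ((fun w => f w (P.idx 0 (P.μ 0)) -
      w (P.idx 0 (P.μ 0)) * (1 - 1 / lam 0 * w (P.idx 0 (P.μ 0))))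
    =O[𝓝 0] fun w => ‖w (P.idx 0 (P.μ 0))‖ * ‖w‖ ^ 2) ∧
  (∀ l ≠ 0, ∀ i, 1 ≤ i → i < P.μ l →
    (fun w => f w (P.idx l i) -
      (lam l / lam 0 * w (P.idx l i)
        - lam l / lam 0 ^ 2 * w (P.idx 0 (i + 1)) * w (P.idx l i)
        + 1 / lam 0 * w (P.idx 0 (i + 1)) * w (P.idx l (i + 1))))
    =O[𝓝 0] fun w => ‖w‖ ^ 3) ∧
  ((fun w => f w (P.idx 1 (P.μ 1)) -
      w (P.idx 1 (P.μ 1)) * (lam 1 / lam 0 + a (P.idx 1 (P.μ 1)) / lam 0 * w (P.idx 0 1)))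
    =O[𝓝 0] fun w => ‖w (P.idx 1 (P.μ 1))‖ * ‖w‖ ^ 2) ∧
  (∀ l, P.μ l < P.μ 0 →
    (fun w => f w (P.idx l (P.μ l)) -
      (lam l / lam 0 * w (P.idx l (P.μ l))
        - lam l / lam 0 ^ 2 * w (P.idx 0 (P.μ l + 1)) * w (P.idx l (P.μ l))))
    =O[𝓝 0] fun w => ‖w‖ ^ 3) ∧
  (∀ l, l ≠ 0 → l ≠ 1 → P.μ l = P.μ 0 →
    (fun w => f w (P.idx l (P.μ l)) -
      (lam l / lam 0 * w (P.idx l (P.μ l))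
        + a (P.idx l (P.μ l)) / lam 0 * w (P.idx 0 1) * w (P.idx 1 (P.μ 1))))
    =O[𝓝 0] fun w => ‖w‖ ^ 3)

end RhoPartition

end Tower

/-- There is a basis of eigenvectors. -/
def IsDiagonalizable {ι : Type} [Fintype ι] (T : Module.End ℂ (ι → ℂ)) : Prop :=
  ∃ (b : Module.Basis ι ℂ (ι → ℂ)) (c : ι → ℂ), ∀ i, T (b i) = c i • b i

end HolBlowUp

/-! A biholomorphic germ which preserves the center of a blow-up lifts to the blow-up, so the tower
is governed by one linear fact. The complement of `P'_k` is closed under passing to the next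
position of a Jordan block. Hence the subspaces spanned by the `e_h`, `h ∈ P'_k`, form a flag
invariant under `dF_O` (`jordan_mulVec_split`) and, by finite dimension, under its inverse
(`fderiv_inv_split`). The lift acts on `E¹` through `dF_O`, so it preserves the `Y^k`
(`liftMap_mem_linearSub`), and by continuity it preserves their proper transforms
(`liftMap_mem_properTransform`). The centers stay smooth because charts in which the whole flag
consists of coordinate subspaces survive the blow-up of its smallest member
(`hasFlagCharts_properTransform`).

A single blow-up is a manifold because a normal coordinate of a transition map vanishes on the
exceptional divisor, and an analytic function vanishing on a hyperplane is divisible by its equation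
(`AnalyticAt.exists_eq_smul`, `analyticAt_quotient`). The lift of `G` is the identity when it is
read in the chart attached to `φ ∘ G` and the one attached to `φ` (`exists_liftRel`), which gives
existence and analyticity together. Uniqueness holds because the projection is injective on a dense
set (`isLift_unique`).

The differential becomes diagonal because the canonical coordinates are quotients of monomials
(`chart_eq_theta`): `z_1² / z_p` with `p` the last pivot, `z_i / z_{i-1}` in the first block, and
`z_{l,i} / z_{1,i}` in the others. The off-diagonal term `z_{i+1}` of `F_i` is `w_{i+1} z_i`, so
after division by `z_i` it is of higher order, and the quotients `F_{1,i} / z_{1,i}` tend to `λ_1`.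
The quadratic part of `F` could still contribute linear terms through `z_1² / z_{1,i}`. In case (G)
this is `w_1` for `i = μ_1` and of order at least two for smaller `i`, and the other blocks only
involve `i < μ_1`. In case (E) a second block of length `μ_1` would see the linear term; the
additional blow-up turns it into the product of `w_1` and the last coordinate of the second block.

For small `w` all the other coordinates of `z` are `O(‖w‖ |z_1|)`, so among the quadratic terms only
`a_11 z_1²` matters (`regularExpansion`). The expansions are proved where the quotients make sense,
a dense set, and extend by continuity (`isBigO_of_dense`). The fixed point arises as a limit along
this set (`lift_length`), and the fixed points at lower stages are its projections. -/

namespace HolBlowUp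

/-! ### Division of an analytic map by a linear form. -/

section Division

variable {E F : Type*} [NormedAddCommGroup E] [NormedSpace ℂ E] [NormedAddCommGroup F]
  [NormedSpace ℂ F]

/-- The formal quotient by the linear form `L` of the part of the series `p` which is divisible
by it; `e` is a vector with `L e = 1`, and `π` the projection `v ↦ v - L v • e`. -/
noncomputable def divSeries (p : FormalMultilinearSeries ℂ E F) (π : E →L[ℂ] E) (e : E) :
    FormalMultilinearSeries ℂ E F := fun n =>
  ∑ k : Fin (n + 1), ((p (n + 1)).curryMid k e).compContinuousLinearMap
    fun i => if (i : ℕ) < k then π else .id ℂ E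

/-- Telescoping sum: replace `v` by `π v` one slot at a time. The change in slot `k` is the value
with `v - π v = L v • e` in that slot, and `L v` comes out by linearity. -/
theorem divSeries_apply (p : FormalMultilinearSeries ℂ E F) (L : E →L[ℂ] ℂ) (e : E)
    (π : E →L[ℂ] E) (hπ : ∀ v, π v = v - L v • e) (n : ℕ) (v : E) :
    L v • divSeries p π e n (fun _ => v) = p (n + 1) (fun _ => v) - p (n + 1) fun _ => π v := by
  set a : ℕ → F := fun k => p (n + 1) fun i => if (i : ℕ) < k then π v else v with ha
  have h0 : a 0 = p (n + 1) fun _ => v := by simp [ha]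
  have h1 : a (n + 1) = p (n + 1) fun _ => π v := by
    simp only [ha]
    congr 1
    funext i
    exact if_pos i.2
  have hstep : ∀ k : Fin (n + 1), L v • (((p (n + 1)).curryMid k e).compContinuousLinearMap
      fun i => if (i : ℕ) < k then π else .id ℂ E) (fun _ => v) = a k - a (k + 1) := by
    intro k
    have e1 : (fun i : Fin (n + 1) => if (i : ℕ) < k then π v else v)
        = Function.update (fun i : Fin (n + 1) => if (i : ℕ) < k then π v else v) k v := by
      funext i
      by_cases h : i = k
      · subst h; simp
      · simp [h]
    have e2 : (fun i : Fin (n + 1) => if (i : ℕ) < k + 1 then π v else v)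
        = Function.update (fun i : Fin (n + 1) => if (i : ℕ) < k then π v else v) k (π v) := by
      funext i
      by_cases h : i = k
      · subst h; simp
      · have : (i : ℕ) ≠ k := fun e => h (Fin.ext e)
        simp only [Function.update_of_ne h]
        congr 1
        exact propext ⟨fun _ => by omega, fun _ => by omega⟩
    have e3 : k.insertNth e (fun i : Fin n => (if (i : ℕ) < k then π else .id ℂ E) v)
        = Function.update (fun i : Fin (n + 1) => if (i : ℕ) < k then π v else v) k e := by
      funext i
      refine Fin.succAboveCases k ?_ (fun i => ?_) i
      · simp
      · have hne : k.succAbove i ≠ k := Fin.succAbove_ne k i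
        simp only [Fin.insertNth_apply_succAbove, Function.update_of_ne hne]
        have : ((k.succAbove i : Fin (n + 1)) : ℕ) < k ↔ (i : ℕ) < k := by
          rw [← Fin.lt_def, Fin.succAbove_lt_iff_castSucc_lt, Fin.lt_def, Fin.val_castSucc]
        by_cases h : (i : ℕ) < k
        · simp [h, this.2 h]
        · simp only [if_neg h, if_neg (mt this.1 h)]
          rfl
    simp only [ha]
    rw [e1, e2, ← ContinuousMultilinearMap.map_update_sub,
      ContinuousMultilinearMap.compContinuousLinearMap_apply,
      ContinuousMultilinearMap.curryMid_apply, e3, hπ, sub_sub_cancel,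
      ContinuousMultilinearMap.map_update_smul]
  rw [divSeries, sum_apply, Finset.smul_sum,
    Finset.sum_congr rfl fun k _ => hstep k, Fin.sum_univ_eq_sum_range (fun k => a k - a (k + 1)),
    Finset.sum_range_sub', h0, h1]

/-- The `n`-th term is a sum of `n + 1` maps, each bounded by a geometric sequence, so the growth
remains geometric. -/
theorem divSeries_radius_pos (p : FormalMultilinearSeries ℂ E F) (π : E →L[ℂ] E) (e : E)
    (hp : 0 < p.radius) : 0 < (divSeries p π e).radius := by
  obtain ⟨K, a, hK, ha, hb⟩ := p.le_mul_pow_of_radius_pos hp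
  set C : ℝ := max 1 ‖π‖ with hC
  have hC1 : 1 ≤ C := le_max_left _ _
  have hCp : 0 < C := by linarith
  have hnorm : ∀ n, ‖divSeries p π e n‖ ≤ (n + 1) * (K * a ^ (n + 1) * ‖e‖ * C ^ n) := by
    intro n
    refine (norm_sum_le _ _).trans ?_
    have : ∀ k ∈ (Finset.univ : Finset (Fin (n + 1))),
        ‖((p (n + 1)).curryMid k e).compContinuousLinearMap
          fun i => if (i : ℕ) < k then π else .id ℂ E‖ ≤ K * a ^ (n + 1) * ‖e‖ * C ^ n := by
      intro k _
      refine (ContinuousMultilinearMap.norm_compContinuousLinearMap_le _ _).trans ?_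
      have h1 : ‖(p (n + 1)).curryMid k e‖ ≤ K * a ^ (n + 1) * ‖e‖ := by
        refine (ContinuousLinearMap.le_opNorm _ _).trans ?_
        gcongr
        refine le_trans ?_ (hb (n + 1))
        exact MultilinearMap.mkContinuousLinear_norm_le _ (norm_nonneg _) _
      have h2 : ∏ i : Fin n, ‖(if (i : ℕ) < k then π else .id ℂ E : E →L[ℂ] E)‖ ≤ C ^ n := by
        refine (Finset.prod_le_prod (fun _ _ => norm_nonneg _) (g := fun _ => C)
          fun i _ => ?_).trans (by simp)
        split_ifs
        · exact le_max_right _ _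
        · exact ContinuousLinearMap.norm_id_le.trans hC1
      exact mul_le_mul h1 h2 (Finset.prod_nonneg fun _ _ => norm_nonneg _) (by positivity)
    refine (Finset.sum_le_card_nsmul _ _ _ this).trans (by simp)
  -- The factor 2 pays for the number of summands, through `n + 1 ≤ 2 ^ n`.
  have hr : 0 < 1 / (2 * a * C) := by positivity
  obtain ⟨R, hR⟩ : ∃ R : NNReal, (R : ℝ) = 1 / (2 * a * C) := ⟨⟨_, hr.le⟩, rfl⟩
  have hle := (divSeries p π e).le_radius_of_bound (K * a * ‖e‖) (r := R) ?_
  · refine lt_of_lt_of_le ?_ hle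
    rw [ENNReal.coe_pos, ← NNReal.coe_pos, hR]
    exact hr
  · intro n
    rw [hR]
    have h2 : ((n : ℝ) + 1) ≤ 2 ^ n := by
      have := Nat.lt_two_pow_self (n := n)
      exact_mod_cast this
    calc ‖divSeries p π e n‖ * (1 / (2 * a * C)) ^ n
        ≤ (2 ^ n * (K * a ^ (n + 1) * ‖e‖ * C ^ n)) * (1 / (2 * a * C)) ^ n := by
          gcongr
          refine (hnorm n).trans ?_
          gcongr
      _ = K * a * ‖e‖ := by
          rw [one_div, inv_pow, mul_pow, mul_pow]
          field_simp
          ring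

/-- An analytic function which vanishes on a hyperplane is divisible by its equation. -/
theorem AnalyticAt.exists_eq_smul [CompleteSpace F] {f : E → F} {x : E} (hf : AnalyticAt ℂ f x)
    {L : E →L[ℂ] ℂ} {e : E} (he : L e = 1) (hx : L x = 0)
    (h0 : ∀ᶠ y in 𝓝 x, L y = 0 → f y = 0) :
    ∃ g : E → F, AnalyticAt ℂ g x ∧ ∀ᶠ y in 𝓝 x, f y = L y • g y := by
  obtain ⟨p, r, hp⟩ := hf
  set π : E →L[ℂ] E := .id ℂ E - L.smulRight e with hπdef
  have hπ : ∀ v, π v = v - L v • e := fun v => by simp [hπdef]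
  have hq := divSeries_radius_pos p π e hp.radius_pos
  have hs := (divSeries p π e).hasFPowerSeriesOnBall hq
  refine ⟨fun y => (divSeries p π e).sum (y - x), ?_, ?_⟩
  · have := hs.comp_sub x
    rw [zero_add] at this
    exact this.analyticAt
  · have t1 : Tendsto (fun y => y - x) (𝓝 x) (𝓝 0) := by
      have : Continuous fun y => y - x := by fun_prop
      simpa using this.tendsto x
    have t2 : Tendsto (fun y => π (y - x)) (𝓝 x) (𝓝 0) := by
      have := (π.continuous.tendsto 0).comp t1
      rwa [map_zero] at this
    have t3 : Tendsto (fun y => x + π (y - x)) (𝓝 x) (𝓝 x) := by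
      simpa using t2.const_add x
    filter_upwards [t1.eventually (Metric.eball_mem_nhds 0 hp.r_pos),
      t1.eventually (Metric.eball_mem_nhds 0 hq),
      t2.eventually (Metric.eball_mem_nhds 0 hp.r_pos), t3.eventually h0] with y h1 h2 h3 h4
    have s1 := hp.hasSum h1
    have s2 := hp.hasSum h3
    have s3 := hs.hasSum h2
    -- The point `x + π (y - x)` lies on the hyperplane, where `f` vanishes, so the second series
    -- sums to zero and subtracting it does not change the value.
    rw [h4 (by rw [map_add, hπ, map_sub, map_smul, he, hx]; simp)] at s2
    have s4 := s1.sub s2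
    rw [sub_zero, add_sub_cancel] at s4
    have s5 := s3.const_smul (L (y - x))
    simp only [divSeries_apply p L e π hπ, zero_add] at s5
    -- The constant terms cancel; dropping degree zero aligns the degrees with those of the
    -- quotient.
    rw [← hasSum_nat_add_iff' 1] at s4
    simp only [Finset.range_one, Finset.sum_singleton] at s4
    have hz : (p 0 fun _ => y - x) - (p 0 fun _ => π (y - x)) = 0 := by
      rw [sub_eq_zero]; congr 1; funext i; exact i.elim0
    rw [hz, sub_zero] at s4
    rw [s4.unique s5, map_sub, hx, sub_zero]

end Division

/-! ### Analytic structure of the blow-up. -/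

section BlowUpManifold

variable {ι : Type} [Fintype ι] {M : Type} [TopologicalSpace M] [ChartedSpace (ι → ℂ) M]

theorem transition_analyticAt {φ φ' : OpenPartialHomeomorph M (ι → ℂ)}
    (hφ : φ ∈ IsManifold.maximalAtlas 𝓘(ℂ, ι → ℂ) ω M)
    (hφ' : φ' ∈ IsManifold.maximalAtlas 𝓘(ℂ, ι → ℂ) ω M) {p : M} (hp : p ∈ φ.source)
    (hp' : p ∈ φ'.source) : AnalyticAt ℂ (φ' ∘ φ.symm) (φ p) := by
  have h := IsManifold.compatible_of_mem_maximalAtlas hφ hφ'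
  have h2 : ContDiffOn ℂ ω _ _ := (mem_groupoid_of_pregroupoid.1 h).1
  have h3 : ContDiffAt ℂ ω (φ' ∘ φ.symm) (φ p) := by
    refine (h2.contDiffAt ?_)
    simp only [modelWithCornersSelf_coe_symm, preimage_id_eq, id_eq, range_id, inter_univ,
      modelWithCornersSelf_coe]
    refine (OpenPartialHomeomorph.open_source _).mem_nhds ?_
    simp [φ.map_source hp, φ.left_inv hp, hp']
  exact h3.analyticAt

variable {X : TopologicalSpace.Closeds M}

namespace BlowUp

theorem analyticAt_coord (h : ι) (w : ι → ℂ) : AnalyticAt ℂ (fun w : ι → ℂ => w h) w :=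
  (ContinuousLinearMap.proj (R := ℂ) (φ := fun _ : ι => ℂ) h).analyticAt w

theorem analyticAt_blowMap (S : Finset ι) (j : ι) (w : ι → ℂ) :
    AnalyticAt ℂ (blowMap S j) w := by
  refine analyticAt_pi_iff.2 fun h => ?_
  unfold blowMap
  split_ifs
  · exact (analyticAt_coord j w).mul (analyticAt_coord h w)
  · exact analyticAt_coord h w

theorem blowMap_chartFun_off (φ : M → ι → ℂ) (S : Finset ι) {j : ι} {q : M} {hq : q ∉ X}
    (hV2 : φ q j ≠ 0) : blowMap S j (chartFun φ S j (off q hq : BlowUp ι X)) = φ q := by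
  funext h
  simp only [blowMap, chartFun]
  by_cases h1 : h ∈ S ∧ h ≠ j
  · simp [h1.1, h1.2]; field_simp
  · simp only [if_neg h1]

theorem blowMap_chartFun {φ : OpenPartialHomeomorph M (ι → ℂ)} {S : Finset ι}
    (hφ : IsAdapted (X : Set M) φ S) {j : ι} (hj : j ∈ S) {x : BlowUp ι X}
    (hx : x ∈ (chartDom φ φ.source j : Set (BlowUp ι X))) :
    blowMap S j (chartFun φ S j x) = φ x.proj := by
  cases x with
  | off q hq => exact blowMap_chartFun_off φ S hx.2
  | exc p hp hs v =>
    have h0 : chartFun φ S j (exc p hp hs v : BlowUp ι X) j = 0 := by simp [chartFun]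
    funext i
    simp only [blowMap, h0, zero_mul, proj]
    by_cases hi : i ∈ S
    · rw [(hφ.2 p hx.1).1 hp i hi]
      by_cases hij : i = j
      · subst hij; simp [h0]
      · simp [hi, hij]
    · have hij : i ≠ j := fun e => hi (e ▸ hj)
      simp [hi, chartFun, hij]

theorem proj_mem_of_mem_chartDom {φ : M → ι → ℂ} {V : Set M} {j : ι} {x : BlowUp ι X}
    (hx : x ∈ (chartDom φ V j : Set (BlowUp ι X))) : x.proj ∈ V := by
  cases x <;> exact hx.1

/-- Off the center each chart of the blow-up factors through a chart of `M`, the extra map `D` being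
the identity or division by `z_j`. Together with `off_left_analytic`, which treats the inverse, this
reduces compatibility there to the transition maps of `M`. -/
theorem IsPreChart.off_right_analytic [IsManifold 𝓘(ℂ, ι → ℂ) ω M] {f : BlowUp ι X → ι → ℂ}
    {V : Set (BlowUp ι X)} (h : IsPreChart f V) {q : M} {hq : q ∉ X} (hV : off q hq ∈ V) :
    ∃ φ ∈ IsManifold.maximalAtlas 𝓘(ℂ, ι → ℂ) ω M, q ∈ φ.source ∧
      ∃ D : (ι → ℂ) → ι → ℂ, AnalyticAt ℂ D (φ q) ∧
      ∀ᶠ q' in 𝓝 q, ∀ h' : q' ∉ X, off q' h' ∈ V ∧ f (off q' h') = D (φ q') := by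
  cases h with
  | ofOff φ hφ =>
    refine ⟨φ, IsManifold.subset_maximalAtlas hφ, hV.1, id, analyticAt_id, ?_⟩
    filter_upwards [φ.open_source.mem_nhds hV.1] with q' hq' h'
    exact ⟨⟨hq', h'⟩, rfl⟩
  | ofExc φ S hφ j hj =>
    have c : ContinuousAt (fun q => φ q j) q :=
      (continuous_apply j).continuousAt.comp (φ.continuousAt hV.1)
    classical
    refine ⟨φ, hφ.1, hV.1, fun w h => if h ∈ S ∧ h ≠ j then w h / w j else w h, ?_, ?_⟩
    · refine analyticAt_pi_iff.2 fun h => ?_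
      split_ifs
      · exact (analyticAt_coord h _).div (analyticAt_coord j _) hV.2
      · exact analyticAt_coord h _
    · filter_upwards [φ.open_source.mem_nhds hV.1, c.eventually_ne hV.2] with q' h1 h2 h'
      refine ⟨⟨h1, h2⟩, ?_⟩
      funext h
      simp only [chartFun]

theorem IsPreChart.off_left_analytic [IsManifold 𝓘(ℂ, ι → ℂ) ω M] {f : BlowUp ι X → ι → ℂ}
    {V : Set (BlowUp ι X)} (h : IsPreChart f V) {q : M} {hq : q ∉ X} (hV : off q hq ∈ V) :
    ∃ φ ∈ IsManifold.maximalAtlas 𝓘(ℂ, ι → ℂ) ω M, q ∈ φ.source ∧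
      ∃ B : (ι → ℂ) → ι → ℂ, AnalyticAt ℂ B (f (off q hq)) ∧ B (f (off q hq)) = φ q ∧
      ∀ᶠ w in 𝓝 (f (off q hq)), ∃ h' : φ.symm (B w) ∉ X,
        off (φ.symm (B w)) h' ∈ V ∧ f (off (φ.symm (B w)) h') = w := by
  cases h with
  | ofOff φ hφ =>
    have hc := φ.continuousAt_symm (φ.map_source hV.1)
    refine ⟨φ, IsManifold.subset_maximalAtlas hφ, hV.1, id, analyticAt_id, rfl, ?_⟩
    have : ∀ᶠ w in 𝓝 (φ q), φ.symm w ∉ X := by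
      refine hc.eventually_mem (X.isClosed.isOpen_compl.mem_nhds ?_)
      rw [φ.left_inv hV.1]; exact hq
    filter_upwards [this, φ.open_target.mem_nhds (φ.map_source hV.1)] with w h1 h2
    exact ⟨h1, ⟨φ.map_target h2, h1⟩, φ.right_inv h2⟩
  | ofExc φ S hφ j hj =>
    have hV2 : φ q j ≠ 0 := hV.2
    have hb := blowMap_chartFun hφ hj hV
    refine ⟨φ, hφ.1, hV.1, blowMap S j, analyticAt_blowMap S j _, hb, ?_⟩
    have e1 : ∀ᶠ w in 𝓝 (chartFun φ S j (off q hq : BlowUp ι X)), blowMap S j w ∈ φ.target := by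
      refine (continuous_blowMap S j).continuousAt.eventually_mem (φ.open_target.mem_nhds ?_)
      rw [hb]; exact φ.map_source hV.1
    have e2 : ∀ᶠ w in 𝓝 (chartFun φ S j (off q hq : BlowUp ι X)), w j ≠ 0 := by
      refine (continuous_apply j).continuousAt.eventually_ne ?_
      simpa [chartFun] using hV2
    filter_upwards [e1, e2] with w h1 h2
    obtain ⟨y, hy, hy2, hy3⟩ := exists_chartFun_eq (X := X) hφ hj h1
    cases y with
    | off q' hq' =>
      simp only [proj] at hy3
      subst hy3
      exact ⟨hq', hy, hy2⟩
    | exc p hp hs v =>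
      exfalso
      apply h2
      rw [← hy2]; simp [chartFun]

/-- The quotient of the normal coordinates of the transition map by the equation of the exceptional
divisor is analytic. -/
theorem analyticAt_quotient {φ φ' : OpenPartialHomeomorph M (ι → ℂ)} {S S' : Finset ι}
    (hφ : IsAdapted (X : Set M) φ S) (hφ' : IsAdapted (X : Set M) φ' S') {j : ι} (hj : j ∈ S)
    {p : M} (hp : p ∈ φ.source) (hp' : p ∈ φ'.source) {w₀ : ι → ℂ}
    (hw₀ : w₀ j = 0) (hb : blowMap S j w₀ = φ p) {h : ι} (hh : h ∈ S') :
    AnalyticAt ℂ (fun w => if w j = 0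
      then fderiv ℂ (φ' ∘ φ.symm) (blowMap S j w) (dirOf S j w) h
      else (φ' ∘ φ.symm) (blowMap S j w) h / w j) w₀ := by
  classical
  set g := φ' ∘ φ.symm with hg
  have ga : AnalyticAt ℂ g (blowMap S j w₀) := by
    rw [hb]; exact transition_analyticAt hφ.1 hφ'.1 hp hp'
  have fa : AnalyticAt ℂ (fun w => g (blowMap S j w) h) w₀ :=
    analyticAt_pi_iff.1 (ga.comp (analyticAt_blowMap S j w₀)) h
  have cb : Tendsto (blowMap S j) (𝓝 w₀) (𝓝 (φ p)) := by
    rw [← hb]; exact (continuous_blowMap S j).continuousAt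
  -- Points with `w j = 0` project into the center, where the normal coordinates of `φ'` vanish;
  -- this is the divisibility hypothesis.
  have hz : ∀ᶠ w in 𝓝 w₀, w j = 0 → g (blowMap S j w) h = 0 := by
    have m1 : ∀ᶠ z in 𝓝 (φ p), z ∈ φ.target := φ.open_target.mem_nhds (φ.map_source hp)
    have m2 : ∀ᶠ z in 𝓝 (φ p), φ.symm z ∈ φ'.source := by
      refine (φ.continuousAt_symm (φ.map_source hp)).eventually_mem ?_
      rw [φ.left_inv hp]; exact φ'.open_source.mem_nhds hp'
    filter_upwards [cb.eventually m1, cb.eventually m2] with w h1 h2 hwj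
    refine (hφ'.2 _ h2).1 ?_ h hh
    rw [hφ.2 _ (φ.map_target h1), φ.right_inv h1]
    intro i hi
    by_cases hij : i = j
    · subst hij; simp [blowMap, hwj]
    · simp [blowMap, hij, hi, hwj]
  -- The analytic quotient agrees with the given function where `w j ≠ 0`. It remains to identify
  -- its values on `w j = 0` with the derivatives of the transition map.
  obtain ⟨q, qa, hq⟩ := AnalyticAt.exists_eq_smul fa
    (L := ContinuousLinearMap.proj (R := ℂ) (φ := fun _ : ι => ℂ) j) (e := Pi.single j 1)
    (by simp) hw₀ hz
  refine qa.congr ?_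
  have ga' : ∀ᶠ w in 𝓝 w₀, AnalyticAt ℂ g (blowMap S j w) := by
    rw [hb] at ga
    exact cb.eventually ga.eventually_analyticAt
  filter_upwards [hq.eventually_nhds, ga', qa.eventually_analyticAt] with w h1 h2 h3
  have h1' := h1.self_of_nhds
  simp only [ContinuousLinearMap.proj_apply, smul_eq_mul] at h1' h1
  by_cases hwj : w j = 0
  · rw [if_pos hwj]
    have hl : HasDerivAt (fun t : ℂ => w + t • (Pi.single j 1 : ι → ℂ)) (Pi.single j 1) 0 := by
      simpa using ((hasDerivAt_id (0 : ℂ)).smul_const (Pi.single j 1 : ι → ℂ)).const_add w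
    have hl0 : w + (0 : ℂ) • (Pi.single j 1 : ι → ℂ) = w := by simp
    -- Starting on the divisor, the line in direction `e_j` projects to a line with velocity `dirOf
    -- S j w`. Differentiating `g_h ∘ blowMap = w_j q` along it at `t = 0` gives the derivative on
    -- one side and `q w` on the other.
    have hline : ∀ t : ℂ, blowMap S j (w + t • (Pi.single j 1 : ι → ℂ))
        = blowMap S j w + t • dirOf S j w := by
      intro t
      funext i
      by_cases hij : i = j
      · subst hij; simp [blowMap, dirOf]
      · by_cases hi : i ∈ S <;> simp [blowMap, dirOf, hij, hi, hwj]
    have hl2 : HasDerivAt (fun t : ℂ => blowMap S j (w + t • (Pi.single j 1 : ι → ℂ)))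
        (dirOf S j w) 0 := by
      simp only [hline]
      simpa using ((hasDerivAt_id (0 : ℂ)).smul_const (dirOf S j w)).const_add (blowMap S j w)
    have d1 : HasDerivAt (fun t : ℂ => g (blowMap S j (w + t • (Pi.single j 1 : ι → ℂ))))
        (fderiv ℂ g (blowMap S j w) (dirOf S j w)) 0 := by
      refine HasFDerivAt.comp_hasDerivAt (0 : ℂ) (l := g) ?_ hl2
      rw [hl0]
      exact h2.differentiableAt.hasFDerivAt
    have d1h := hasDerivAt_pi.1 d1 h
    have d2 : HasDerivAt (fun t : ℂ => t * q (w + t • (Pi.single j 1 : ι → ℂ))) (q w) 0 := by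
      have h3' : DifferentiableAt ℂ q (w + (0 : ℂ) • (Pi.single j 1 : ι → ℂ)) := by
        rw [hl0]; exact h3.differentiableAt
      have := (hasDerivAt_id (0 : ℂ)).mul
        (h3'.hasFDerivAt.comp_hasDerivAt (0 : ℂ) hl)
      simp only [id, one_mul, zero_mul, add_zero, Function.comp, hl0] at this
      exact this
    have ev : (fun t : ℂ => g (blowMap S j (w + t • (Pi.single j 1 : ι → ℂ))) h) =ᶠ[𝓝 0]
        fun t => t * q (w + t • (Pi.single j 1 : ι → ℂ)) := by
      have ct : Tendsto (fun t : ℂ => w + t • (Pi.single j 1 : ι → ℂ)) (𝓝 0) (𝓝 w) := by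
        have := hl.continuousAt.tendsto
        rwa [hl0] at this
      filter_upwards [ct.eventually h1] with t ht
      rw [ht]; simp [hwj]
    exact (d2.congr_of_eventuallyEq ev).unique d1h
  · rw [if_neg hwj, h1']
    field_simp

/-- Over the center the transition map has components `H_h / H_k`, where `H` consists of the normal
coordinates divided by the equation of the exceptional divisor, together with tangential coordinates
that are simply composed with `blowMap`. -/
theorem IsPreChart.compat_analytic [IsManifold 𝓘(ℂ, ι → ℂ) ω M] {f f' : BlowUp ι X → ι → ℂ}
    {V V' : Set (BlowUp ι X)} (h : IsPreChart f V) (h' : IsPreChart f' V') {x : BlowUp ι X}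
    (hx : x ∈ V) (hx' : x ∈ V') :
    ∃ T : (ι → ℂ) → ι → ℂ, AnalyticAt ℂ T (f x) ∧
      ∀ᶠ w in 𝓝 (f x), ∃ y ∈ V ∩ V', f y = w ∧ f' y = T w := by
  cases x with
  | off q hq =>
    obtain ⟨φ, hφ, hqφ, B, hB, hBq, hB'⟩ := h.off_left_analytic hx
    obtain ⟨φ', hφ', hqφ', D, hD, hD'⟩ := h'.off_right_analytic hx'
    have hc : Tendsto (fun w => φ.symm (B w)) (𝓝 (f (off q hq))) (𝓝 q) := by
      have h1 := (φ.continuousAt_symm (φ.map_source hqφ)).tendsto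
      rw [φ.left_inv hqφ, ← hBq] at h1
      exact h1.comp hB.continuousAt.tendsto
    refine ⟨fun w => D ((φ' ∘ φ.symm) (B w)), ?_, ?_⟩
    · have ht := transition_analyticAt hφ hφ' hqφ hqφ'
      rw [← hBq] at ht
      have h2 := ht.comp hB
      refine AnalyticAt.comp (f := fun w => (φ' ∘ φ.symm) (B w)) (g := D) ?_ h2
      simp only [hBq, Function.comp, φ.left_inv hqφ]
      exact hD
    · filter_upwards [hB', hc.eventually hD'] with w h1 h2
      obtain ⟨h3, h4, h5⟩ := h1
      exact ⟨off (φ.symm (B w)) h3, ⟨h4, (h2 h3).1⟩, h5, (h2 h3).2⟩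
  | exc p hp hs v =>
    cases h with
    | ofOff φ hφ => exact absurd hp hx.2
    | ofExc φ S hφ j hj =>
    cases h' with
    | ofOff φ' hφ' => exact absurd hp hx'.2
    | ofExc φ' S' hφ' k hk =>
    classical
    have h0 : chartFun φ S j (exc p hp hs v : BlowUp ι X) j = 0 := by simp [chartFun]
    have hb := blowMap_chartFun hφ hj hx
    set w₀ := chartFun φ S j (exc p hp hs v : BlowUp ι X) with hw₀
    simp only [proj] at hb
    let H : (ι → ℂ) → ι → ℂ := fun w h => if w j = 0
      then fderiv ℂ (φ' ∘ φ.symm) (blowMap S j w) (dirOf S j w) h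
      else (φ' ∘ φ.symm) (blowMap S j w) h / w j
    have hHc : ∀ h ∈ S', AnalyticAt ℂ (fun w => H w h) w₀ := fun h hh =>
      analyticAt_quotient hφ hφ' hj hx.1 hx'.1 h0 hb hh
    have cb : Tendsto (blowMap S j) (𝓝 w₀) (𝓝 (φ p)) := by
      rw [← hb]; exact (continuous_blowMap S j).continuousAt
    -- The denominator does not vanish precisely because the point lies in the domain of the second
    -- chart.
    have hHk : H w₀ k ≠ 0 := by
      refine ((chartFun_transition hφ hφ' hj hk hx hx'.1 (H := H w₀) fun i => ?_).1).1 hx'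
      simp only [H, ← hw₀, h0, if_true, hb, proj]
    refine ⟨fun w h => if h ∈ S' ∧ h ≠ k then H w h / H w k else (φ' ∘ φ.symm) (blowMap S j w) h,
      ?_, ?_⟩
    · refine analyticAt_pi_iff.2 fun i => ?_
      split_ifs with hi
      · exact (hHc i hi.1).div (hHc k hk) hHk
      · have h1 := transition_analyticAt hφ.1 hφ'.1 hx.1 hx'.1
        rw [← hb] at h1
        exact analyticAt_pi_iff.1 (h1.comp (analyticAt_blowMap S j w₀)) i
    · have m1 : ∀ᶠ z in 𝓝 (φ p), z ∈ φ.target := φ.open_target.mem_nhds (φ.map_source hx.1)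
      have m2 : ∀ᶠ z in 𝓝 (φ p), φ.symm z ∈ φ'.source := by
        refine (φ.continuousAt_symm (φ.map_source hx.1)).eventually_mem ?_
        rw [φ.left_inv hx.1]; exact φ'.open_source.mem_nhds hx'.1
      filter_upwards [cb.eventually m1, cb.eventually m2,
        (hHc k hk).continuousAt.eventually_ne hHk] with w h1 h2 h3
      obtain ⟨y, hy, hyw, hyp⟩ := exists_chartFun_eq (X := X) hφ hj h1
      have hφy : φ y.proj = blowMap S j w := by rw [hyp, φ.right_inv h1]
      obtain ⟨t1, t2⟩ := chartFun_transition hφ hφ' hj hk hy (by rw [hyp]; exact h2) (H := H w)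
        (fun i => by simp only [H, hyw, hφy]; rw [hyp]; rfl)
      refine ⟨y, ⟨hy, t1.2 h3⟩, hyw, ?_⟩
      funext i
      rw [t2 i, hyp]
      rfl

theorem preAtlas_compat_analytic [IsManifold 𝓘(ℂ, ι → ℂ) ω M]
    {e e' : PartialEquiv (BlowUp ι X) (ι → ℂ)} (he : e ∈ preAtlas ι X)
    (he' : e' ∈ preAtlas ι X) {w : ι → ℂ} (hw : w ∈ (e.symm.trans e').source) :
    AnalyticAt ℂ (e.symm.trans e') w := by
  obtain ⟨f, V, h, hs, hf⟩ := he
  obtain ⟨f', V', h', hs', hf'⟩ := he'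
  rw [PartialEquiv.trans_source] at hw
  have hx : e.symm w ∈ V := hs ▸ e.map_target hw.1
  have hx' : e.symm w ∈ V' := hs' ▸ hw.2
  have hfw : f (e.symm w) = w := by rw [← hf hx]; exact e.right_inv hw.1
  obtain ⟨T, hT, hT'⟩ := h.compat_analytic h' hx hx'
  rw [hfw] at hT hT'
  refine hT.congr ?_
  filter_upwards [hT'] with z hz
  obtain ⟨y, hy, hyz, hyT⟩ := hz
  have hys : y ∈ e.source := hs ▸ hy.1
  have hez : e y = z := by rw [hf hy.1, hyz]
  have hyz' : e.symm z = y := by rw [← hez]; exact e.left_inv hys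
  change T z = e' (e.symm z)
  rw [hyz', hf' hy.2, hyT]

theorem mem_atlas_iff {e : OpenPartialHomeomorph (BlowUp ι X) (ι → ℂ)} :
    e ∈ atlas (ι → ℂ) (BlowUp ι X) ↔
      ∃ (e₀ : PartialEquiv (BlowUp ι X) (ι → ℂ)) (h : e₀ ∈ preAtlas ι X),
        e = (core ι X).openPartialHomeomorph e₀ h := by
  change e ∈ ⋃ (e₀ : PartialEquiv (BlowUp ι X) (ι → ℂ)) (h : e₀ ∈ (core ι X).atlas),
    {(core ι X).openPartialHomeomorph e₀ h} ↔ _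
  simp only [mem_iUnion, mem_singleton_iff]
  rfl

instance isManifold [IsManifold 𝓘(ℂ, ι → ℂ) ω M] :
    IsManifold 𝓘(ℂ, ι → ℂ) ω (BlowUp ι X) := by
  refine isManifold_of_contDiffOn _ _ _ fun e e' he he' => ?_
  obtain ⟨e0, he0, rfl⟩ := mem_atlas_iff.1 he
  obtain ⟨e0', he0', rfl⟩ := mem_atlas_iff.1 he'
  intro w hw
  have hw' : w ∈ (e0.symm.trans e0').source := hw.1
  have := preAtlas_compat_analytic he0 he0' hw'
  exact (this.contDiffAt (n := ω)).contDiffWithinAt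

theorem IsPreChart.exists_chart {f : BlowUp ι X → ι → ℂ} {V : Set (BlowUp ι X)}
    (h : IsPreChart f V) [Nonempty (BlowUp ι X)] :
    ∃ e ∈ atlas (ι → ℂ) (BlowUp ι X), e.source = V ∧ ∀ x, e x = f x := by
  have hmem : (h.injOn.bijOn_image).toPartialEquiv f V _ ∈ preAtlas ι X :=
    ⟨f, V, h, rfl, fun _ _ => rfl⟩
  exact ⟨(core ι X).openPartialHomeomorph _ hmem, mem_atlas_iff.2 ⟨_, hmem, rfl⟩, rfl, fun _ => rfl⟩

end BlowUp

end BlowUpManifold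

/-! ### Projection and topology of the blow-up. -/

theorem dense_forall_ne_zero (ι : Type*) : Dense {w : ι → ℂ | ∀ h, w h ≠ 0} := by
  have := dense_pi (univ : Set ι) (s := fun _ => ({0}ᶜ : Set ℂ)) fun i _ => dense_compl_singleton 0
  refine this.mono fun w hw h => ?_
  exact hw h (mem_univ h)

theorem exists_mem_of_dense {A B : Type*} [TopologicalSpace A] [TopologicalSpace B]
    (e : OpenPartialHomeomorph A B) {D : Set B} (hD : Dense D) {x : A} (hx : x ∈ e.source)
    {O : Set A} (hO : O ∈ 𝓝 x) : ∃ y ∈ O, y ∈ e.source ∧ e y ∈ D := by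
  have h1 : O ∩ e.source ∈ 𝓝 x := inter_mem hO (e.open_source.mem_nhds hx)
  obtain ⟨w, ⟨y, hy, rfl⟩, hw⟩ := mem_closure_iff_nhds.1 (hD (e x)) _ (e.image_mem_nhds hx h1)
  exact ⟨y, hy.1, hy.2, hw⟩

section BlowUpTopology

variable {ι : Type} [Fintype ι] {M : Type} [TopologicalSpace M] [ChartedSpace (ι → ℂ) M]
  {X : TopologicalSpace.Closeds M}

namespace BlowUp

variable [IsManifold 𝓘(ℂ, ι → ℂ) ω M]

/-- The map `χ_j` attached to an adapted chart is a chart of the blow-up. -/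
theorem exists_excChart [Nonempty (BlowUp ι X)] {φ : OpenPartialHomeomorph M (ι → ℂ)}
    {S : Finset ι} (hφ : IsAdapted (X : Set M) φ S) {j : ι} (hj : j ∈ S) :
    ∃ e ∈ IsManifold.maximalAtlas 𝓘(ℂ, ι → ℂ) ω (BlowUp ι X),
      e.source = chartDom φ φ.source j ∧ (∀ x, e x = chartFun φ S j x) ∧
      e.target = {w | blowMap S j w ∈ φ.target} := by
  obtain ⟨e, he, hs, hf⟩ := (IsPreChart.ofExc φ S hφ j hj).exists_chart
  refine ⟨e, IsManifold.subset_maximalAtlas he, hs, hf, ?_⟩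
  ext w
  constructor
  · intro hw
    have h1 := e.map_target hw
    have h2 := e.right_inv hw
    rw [hs] at h1
    rw [hf] at h2
    have h3 := blowMap_chartFun hφ hj h1
    rw [h2] at h3
    rw [mem_ofPred_eq, h3]
    exact φ.map_source (proj_mem_of_mem_chartDom h1)
  · intro hw
    obtain ⟨y, hy, hyw, -⟩ := exists_chartFun_eq (X := X) hφ hj hw
    rw [← hyw, ← hf]
    exact e.map_source (hs ▸ hy)

/-- A non-zero normal vector has a non-zero normal coordinate, so the charts attached to one adapted
chart cover the fibers over its domain. -/
theorem exists_mem_chartDom {x : BlowUp ι X} (hx : x.proj ∈ X)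
    {φ : OpenPartialHomeomorph M (ι → ℂ)} {S : Finset ι} (hφ : IsAdapted (X : Set M) φ S)
    (hxφ : x.proj ∈ φ.source) : ∃ j ∈ S, x ∈ (chartDom φ φ.source j : Set (BlowUp ι X)) := by
  cases x with
  | off q hq => exact absurd hx hq
  | exc p hp hs v =>
    change p ∈ φ.source at hxφ
    obtain ⟨u, hu⟩ := Submodule.Quotient.mk_surjective _ v.rep
    have : ∃ j ∈ S, dnormal φ p v.rep j ≠ 0 := by
      by_contra! hcon
      refine v.rep_nonzero ?_
      rw [← hu, Submodule.Quotient.mk_eq_zero, mem_tangentOf hφ hxφ hp]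
      intro h hh
      rw [← dnormal_mk hφ hxφ hp u hh, hu]
      exact hcon h hh
    obtain ⟨j, hj, hne⟩ := this
    exact ⟨j, hj, hxφ, hne⟩

theorem isSubmanifoldAt_proj {x : BlowUp ι X} (hx : x.proj ∈ X) :
    IsSubmanifoldAt ι (X : Set M) x.proj := by
  cases x with
  | off q hq => exact absurd hx hq
  | exc p hp hs v => exact hs

theorem chartFun_pivot_eq_zero_iff {φ : M → ι → ℂ} {V : Set M} {S : Finset ι} {j : ι}
    {x : BlowUp ι X} (hx : x ∈ (chartDom φ V j : Set (BlowUp ι X))) :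
    chartFun φ S j x j = 0 ↔ x.proj ∈ X := by
  cases x with
  | off q hq => simpa [chartFun, proj, hq] using hx.2
  | exc p hp hs v => simp [chartFun, proj, hp]

/-- In both kinds of charts the projection reads `φ⁻¹ ∘ B ∘ e` with `B` polynomial: `blowMap` over
the center, the identity elsewhere. -/
theorem contMDiff_proj :
    ContMDiff 𝓘(ℂ, ι → ℂ) 𝓘(ℂ, ι → ℂ) ω (proj : BlowUp ι X → M) := by
  intro x
  have : Nonempty (BlowUp ι X) := ⟨x⟩
  have hcase : ∃ e ∈ IsManifold.maximalAtlas 𝓘(ℂ, ι → ℂ) ω (BlowUp ι X),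
      ∃ φ ∈ IsManifold.maximalAtlas 𝓘(ℂ, ι → ℂ) ω M, ∃ B : (ι → ℂ) → ι → ℂ, x ∈ e.source ∧
        (∀ w, AnalyticAt ℂ B w) ∧ ∀ y ∈ e.source, y.proj ∈ φ.source ∧ B (e y) = φ y.proj := by
    by_cases hx : x.proj ∈ X
    · obtain ⟨φ, S, hφ, hxφ⟩ := isSubmanifoldAt_proj hx
      obtain ⟨j, hj, hxj⟩ := exists_mem_chartDom hx hφ hxφ
      obtain ⟨e, he, hs, hf, -⟩ := exists_excChart hφ hj
      refine ⟨e, he, φ, hφ.1, blowMap S j, hs ▸ hxj, analyticAt_blowMap S j, fun y hy => ?_⟩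
      rw [hs] at hy
      exact ⟨proj_mem_of_mem_chartDom hy, by rw [hf]; exact blowMap_chartFun hφ hj hy⟩
    · obtain ⟨e, he, hs, hf⟩ :=
        (IsPreChart.ofOff (X := X) _ (chart_mem_atlas (ι → ℂ) x.proj)).exists_chart
      refine ⟨e, IsManifold.subset_maximalAtlas he, _,
        IsManifold.subset_maximalAtlas (chart_mem_atlas (ι → ℂ) x.proj), id,
        hs ▸ ⟨mem_chart_source _ _, hx⟩, fun _ => analyticAt_id, fun y hy => ?_⟩
      rw [hs] at hy
      exact ⟨hy.1, hf y⟩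
  obtain ⟨e, he, φ, hφ, B, hx, hB, h⟩ := hcase
  have c1 := contMDiffAt_of_mem_maximalAtlas he hx
  have c2 : ContMDiffAt 𝓘(ℂ, ι → ℂ) 𝓘(ℂ, ι → ℂ) ω B (e x) :=
    (hB _).contDiffAt.contMDiffAt
  have c3 : ContMDiffAt 𝓘(ℂ, ι → ℂ) 𝓘(ℂ, ι → ℂ) ω φ.symm (B (e x)) := by
    refine contMDiffAt_symm_of_mem_maximalAtlas hφ ?_
    rw [(h x hx).2]
    exact φ.map_source (h x hx).1
  refine (c3.comp x (c2.comp x c1)).congr_of_eventuallyEq ?_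
  filter_upwards [e.open_source.mem_nhds hx] with y hy
  simp only [Function.comp]
  rw [(h y hy).2, φ.left_inv (h y hy).1]

theorem continuous_proj : Continuous (proj : BlowUp ι X → M) := contMDiff_proj.continuous

open Classical in
/-- The inverse of the projection outside of the center. -/
noncomputable def ofOff [Nonempty (BlowUp ι X)] (q : M) : BlowUp ι X :=
  if h : q ∉ X then off q h else Classical.arbitrary _

theorem proj_ofOff [Nonempty (BlowUp ι X)] {q : M} (h : q ∉ X) :
    (ofOff q : BlowUp ι X).proj = q := by
  simp [ofOff, h, proj]

theorem eq_of_proj_eq {x y : BlowUp ι X} (h : x.proj = y.proj) (hx : x.proj ∉ X) : x = y := by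
  cases x with
  | off q hq =>
    cases y with
    | off q' hq' => simp only [proj] at h; subst h; rfl
    | exc p hp hs v => simp only [proj] at h; subst h; exact absurd hp hx
  | exc p hp hs v => exact absurd hp hx

theorem contMDiffOn_ofOff [Nonempty (BlowUp ι X)] :
    ContMDiffOn 𝓘(ℂ, ι → ℂ) 𝓘(ℂ, ι → ℂ) ω (ofOff : M → BlowUp ι X) (X : Set M)ᶜ := by
  intro q hq
  refine ContMDiffAt.contMDiffWithinAt ?_
  set φ := chartAt (ι → ℂ) q with hφ
  obtain ⟨e, he, hs, hf⟩ := (IsPreChart.ofOff (X := X) φ (chart_mem_atlas _ q)).exists_chart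
  have c1 := contMDiffAt_of_mem_maximalAtlas (I := 𝓘(ℂ, ι → ℂ)) (n := ω)
    (IsManifold.subset_maximalAtlas (chart_mem_atlas (ι → ℂ) q)) (mem_chart_source (ι → ℂ) q)
  have key : ∀ q' ∈ φ.source, q' ∉ X → φ q' ∈ e.target ∧ e.symm (φ q') = ofOff q' := by
    intro q' h1 h2
    have h3 : (ofOff q' : BlowUp ι X) ∈ e.source := by
      rw [hs]
      exact ⟨by rw [proj_ofOff h2]; exact h1, by rw [proj_ofOff h2]; exact h2⟩
    have h4 : e (ofOff q' : BlowUp ι X) = φ q' := by rw [hf, proj_ofOff h2]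
    rw [← h4]
    exact ⟨e.map_source h3, e.left_inv h3⟩
  have c2 : ContMDiffAt 𝓘(ℂ, ι → ℂ) 𝓘(ℂ, ι → ℂ) ω e.symm (φ q) :=
    contMDiffAt_symm_of_mem_maximalAtlas (IsManifold.subset_maximalAtlas he)
      (key q (mem_chart_source _ q) hq).1
  refine (c2.comp q c1).congr_of_eventuallyEq ?_
  filter_upwards [φ.open_source.mem_nhds (mem_chart_source _ q),
    X.isClosed.isOpen_compl.mem_nhds hq] with q' h1 h2
  exact (key q' h1 h2).2.symm

variable (X) in
/-- The projection is an isomorphism outside of the center. -/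
noncomputable def offHomeo [Nonempty (BlowUp ι X)] : OpenPartialHomeomorph (BlowUp ι X) M where
  toFun := proj
  invFun := ofOff
  source := proj ⁻¹' (X : Set M)ᶜ
  target := (X : Set M)ᶜ
  map_source' _ hx := hx
  map_target' q hq := by
    rw [mem_preimage, proj_ofOff hq]
    exact hq
  left_inv' x hx := (eq_of_proj_eq (proj_ofOff hx).symm hx).symm
  right_inv' q hq := proj_ofOff hq
  open_source := X.isClosed.isOpen_compl.preimage continuous_proj
  open_target := X.isClosed.isOpen_compl
  continuousOn_toFun := continuous_proj.continuousOn
  continuousOn_invFun := contMDiffOn_ofOff.continuousOn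

/-- Off the center, `IsPreChart` only uses the charts of the given atlas. Composing with `offHomeo`
admits every chart of the maximal atlas, as is needed for charts adapted to a flag. -/
theorem exists_offChart [Nonempty (BlowUp ι X)] {φ : OpenPartialHomeomorph M (ι → ℂ)}
    (hφ : φ ∈ IsManifold.maximalAtlas 𝓘(ℂ, ι → ℂ) ω M) :
    ∃ e ∈ IsManifold.maximalAtlas 𝓘(ℂ, ι → ℂ) ω (BlowUp ι X),
      e.source = offDom φ.source ∧ ∀ x, e x = φ x.proj := by
  have hs : ((offHomeo (ι := ι) X).trans φ).source = offDom φ.source := by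
    rw [OpenPartialHomeomorph.trans_source]
    exact inter_comm _ _
  refine ⟨(offHomeo (ι := ι) X).trans φ, ?_, hs, fun _ => rfl⟩
  refine OpenPartialHomeomorph.mem_maximalAtlas_of_contMDiffOn _ ?_ ?_
  · refine (contMDiffOn_of_mem_maximalAtlas hφ).comp contMDiff_proj.contMDiffOn fun x hx => ?_
    exact hx.2
  · refine contMDiffOn_ofOff.comp
      ((contMDiffOn_symm_of_mem_maximalAtlas hφ).mono fun x hx => hx.1) fun x hx => ?_
    exact hx.2

/-- In a chart the exceptional divisor is the hyperplane `w j = 0`, and points with all coordinates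
non-zero are dense. -/
theorem dense_proj_notMem : Dense {x : BlowUp ι X | x.proj ∉ X} := by
  intro x
  have : Nonempty (BlowUp ι X) := ⟨x⟩
  by_cases hx : x.proj ∈ X
  · obtain ⟨φ, S, hφ, hxφ⟩ := isSubmanifoldAt_proj hx
    obtain ⟨j, hj, hxj⟩ := exists_mem_chartDom hx hφ hxφ
    obtain ⟨e, he, hs, hf, -⟩ := exists_excChart hφ hj
    refine mem_closure_iff_nhds.2 fun O hO => ?_
    obtain ⟨y, hyO, hys, hy⟩ := exists_mem_of_dense e (dense_forall_ne_zero ι) (hs ▸ hxj) hO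
    rw [hs] at hys
    rw [hf] at hy
    exact ⟨y, hyO, fun hc => hy j ((chartFun_pivot_eq_zero_iff hys).2 hc)⟩
  · exact subset_closure hx

theorem dense_preimage_proj {D : Set M} (hD : Dense D) : Dense (proj ⁻¹' D : Set (BlowUp ι X)) := by
  intro x
  have : Nonempty (BlowUp ι X) := ⟨x⟩
  refine mem_closure_iff_nhds.2 fun O hO => ?_
  obtain ⟨O', hO'O, hO', hxO'⟩ := mem_nhds_iff.1 hO
  obtain ⟨y, hyO, hy⟩ := mem_closure_iff_nhds.1 (dense_proj_notMem (X := X) x) O hO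
  obtain ⟨y, hyO, hy⟩ := mem_closure_iff_nhds.1 (dense_proj_notMem (X := X) x) O'
    (hO'.mem_nhds hxO')
  obtain ⟨z, hzO, -, hz⟩ := exists_mem_of_dense (offHomeo (ι := ι) X) hD (x := y) hy (hO'.mem_nhds hyO)
  exact ⟨z, hO'O hzO, hz⟩

/-- The quotients `z_k / z_j` and `z_j / z_k` are inverse to each other, so they cannot both have
modulus less than one. This separates points of the same fiber in `t2Space`. -/
theorem chartFun_mul_chartFun {φ : OpenPartialHomeomorph M (ι → ℂ)} {S : Finset ι} {j k : ι}
    (hj : j ∈ S) (hk : k ∈ S) (hjk : j ≠ k) {x : BlowUp ι X}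
    (hxj : x ∈ (chartDom φ φ.source j : Set (BlowUp ι X)))
    (hxk : x ∈ (chartDom φ φ.source k : Set (BlowUp ι X))) :
    chartFun φ S j x k * chartFun φ S k x j = 1 := by
  cases x with
  | off q hq =>
    have h1 : φ q j ≠ 0 := hxj.2
    have h2 : φ q k ≠ 0 := hxk.2
    simp only [chartFun, hj, hk, hjk, hjk.symm, ne_eq, not_false_eq_true, and_self, if_true]
    field_simp
  | exc p hp hs v =>
    have h1 : dnormal φ p v.rep j ≠ 0 := hxj.2
    have h2 : dnormal φ p v.rep k ≠ 0 := hxk.2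
    simp only [chartFun, hj, hk, hjk, hjk.symm, if_true, if_false]
    field_simp

theorem exists_disjoint_of_mem_source {e : OpenPartialHomeomorph (BlowUp ι X) (ι → ℂ)}
    {x y : BlowUp ι X} (hx : x ∈ e.source) (hy : y ∈ e.source) (hxy : x ≠ y) :
    ∃ u v : Set (BlowUp ι X), IsOpen u ∧ IsOpen v ∧ x ∈ u ∧ y ∈ v ∧ Disjoint u v := by
  obtain ⟨u, v, hu, hv, hxu, hyv, huv⟩ := t2_separation (e.injOn.ne hx hy hxy)
  refine ⟨e.source ∩ e ⁻¹' u, e.source ∩ e ⁻¹' v, e.isOpen_inter_preimage hu,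
    e.isOpen_inter_preimage hv, ⟨hx, hxu⟩, ⟨hy, hyv⟩, ?_⟩
  exact (huv.preimage e).mono inter_subset_right inter_subset_right

/-- Points with distinct projections are separated in `M`. Two points of the same fiber either share
a chart, or are told apart by the size of a quotient of two normal coordinates. -/
instance t2Space [T2Space M] : T2Space (BlowUp ι X) := by
  refine ⟨fun x y hxy => ?_⟩
  have : Nonempty (BlowUp ι X) := ⟨x⟩
  by_cases hp : x.proj = y.proj
  · have hx : x.proj ∈ X := by
      by_contra hx
      exact hxy (eq_of_proj_eq hp hx)
    obtain ⟨φ, S, hφ, hxφ⟩ := isSubmanifoldAt_proj hx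
    obtain ⟨j, hj, hxj⟩ := exists_mem_chartDom hx hφ hxφ
    have hyX : y.proj ∈ X := hp ▸ hx
    obtain ⟨k, hk, hyk⟩ := exists_mem_chartDom hyX hφ (hp ▸ hxφ)
    obtain ⟨e, he, hs, hf, -⟩ := exists_excChart hφ hj
    obtain ⟨e', he', hs', hf', -⟩ := exists_excChart hφ hk
    by_cases hyj : y ∈ (chartDom φ φ.source j : Set (BlowUp ι X))
    · exact exists_disjoint_of_mem_source (hs ▸ hxj) (hs ▸ hyj) hxy
    by_cases hxk : x ∈ (chartDom φ φ.source k : Set (BlowUp ι X))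
    · exact exists_disjoint_of_mem_source (hs' ▸ hxk) (hs' ▸ hyk) hxy
    -- Remaining case: `d(z_k)` vanishes on the direction `x` and `d(z_j)` on the direction `y`, so
    -- `z_k / z_j` is zero at `x` and `z_j / z_k` is zero at `y`.
    have hjk : j ≠ k := fun h => hxk (h ▸ hxj)
    have o1 : IsOpen {w : ι → ℂ | ‖w k‖ < 1} :=
      isOpen_lt (continuous_apply k).norm continuous_const
    have o2 : IsOpen {w : ι → ℂ | ‖w j‖ < 1} :=
      isOpen_lt (continuous_apply j).norm continuous_const
    refine ⟨_, _, e.isOpen_inter_preimage o1, e'.isOpen_inter_preimage o2, ⟨hs ▸ hxj, ?_⟩,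
      ⟨hs' ▸ hyk, ?_⟩, ?_⟩
    · rw [mem_preimage, hf, mem_ofPred_eq]
      cases x with
      | off q hq => exact absurd hx hq
      | exc p hp hs v =>
        have : dnormal φ p v.rep k = 0 := by
          by_contra h; exact hxk ⟨hxφ, h⟩
        simp [chartFun, hjk.symm, hk, this]
    · rw [mem_preimage, hf', mem_ofPred_eq]
      cases y with
      | off q hq => exact absurd hyX hq
      | exc p hp' hs v =>
        have : dnormal φ p v.rep j = 0 := by
          by_contra h; exact hyj ⟨hyk.1, h⟩
        simp [chartFun, hjk, hj, this]
    · refine Set.disjoint_left.2 fun z hz hz' => ?_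
      have h1 : ‖e z k‖ < 1 := hz.2
      have h2 : ‖e' z j‖ < 1 := hz'.2
      have h3 := chartFun_mul_chartFun hj hk hjk (hs ▸ hz.1) (hs' ▸ hz'.1)
      rw [← hf, ← hf'] at h3
      have h4 : ‖e z k‖ * ‖e' z j‖ = 1 := by rw [← norm_mul, h3, norm_one]
      nlinarith [norm_nonneg (e z k), norm_nonneg (e' z j)]
  · obtain ⟨u, v, hu, hv, hxu, hyv, huv⟩ := t2_separation hp
    exact ⟨_, _, hu.preimage continuous_proj, hv.preimage continuous_proj, hxu, hyv,
      huv.preimage _⟩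

/-- The complement of the exceptional divisor is one piece of a countable cover. The Lindelöf
property of the set where adapted charts exist provides countably many charts for the rest, each
with finitely many pivots. -/
instance secondCountableTopology [SecondCountableTopology M] :
    SecondCountableTopology (BlowUp ι X) := by
  rcases isEmpty_or_nonempty (BlowUp ι X) with hE | hE
  · infer_instance
  set Y : Set M := {p | IsSubmanifoldAt ι (X : Set M) p} with hY
  have hch : ∀ p : M, ∃ (φ : OpenPartialHomeomorph M (ι → ℂ)) (S : Finset ι),
      p ∈ Y → IsAdapted (X : Set M) φ S ∧ p ∈ φ.source := by
    intro p
    by_cases hp : p ∈ Y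
    · obtain ⟨φ, S, h⟩ := hp
      exact ⟨φ, S, fun _ => h⟩
    -- An arbitrary choice: no point of the exceptional divisor lies over such a `p`.
    · exact ⟨chartAt _ p, ∅, fun h => absurd h hp⟩
  choose φ S hφ using hch
  obtain ⟨t, htY, htc, ht⟩ := TopologicalSpace.countable_cover_nhdsWithin (s := Y)
    (f := fun p => (φ p).source) fun p hp =>
      mem_nhdsWithin_of_mem_nhds ((φ p).open_source.mem_nhds (hφ p hp).2)
  have : Countable t := htc.to_subtype
  have hU : ∀ (p : t) (j : S p), ∃ U : Set (BlowUp ι X), IsOpen U ∧ SecondCountableTopology U ∧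
      U = chartDom (φ p) (φ p).source j := by
    intro p j
    obtain ⟨e, -, hs, -⟩ := exists_excChart (hφ p (htY p.2)).1 j.2
    exact ⟨e.source, e.open_source, e.secondCountableTopology_source, hs⟩
  choose U hUo hUs hUe using hU
  let W : Option (Σ p : t, S p) → Set (BlowUp ι X) := fun o =>
    o.elim (offHomeo (ι := ι) X).source fun q => U q.1 q.2
  have hWs : ∀ o, SecondCountableTopology (W o) := by
    rintro (_ | q)
    · exact (offHomeo (ι := ι) X).secondCountableTopology_source
    · exact hUs q.1 q.2
  refine TopologicalSpace.secondCountableTopology_of_countable_cover (U := W) ?_ ?_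
  · rintro (_ | q)
    · exact (offHomeo (ι := ι) X).open_source
    · exact hUo q.1 q.2
  · refine eq_univ_of_forall fun x => mem_iUnion.2 ?_
    by_cases hx : x.proj ∈ X
    · have hxY : x.proj ∈ Y := isSubmanifoldAt_proj hx
      obtain ⟨p, hp, hxp⟩ := mem_iUnion₂.1 (ht hxY)
      obtain ⟨j, hj, hxj⟩ := exists_mem_chartDom hx (hφ p (htY hp)).1 hxp
      refine ⟨some ⟨⟨p, hp⟩, ⟨j, hj⟩⟩, ?_⟩
      change x ∈ U _ _
      rw [hUe]
      exact hxj
    · exact ⟨none, hx⟩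

end BlowUp

end BlowUpTopology

/-! ### Lifting biholomorphisms to the blow-up. -/

section Lift

variable {ι : Type} [Fintype ι] {M : Type} [TopologicalSpace M] [ChartedSpace (ι → ℂ) M]

variable (ι) in
/-- `G` is a biholomorphism from the open set `U` onto the open set `U'`, with inverse `H`. -/
structure IsBihol (G H : M → M) (U U' : Set M) : Prop where
  isOpen_source : IsOpen U
  isOpen_target : IsOpen U'
  mapsTo : MapsTo G U U'
  mapsTo_inv : MapsTo H U' U
  left_inv : ∀ x ∈ U, H (G x) = x
  right_inv : ∀ x ∈ U', G (H x) = x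
  contMDiffOn : ContMDiffOn 𝓘(ℂ, ι → ℂ) 𝓘(ℂ, ι → ℂ) ω G U
  contMDiffOn_inv : ContMDiffOn 𝓘(ℂ, ι → ℂ) 𝓘(ℂ, ι → ℂ) ω H U'

namespace IsBihol

variable {G H : M → M} {U U' : Set M}

theorem symm (h : IsBihol ι G H U U') : IsBihol ι H G U' U :=
  ⟨h.2, h.1, h.4, h.3, h.6, h.5, h.8, h.7⟩

/-- A biholomorphism as a partial homeomorphism. -/
noncomputable def toHomeo (h : IsBihol ι G H U U') : OpenPartialHomeomorph M M where
  toFun := G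
  invFun := H
  source := U
  target := U'
  map_source' := h.mapsTo
  map_target' := h.mapsTo_inv
  left_inv' := h.left_inv
  right_inv' := h.right_inv
  open_source := h.isOpen_source
  open_target := h.isOpen_target
  continuousOn_toFun := h.contMDiffOn.continuousOn
  continuousOn_invFun := h.contMDiffOn_inv.continuousOn

/-- The chart `φ ∘ G`. -/
noncomputable def pull (h : IsBihol ι G H U U') (φ : OpenPartialHomeomorph M (ι → ℂ)) :
    OpenPartialHomeomorph M (ι → ℂ) := h.toHomeo.trans φ

theorem pull_mem [IsManifold 𝓘(ℂ, ι → ℂ) ω M] (h : IsBihol ι G H U U')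
    {φ : OpenPartialHomeomorph M (ι → ℂ)}
    (hφ : φ ∈ IsManifold.maximalAtlas 𝓘(ℂ, ι → ℂ) ω M) :
    h.pull φ ∈ IsManifold.maximalAtlas 𝓘(ℂ, ι → ℂ) ω M := by
  refine OpenPartialHomeomorph.mem_maximalAtlas_of_contMDiffOn _ ?_ ?_
  · exact (contMDiffOn_of_mem_maximalAtlas hφ).comp (h.contMDiffOn.mono fun x hx => hx.1)
      fun x hx => hx.2
  · exact h.contMDiffOn_inv.comp
      ((contMDiffOn_symm_of_mem_maximalAtlas hφ).mono fun x hx => hx.1) fun x hx => hx.2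

theorem pull_isAdapted [IsManifold 𝓘(ℂ, ι → ℂ) ω M] (h : IsBihol ι G H U U') {X : Set M}
    (hX : ∀ x ∈ U, G x ∈ X ↔ x ∈ X) {φ : OpenPartialHomeomorph M (ι → ℂ)} {S : Finset ι}
    (hφ : IsAdapted X φ S) : IsAdapted X (h.pull φ) S :=
  ⟨h.pull_mem hφ.1, fun q hq => (hX q hq.1).symm.trans (hφ.2 _ hq.2)⟩

theorem mem_iff (h : IsBihol ι G H U U') {X : Set M} (h1 : ∀ x ∈ U, x ∈ X → G x ∈ X)
    (h2 : ∀ x ∈ U', x ∈ X → H x ∈ X) (x : M) (hx : x ∈ U) : G x ∈ X ↔ x ∈ X :=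
  ⟨fun hG => by rw [← h.left_inv x hx]; exact h2 _ (h.mapsTo hx) hG, h1 x hx⟩

theorem mem_iff_symm (h : IsBihol ι G H U U') {X : Set M} (hX : ∀ x ∈ U, G x ∈ X ↔ x ∈ X)
    (x : M) (hx : x ∈ U') : H x ∈ X ↔ x ∈ X := by
  rw [← hX _ (h.mapsTo_inv hx), h.right_inv x hx]

end IsBihol

variable {X : TopologicalSpace.Closeds M}

namespace BlowUp

/-- The charts of the blow-up depend only on the germ of `φ` at the projected point. This permits
replacing `φ ∘ H ∘ G` by `φ`, and the canonical coordinate functions by genuine charts. -/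
theorem dnormal_congr {φ φ' : M → ι → ℂ} {p : M} (h : φ =ᶠ[𝓝 p] φ')
    (v : NormalSpace (ι := ι) (X : Set M) p) : dnormal φ p v = dnormal φ' p v := by
  rw [dnormal, dnormal, dchart, dchart, h.mfderiv_eq]

theorem chartFun_congr {φ φ' : M → ι → ℂ} (S : Finset ι) (j : ι) {x : BlowUp ι X}
    (h : φ =ᶠ[𝓝 x.proj] φ') : chartFun φ S j x = chartFun φ' S j x := by
  cases x with
  | off q hq =>
    have : φ q = φ' q := h.self_of_nhds
    simp only [chartFun, this]
  | exc p hp hs v =>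
    have h1 : φ p = φ' p := h.self_of_nhds
    have h2 : dnormal φ p v.rep = dnormal φ' p v.rep := dnormal_congr h v.rep
    simp only [chartFun, h1, h2]

theorem mem_chartDom_congr {φ φ' : M → ι → ℂ} {V V' : Set M} (j : ι) {x : BlowUp ι X}
    (h : φ =ᶠ[𝓝 x.proj] φ') (hV : x.proj ∈ V ↔ x.proj ∈ V') :
    x ∈ (chartDom φ V j : Set (BlowUp ι X)) ↔ x ∈ (chartDom φ' V' j : Set (BlowUp ι X)) := by
  cases x with
  | off q hq =>
    have : φ q = φ' q := h.self_of_nhds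
    change (q ∈ V ∧ φ q j ≠ 0) ↔ (q ∈ V' ∧ φ' q j ≠ 0)
    rw [this]
    exact and_congr_left' hV
  | exc p hp hs v =>
    have h2 : dnormal φ p v.rep = dnormal φ' p v.rep := dnormal_congr h v.rep
    change (p ∈ V ∧ dnormal φ p v.rep j ≠ 0) ↔ (p ∈ V' ∧ dnormal φ' p v.rep j ≠ 0)
    rw [h2]
    exact and_congr_left' hV

/-- `y` is the image of `x` under the lift of `G`: the coordinates of `y` in the chart attached to `φ`
are those of `x` in the chart attached to `φ ∘ G`. -/
structure LiftRel (G : M → M) (x y : BlowUp ι X) : Prop where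
  proj_eq : y.proj = G x.proj
  mem_iff : ∀ (φ : OpenPartialHomeomorph M (ι → ℂ)) (S : Finset ι), IsAdapted (X : Set M) φ S →
    y.proj ∈ φ.source → ∀ j ∈ S, (y ∈ (chartDom φ φ.source j : Set (BlowUp ι X)) ↔
      x ∈ (chartDom (φ ∘ G) (G ⁻¹' φ.source) j : Set (BlowUp ι X)))
  chartFun_eq : ∀ (φ : OpenPartialHomeomorph M (ι → ℂ)) (S : Finset ι),
    IsAdapted (X : Set M) φ S → ∀ j ∈ S, y ∈ (chartDom φ φ.source j : Set (BlowUp ι X)) →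
      chartFun φ S j y = chartFun (φ ∘ G) S j x

open Classical in
/-- The lift of a self-map of `M` to the blow-up (the identity where there is no lift). -/
noncomputable def liftMap (G : M → M) (x : BlowUp ι X) : BlowUp ι X :=
  if h : ∃ y, LiftRel G x y then h.choose else x

variable [IsManifold 𝓘(ℂ, ι → ℂ) ω M] {G H : M → M} {U U' : Set M}

theorem mem_chartDom_pull (h : IsBihol ι G H U U') (φ : OpenPartialHomeomorph M (ι → ℂ)) (j : ι)
    {x : BlowUp ι X} (hx : x.proj ∈ U) :
    x ∈ (chartDom (h.pull φ) (h.pull φ).source j : Set (BlowUp ι X)) ↔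
      x ∈ (chartDom (φ ∘ G) (G ⁻¹' φ.source) j : Set (BlowUp ι X)) :=
  mem_chartDom_congr j (Filter.EventuallyEq.refl _ _) ⟨fun hm => hm.2, fun hm => ⟨hx, hm⟩⟩

/-- Over the center, give the image the coordinates in the chart of `φ` that `x` has in the chart of
`φ ∘ G`. The choice of `φ` is immaterial: the transition from `φ ∘ G` to `φ' ∘ G` has the same germ
as the one from `φ` to `φ'`, and only the transition enters in `chartFun_transition`. -/
theorem exists_liftRel (h : IsBihol ι G H U U') (hX : ∀ x ∈ U, G x ∈ X ↔ x ∈ X)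
    {x : BlowUp ι X} (hx : x.proj ∈ U) : ∃ y, LiftRel G x y := by
  by_cases hxX : x.proj ∈ X
  · have hGX := (hX _ hx).2 hxX
    obtain ⟨φ₀, S, hφ₀, hpφ₀⟩ := isSubmanifoldAt_proj hxX
    -- A chart around `G x` is obtained from one around `x` by composing with `H`. Its domain lies
    -- in `U'`, where `G` and `H` are inverse.
    have hφ := h.symm.pull_isAdapted (h.mem_iff_symm (X := (X : Set M)) hX) hφ₀
    set φ := h.symm.pull φ₀ with hφdef
    have hpφ : G x.proj ∈ φ.source :=
      ⟨h.mapsTo hx, by rw [mem_preimage]; change H (G _) ∈ _; rw [h.left_inv _ hx]; exact hpφ₀⟩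
    have hψ := h.pull_isAdapted (X := (X : Set M)) hX hφ
    have hpψ : x.proj ∈ (h.pull φ).source := ⟨hx, hpφ⟩
    obtain ⟨j, hj, hxj⟩ := exists_mem_chartDom hxX hψ hpψ
    have hb : blowMap S j (chartFun (φ ∘ G) S j x) = φ (G x.proj) := blowMap_chartFun hψ hj hxj
    have ht : blowMap S j (chartFun (φ ∘ G) S j x) ∈ φ.target := by
      rw [hb]; exact φ.map_source hpφ
    obtain ⟨y, hy, hyw, hyp⟩ := exists_chartFun_eq (X := X) hφ hj ht
    have hyp' : y.proj = G x.proj := by rw [hyp, hb, φ.left_inv hpφ]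
    have key : ∀ (φ' : OpenPartialHomeomorph M (ι → ℂ)) (S' : Finset ι),
        IsAdapted (X : Set M) φ' S' → y.proj ∈ φ'.source → ∀ k ∈ S',
        (y ∈ (chartDom φ' φ'.source k : Set (BlowUp ι X)) ↔
          x ∈ (chartDom (φ' ∘ G) (G ⁻¹' φ'.source) k : Set (BlowUp ι X))) ∧
        chartFun φ' S' k y = chartFun (φ' ∘ G) S' k x := by
      intro φ' S' hφ' hyφ' k hk
      have hψ' := h.pull_isAdapted (X := (X : Set M)) hX hφ'
      have hpψ' : x.proj ∈ (h.pull φ').source := ⟨hx, by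
        change G x.proj ∈ φ'.source; rw [← hyp']; exact hyφ'⟩
      -- In the transition between the two pulled-back charts, `G` and `H` cancel.
      have hfd : fderiv ℂ (h.pull φ' ∘ (h.pull φ).symm) (h.pull φ x.proj)
          = fderiv ℂ (φ' ∘ φ.symm) (φ y.proj) := by
        have e0 : h.pull φ x.proj = φ y.proj := by rw [hyp']; rfl
        rw [e0]
        refine Filter.EventuallyEq.fderiv_eq ?_
        have : ∀ᶠ z in 𝓝 (φ y.proj), φ.symm z ∈ U' := by
          have hc := φ.continuousAt_symm (φ.map_source (hyp' ▸ hpφ))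
          refine hc.eventually_mem (h.isOpen_target.mem_nhds ?_)
          rw [φ.left_inv (hyp' ▸ hpφ), hyp']
          exact h.mapsTo hx
        filter_upwards [this] with z hz
        change φ' (G (H (φ.symm z))) = φ' (φ.symm z)
        rw [h.right_inv _ hz]
      classical
      set K : ι → ℂ := fun i => if chartFun φ S j y j = 0
        then fderiv ℂ (φ' ∘ φ.symm) (φ y.proj) (dirOf S j (chartFun φ S j y)) i
        else φ' y.proj i / chartFun φ S j y j with hK
      obtain ⟨t1, t2⟩ := chartFun_transition hφ hφ' hj hk hy hyφ' (H := K) fun i => rfl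
      obtain ⟨t3, t4⟩ := chartFun_transition hψ hψ' hj hk hxj hpψ' (H := K) fun i => by
        rw [hfd]
        change _ = if chartFun (φ ∘ G) S j x j = 0
          then fderiv ℂ (φ' ∘ φ.symm) (φ y.proj) (dirOf S j (chartFun (φ ∘ G) S j x)) i
          else φ' (G x.proj) i / chartFun (φ ∘ G) S j x j
        rw [← hyw, ← hyp']
      refine ⟨t1.trans (t3.symm.trans ?_), ?_⟩
      · exact mem_chartDom_pull h φ' k hx
      · funext i
        rw [t2 i, hyp']
        exact (t4 i).symm
    refine ⟨y, hyp', fun φ' S' hφ' hy' k hk => (key φ' S' hφ' hy' k hk).1,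
      fun φ' S' hφ' k hk hy' => (key φ' S' hφ' (proj_mem_of_mem_chartDom hy') k hk).2⟩
  · have hGX : G x.proj ∉ X := fun hc => hxX ((hX _ hx).1 hc)
    cases x with
    | exc p hp hs v => exact absurd hp hxX
    | off q hq =>
      exact ⟨off (G q) hGX, rfl, fun φ S hφ hy j hj => Iff.rfl, fun φ S hφ j hj hy => rfl⟩

theorem liftMap_spec (h : IsBihol ι G H U U') (hX : ∀ x ∈ U, G x ∈ X ↔ x ∈ X)
    {x : BlowUp ι X} (hx : x.proj ∈ U) : LiftRel G x (liftMap G x) := by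
  have he := exists_liftRel h hX hx
  rw [liftMap, dif_pos he]
  exact he.choose_spec

theorem proj_liftMap (h : IsBihol ι G H U U') (hX : ∀ x ∈ U, G x ∈ X ↔ x ∈ X)
    {x : BlowUp ι X} (hx : x.proj ∈ U) : (liftMap G x).proj = G x.proj :=
  (liftMap_spec h hX hx).proj_eq

/-- The image has in the chart of `φ` the coordinates that `x` has in that of `φ ∘ H ∘ G`, which is
`φ` near the point; the chart is injective. Off the center the projection decides. -/
theorem liftMap_liftMap (h : IsBihol ι G H U U') (hX : ∀ x ∈ U, G x ∈ X ↔ x ∈ X)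
    {x : BlowUp ι X} (hx : x.proj ∈ U) : liftMap H (liftMap G x) = x := by
  have hX' : ∀ x ∈ U', H x ∈ X ↔ x ∈ X := h.mem_iff_symm (X := (X : Set M)) hX
  have s1 := liftMap_spec h hX hx
  have hy : (liftMap G x).proj ∈ U' := by rw [s1.proj_eq]; exact h.mapsTo hx
  have s2 := liftMap_spec h.symm hX' hy
  set y := liftMap G x with hydef
  set x' := liftMap H y with hx'def
  have hp : x'.proj = x.proj := by rw [s2.proj_eq, s1.proj_eq, h.left_inv _ hx]
  by_cases hxX : x.proj ∈ X
  · obtain ⟨φ, S, hφ, hpφ⟩ := isSubmanifoldAt_proj hxX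
    obtain ⟨j, hj, hxj⟩ := exists_mem_chartDom hxX hφ hpφ
    have hψ := h.symm.pull_isAdapted (X := (X : Set M)) hX' hφ
    have hev : (h.symm.pull φ) ∘ G =ᶠ[𝓝 x.proj] φ := by
      filter_upwards [h.isOpen_source.mem_nhds hx] with z hz
      change φ (H (G z)) = φ z
      rw [h.left_inv z hz]
    have hyψ : y.proj ∈ (h.symm.pull φ).source := by
      refine ⟨hy, ?_⟩
      change H y.proj ∈ φ.source
      rw [s1.proj_eq, h.left_inv _ hx]; exact hpφ
    have m1 : y ∈ (chartDom (h.symm.pull φ) (h.symm.pull φ).source j : Set (BlowUp ι X)) := by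
      rw [s1.mem_iff _ S hψ hyψ j hj]
      refine (mem_chartDom_congr j hev ⟨fun _ => hpφ, fun _ => ?_⟩).2 hxj
      rw [mem_preimage, ← s1.proj_eq]; exact hyψ
    have m2 : x' ∈ (chartDom φ φ.source j : Set (BlowUp ι X)) := by
      rw [s2.mem_iff φ S hφ (hp ▸ hpφ) j hj]
      exact (mem_chartDom_pull h.symm φ j hy).1 m1
    refine injOn_chartFun hφ hj m2 hxj ?_
    rw [s2.chartFun_eq φ S hφ j hj m2]
    exact (s1.chartFun_eq _ S hψ j hj m1).trans (chartFun_congr S j hev)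
  · exact eq_of_proj_eq hp (hp ▸ hxX)

/-- Between the charts attached to `φ ∘ G` and to `φ`, the lift is the identity in coordinates. Off
the center it is `G` conjugated by the projection. -/
theorem contMDiffOn_liftMap (h : IsBihol ι G H U U') (hX : ∀ x ∈ U, G x ∈ X ↔ x ∈ X) :
    ContMDiffOn 𝓘(ℂ, ι → ℂ) 𝓘(ℂ, ι → ℂ) ω (liftMap G : BlowUp ι X → BlowUp ι X)
      (proj ⁻¹' U) := by
  intro x hx
  have : Nonempty (BlowUp ι X) := ⟨x⟩
  refine ContMDiffAt.contMDiffWithinAt ?_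
  have s := liftMap_spec h hX hx
  have hU : (proj ⁻¹' U : Set (BlowUp ι X)) ∈ 𝓝 x :=
    (h.isOpen_source.preimage continuous_proj).mem_nhds hx
  by_cases hxX : x.proj ∈ X
  · have hyX : (liftMap G x).proj ∈ X := by rw [s.proj_eq]; exact (hX _ hx).2 hxX
    obtain ⟨φ, S, hφ, hyφ⟩ := isSubmanifoldAt_proj hyX
    obtain ⟨j, hj, hyj⟩ := exists_mem_chartDom hyX hφ hyφ
    have hψ := h.pull_isAdapted (X := (X : Set M)) hX hφ
    obtain ⟨e, he, hes, hef, -⟩ := exists_excChart hφ hj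
    obtain ⟨e', he', hes', hef', -⟩ := exists_excChart hψ hj
    have key : ∀ z ∈ e'.source, liftMap G z ∈ e.source ∧ e (liftMap G z) = e' z := by
      intro z hz
      rw [hes'] at hz
      have hzU := proj_mem_of_mem_chartDom hz
      have sz := liftMap_spec h hX hzU.1
      have m : liftMap G z ∈ (chartDom φ φ.source j : Set (BlowUp ι X)) := by
        rw [sz.mem_iff φ S hφ (by rw [sz.proj_eq]; exact hzU.2) j hj]
        exact (mem_chartDom_pull h φ j hzU.1).1 hz
      exact ⟨hes ▸ m, by rw [hef, hef']; exact sz.chartFun_eq φ S hφ j hj m⟩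
    have hxe' : x ∈ e'.source := by
      rw [hes']
      exact (mem_chartDom_pull h φ j hx).2 ((s.mem_iff φ S hφ hyφ j hj).1 hyj)
    have c1 := contMDiffAt_of_mem_maximalAtlas he' hxe'
    have c2 : ContMDiffAt 𝓘(ℂ, ι → ℂ) 𝓘(ℂ, ι → ℂ) ω e.symm (e' x) := by
      refine contMDiffAt_symm_of_mem_maximalAtlas he ?_
      rw [← (key x hxe').2]
      exact e.map_source (key x hxe').1
    refine (c2.comp x c1).congr_of_eventuallyEq ?_
    filter_upwards [e'.open_source.mem_nhds hxe'] with z hz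
    simp only [Function.comp]
    rw [← (key z hz).2, e.left_inv (key z hz).1]
  · have hGX : G x.proj ∉ X := fun hc => hxX ((hX _ hx).1 hc)
    have c1 : ContMDiffAt 𝓘(ℂ, ι → ℂ) 𝓘(ℂ, ι → ℂ) ω G x.proj :=
      h.contMDiffOn.contMDiffAt (h.isOpen_source.mem_nhds hx)
    have c2 : ContMDiffAt 𝓘(ℂ, ι → ℂ) 𝓘(ℂ, ι → ℂ) ω (ofOff : M → BlowUp ι X) (G x.proj) :=
      contMDiffOn_ofOff.contMDiffAt (X.isClosed.isOpen_compl.mem_nhds hGX)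
    refine (c2.comp x (c1.comp x contMDiff_proj.contMDiffAt)).congr_of_eventuallyEq ?_
    filter_upwards [hU, (X.isClosed.isOpen_compl.preimage continuous_proj).mem_nhds hxX]
      with z hz hzX
    have hGz : G z.proj ∉ X := fun hc => hzX ((hX _ hz).1 hc)
    refine eq_of_proj_eq ?_ ?_
    · rw [proj_liftMap h hX hz]; exact (proj_ofOff hGz).symm
    · rw [proj_liftMap h hX hz]; exact hGz

/-- A biholomorphism which preserves the center lifts to the blow-up. -/
theorem isBihol_liftMap (h : IsBihol ι G H U U') (hX : ∀ x ∈ U, G x ∈ X ↔ x ∈ X) :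
    IsBihol ι (liftMap G : BlowUp ι X → BlowUp ι X) (liftMap H) (proj ⁻¹' U) (proj ⁻¹' U') where
  isOpen_source := h.isOpen_source.preimage continuous_proj
  isOpen_target := h.isOpen_target.preimage continuous_proj
  mapsTo x hx := by rw [mem_preimage, proj_liftMap h hX hx]; exact h.mapsTo hx
  mapsTo_inv x hx := by
    rw [mem_preimage, proj_liftMap h.symm (h.mem_iff_symm (X := (X : Set M)) hX) hx]
    exact h.mapsTo_inv hx
  left_inv x hx := liftMap_liftMap h hX hx
  right_inv x hx := liftMap_liftMap h.symm (h.mem_iff_symm (X := (X : Set M)) hX) hx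
  contMDiffOn := contMDiffOn_liftMap h hX
  contMDiffOn_inv := contMDiffOn_liftMap h.symm (h.mem_iff_symm (X := (X : Set M)) hX)

/-- The lift is continuous and respects `σ⁻¹ (Z ∖ X)` over `U`, so it respects the closure there. -/
theorem liftMap_mem_properTransform (h : IsBihol ι G H U U') (hX : ∀ x ∈ U, G x ∈ X ↔ x ∈ X)
    {Z : Set M} (hZ : ∀ x ∈ U, x ∈ Z → G x ∈ Z) {x : BlowUp ι X} (hx : x.proj ∈ U)
    (hxZ : x ∈ properTransform (ι := ι) (X := X) Z) : liftMap G x ∈ properTransform (ι := ι) (X := X) Z := by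
  have hU : (proj ⁻¹' U : Set (BlowUp ι X)) ∈ 𝓝 x :=
    (h.isOpen_source.preimage continuous_proj).mem_nhds hx
  have hc := ((contMDiffOn_liftMap (X := X) h hX).contMDiffAt hU).continuousAt
  change liftMap G x ∈ closure _
  change x ∈ closure _ at hxZ
  -- The approximating points may be taken over the open set `U`, the only place where `G` is
  -- controlled.
  have h1 : x ∈ closure (proj ⁻¹' U ∩ proj ⁻¹' (Z \ X) : Set (BlowUp ι X)) := by
    rw [mem_closure_iff_nhds] at hxZ ⊢
    intro O hO
    obtain ⟨y, hy, hyZ⟩ := hxZ _ (inter_mem hO hU)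
    exact ⟨y, hy.1, hy.2, hyZ⟩
  refine hc.continuousWithinAt.mem_closure h1 ?_
  rintro y ⟨hyU, hyZ, hyX⟩
  refine ⟨?_, ?_⟩
  · rw [proj_liftMap h hX hyU]; exact hZ _ hyU hyZ
  · rw [proj_liftMap h hX hyU]; exact fun hc => hyX ((hX _ hyU).1 hc)

end BlowUp

end Lift

/-! ### Flags of submanifolds under blow-up. -/

theorem mem_closure_iff_of_chart {A B : Type*} [TopologicalSpace A] [TopologicalSpace B]
    (e : OpenPartialHomeomorph A B) {L : Set A} {C : Set B} (hC : IsClosed C)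
    (h : ∀ y ∈ e.source, y ∈ L ↔ e y ∈ C) {x : A} (hx : x ∈ e.source) :
    x ∈ closure L ↔ e x ∈ C := by
  refine ⟨fun hxL => ?_, fun hxC => subset_closure ((h x hx).2 hxC)⟩
  by_contra hne
  have hO := e.isOpen_inter_preimage hC.isOpen_compl
  obtain ⟨y, hy, hyL⟩ := mem_closure_iff.1 hxL _ hO ⟨hx, hne⟩
  exact hy.2 ((h y hy.1).1 hyL)

section Flags

variable {ι : Type} [Fintype ι] {M : Type} [TopologicalSpace M] [ChartedSpace (ι → ℂ) M]

variable (ι) in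
/-- Around every point there is a chart in which all the closed sets `Z h`, `a ≤ h < b`, that it meets are
coordinate subspaces, of codimension `c h`. -/
def HasFlagCharts (Z : ℕ → TopologicalSpace.Closeds M) (a b : ℕ) (c : ℕ → ℕ) : Prop :=
  ∀ p : M, ∃ φ ∈ IsManifold.maximalAtlas 𝓘(ℂ, ι → ℂ) ω M, p ∈ φ.source ∧
    ∃ (A : ℕ → Prop) (T : ℕ → Finset ι),
      (∀ h, a ≤ h → h < b → ∀ q ∈ φ.source, q ∈ Z h ↔ A h ∧ ∀ i ∈ T h, φ q i = 0) ∧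
      (∀ h, a ≤ h → h < b → A h → (T h).card = c h) ∧
      ∀ h h', a ≤ h → h ≤ h' → h' < b → A h → A h' ∧ T h' ⊆ T h

namespace BlowUp

variable {X : TopologicalSpace.Closeds M} [IsManifold 𝓘(ℂ, ι → ℂ) ω M]

theorem mem_properTransform_iff_of_notMem {Z : TopologicalSpace.Closeds M} {x : BlowUp ι X}
    (hx : x.proj ∉ X) : x ∈ properTransform (ι := ι) (X := X) (Z : Set M) ↔ x.proj ∈ Z := by
  constructor
  · intro h
    by_contra hne
    obtain ⟨y, hy, hyZ⟩ := mem_closure_iff.1 h _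
      (Z.isClosed.isOpen_compl.preimage (continuous_proj (ι := ι) (X := X))) hne
    exact hy hyZ.1
  · intro h
    exact subset_closure ⟨h, hx⟩

theorem proj_mem_of_mem_properTransform {Z : TopologicalSpace.Closeds M} {x : BlowUp ι X}
    (hx : x ∈ properTransform (ι := ι) (X := X) (Z : Set M)) : x.proj ∈ Z := by
  by_contra hne
  obtain ⟨y, hy, hyZ⟩ := mem_closure_iff.1 hx _
    (Z.isClosed.isOpen_compl.preimage (continuous_proj (ι := ι) (X := X))) hne
  exact hy hyZ.1

/-- The proper transform of a coordinate subspace containing the center. -/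
theorem mem_properTransform_iff {φ : OpenPartialHomeomorph M (ι → ℂ)} {S : Finset ι}
    (hφ : IsAdapted (X : Set M) φ S) {j : ι} (hj : j ∈ S) {Z : Set M} {A : Prop} {T : Finset ι}
    (hTS : A → T ⊆ S) (hZ : ∀ q ∈ φ.source, q ∈ Z ↔ A ∧ ∀ i ∈ T, φ q i = 0) {x : BlowUp ι X}
    (hx : x ∈ (chartDom φ φ.source j : Set (BlowUp ι X))) :
    x ∈ properTransform (ι := ι) (X := X) Z ↔ (A ∧ j ∉ T) ∧ ∀ i ∈ T, chartFun φ S j x i = 0 := by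
  classical
  have : Nonempty (BlowUp ι X) := ⟨x⟩
  obtain ⟨e, he, hes, hef, het⟩ := exists_excChart hφ hj
  have hxe : x ∈ e.source := hes ▸ hx
  -- Off the exceptional divisor the pivot coordinate is non-zero, so the equations `w_j w_i = 0`
  -- may be divided by it, and `j` cannot itself be an equation of `Z`.
  have hoff : ∀ y ∈ e.source, y.proj ∈ Z \ X → (A ∧ j ∉ T) ∧ ∀ i ∈ T, e y i = 0 := by
    rintro y hy ⟨hyZ, hyX⟩
    rw [hes] at hy
    obtain ⟨hA, hT⟩ := (hZ _ (proj_mem_of_mem_chartDom hy)).1 hyZ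
    have hb := blowMap_chartFun hφ hj hy
    have hyj := (chartFun_pivot_eq_zero_iff (S := S) hy).not.2 hyX
    have hjT : j ∉ T := by
      intro h
      have h1 := hT j h
      rw [← hb] at h1
      exact hyj (by simpa [blowMap] using h1)
    refine ⟨⟨hA, hjT⟩, fun i hi => ?_⟩
    have hij : i ≠ j := fun h => hjT (h ▸ hi)
    have h1 := hT i hi
    rw [← hb] at h1
    simp only [blowMap, hTS hA hi, hij, ne_eq, not_false_eq_true, and_self, if_true,
      mul_eq_zero, hyj, false_or] at h1
    rw [hef]; exact h1
  constructor
  · intro h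
    obtain ⟨y, hy, hyZ⟩ := mem_closure_iff.1 h _ e.open_source hxe
    refine ⟨(hoff y hy hyZ).1, fun i hi => ?_⟩
    by_contra hne
    have hO := e.isOpen_inter_preimage (s := {w | w i ≠ 0})
      (isOpen_ne_fun (continuous_apply i) continuous_const)
    obtain ⟨y, hy, hyZ⟩ := mem_closure_iff.1 h _ hO ⟨hxe, by
      rw [mem_preimage, hef]; exact hne⟩
    exact hy.2 ((hoff y hy.1 hyZ).2 i hi)
  · rintro ⟨⟨hA, hjT⟩, hT⟩
    change x ∈ closure _
    rw [mem_closure_iff]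
    intro O hO hxO
    -- Approach `x` along the pivot axis: since `j ∉ T` the equations of `Z` are kept, and avoiding
    -- the one value `t = - e x j` keeps the point off the divisor.
    have hl : Tendsto (fun t : ℂ => e x + t • (Pi.single j 1 : ι → ℂ)) (𝓝 0) (𝓝 (e x)) := by
      have : Continuous fun t : ℂ => e x + t • (Pi.single j 1 : ι → ℂ) := by fun_prop
      simpa using this.tendsto 0
    have h1 : ∀ᶠ t in 𝓝 (0 : ℂ), e x + t • (Pi.single j 1 : ι → ℂ) ∈ e.target :=
      hl.eventually (e.open_target.mem_nhds (e.map_source hxe))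
    have h2 : ∀ᶠ t in 𝓝 (0 : ℂ), e.symm (e x + t • (Pi.single j 1 : ι → ℂ)) ∈ O := by
      have hc := (e.continuousAt_symm (e.map_source hxe)).tendsto
      rw [e.left_inv hxe] at hc
      exact (hc.comp hl).eventually (hO.mem_nhds hxO)
    have h3 : ∃ᶠ t in 𝓝 (0 : ℂ), t ≠ - e x j := by
      refine mem_closure_iff_frequently.1 ?_
      exact dense_compl_singleton (- e x j) 0
    obtain ⟨t, ht3, ht1, ht2⟩ := (h3.and_eventually (h1.and h2)).exists
    refine ⟨_, ht2, ?_⟩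
    set y := e.symm (e x + t • (Pi.single j 1 : ι → ℂ)) with hy
    have hys : y ∈ e.source := e.map_target ht1
    have hey : e y = e x + t • (Pi.single j 1 : ι → ℂ) := e.right_inv ht1
    rw [hes] at hys
    rw [hef] at hey
    have hyj : chartFun φ S j y j ≠ 0 := by
      rw [hey]
      intro h0
      simp only [Pi.add_apply, Pi.smul_apply, Pi.single_eq_same, smul_eq_mul, mul_one] at h0
      exact ht3 (by linear_combination h0)
    refine ⟨(hZ _ (proj_mem_of_mem_chartDom hys)).2 ⟨hA, fun i hi => ?_⟩,
      (chartFun_pivot_eq_zero_iff (S := S) hys).not.1 hyj⟩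
    have hij : i ≠ j := fun h => hjT (h ▸ hi)
    rw [← blowMap_chartFun hφ hj hys, hey]
    have := hT i hi
    rw [← hef] at this
    simp [blowMap, hTS hA hi, hij, this]

/-- The center is the smallest member of the flag, so the equations of every other member are among
its normal coordinates. In a chart of the blow-up they persist verbatim, unless the pivot is one of
them, in which case the transform misses that chart. -/
theorem hasFlagCharts_properTransform {Z : ℕ → TopologicalSpace.Closeds M} {a b : ℕ} {c : ℕ → ℕ}
    (hab : a < b) (h : HasFlagCharts ι Z a b c) :
    HasFlagCharts (M := BlowUp ι (Z a)) ι (fun h => properTransform (Z h)) (a + 1) b c := by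
  intro x
  have : Nonempty (BlowUp ι (Z a)) := ⟨x⟩
  obtain ⟨φ, hφ, hp, A, T, hZ, hc, hm⟩ := h x.proj
  by_cases hx : x.proj ∈ Z a
  · have hA : A a := ((hZ a le_rfl hab _ hp).1 hx).1
    have had : IsAdapted (Z a : Set M) φ (T a) :=
      ⟨hφ, fun q hq => (hZ a le_rfl hab q hq).trans (and_iff_right hA)⟩
    obtain ⟨j, hj, hxj⟩ := exists_mem_chartDom hx had hp
    obtain ⟨e, he, hes, hef, -⟩ := exists_excChart had hj
    refine ⟨e, he, hes ▸ hxj, fun h => A h ∧ j ∉ T h, T, fun h h1 h2 y hy => ?_,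
      fun h h1 h2 h3 => hc h (by omega) h2 h3.1, fun h h' h1 h2 h3 h4 => ?_⟩
    · rw [hes] at hy
      rw [hef]
      exact mem_properTransform_iff had hj (fun _ => (hm a h le_rfl (by omega) h2 hA).2)
        (hZ h (by omega) h2) hy
    · obtain ⟨h5, h6⟩ := hm h h' (by omega) h2 h3 h4.1
      exact ⟨⟨h5, fun h7 => h4.2 (h6 h7)⟩, h6⟩
  · obtain ⟨e, he, hes, hef⟩ := exists_offChart (X := Z a) hφ
    refine ⟨e, he, hes ▸ ⟨hp, hx⟩, A, T, fun h h1 h2 y hy => ?_,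
      fun h h1 h2 h3 => hc h (by omega) h2 h3, fun h h' h1 h2 h3 h4 => hm h h' (by omega) h2 h3 h4⟩
    rw [hes] at hy
    rw [hef, mem_properTransform_iff_of_notMem hy.2]
    exact hZ h (by omega) h2 _ hy.1

end BlowUp

end Flags

/-! ### Linear subspaces of the exceptional divisor of a point. -/

section PointBlowUp

namespace BlowUp

variable {ι : Type} [Fintype ι]

variable (ι) in
/-- The origin as a closed set. -/
def originClosed : TopologicalSpace.Closeds (ι → ℂ) := ⟨{0}, isClosed_singleton⟩

/-- The linear subspace of the exceptional divisor of the blow-up of the origin spanned by the `[e_i]`,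
`i ∈ W`. -/
def linearSub (W : Finset ι) : Set (BlowUp ι (originClosed ι)) :=
  {x | ∃ p hp hs v, x = BlowUp.exc p hp hs v ∧
    ∀ i, i ∉ W → dnormal (id : (ι → ℂ) → ι → ℂ) p v.rep i = 0}

theorem isAdapted_refl : IsAdapted (originClosed ι : Set (ι → ℂ))
    (OpenPartialHomeomorph.refl (ι → ℂ)) Finset.univ := by
  refine ⟨StructureGroupoid.id_mem_maximalAtlas _, fun q _ => ?_⟩
  change q = 0 ↔ _
  simp [funext_iff]

/-- A linear subspace in an affine chart of projective space: it misses the chart `j` if `j ∉ W`,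
and otherwise is cut out by the equation of the exceptional divisor and the coordinates outside `W`.
-/
theorem mem_linearSub_iff {W : Finset ι} {j : ι} {x : BlowUp ι (originClosed ι)}
    (hx : x ∈ (chartDom (id : (ι → ℂ) → ι → ℂ) univ j : Set (BlowUp ι (originClosed ι))))
    [DecidableEq ι] :
    x ∈ linearSub W ↔ j ∈ W ∧ ∀ i ∈ insert j Wᶜ,
      chartFun (id : (ι → ℂ) → ι → ℂ) Finset.univ j x i = 0 := by
  cases x with
  | off q hq =>
    constructor
    · rintro ⟨p, hp, hs, v, h, -⟩
      exact absurd h (by simp)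
    · rintro ⟨-, h⟩
      exact absurd ((chartFun_pivot_eq_zero_iff hx).1 (h j (by simp))) hq
  | exc p hp hs v =>
    have hj : dnormal (id : (ι → ℂ) → ι → ℂ) p v.rep j ≠ 0 := hx.2
    constructor
    · rintro ⟨p', hp', hs', v', h, h0⟩
      injection h with h1 h2
      subst h1
      obtain rfl := eq_of_heq h2
      have hjW : j ∈ W := by
        by_contra hjW
        exact hj (h0 j hjW)
      refine ⟨hjW, fun i hi => ?_⟩
      rw [Finset.mem_insert, Finset.mem_compl] at hi
      by_cases hij : i = j
      · simp [chartFun, hij]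
      · have := h0 i (hi.resolve_left hij)
        simp [chartFun, hij, this]
    · rintro ⟨hjW, h0⟩
      refine ⟨p, hp, hs, v, rfl, fun i hi => ?_⟩
      have hij : i ≠ j := fun h => hi (h ▸ hjW)
      have := h0 i (by simp [hi])
      simpa [chartFun, hij, hj] using this

/-- The condition is closed in each chart over the origin. Thus the closure taken in `tower` adds
nothing. -/
theorem isClosed_linearSub (W : Finset ι) : IsClosed (linearSub W) := by
  classical
  rw [← closure_subset_iff_isClosed]
  intro x hx
  have : Nonempty (BlowUp ι (originClosed ι)) := ⟨x⟩
  have hxX : x.proj ∈ originClosed ι := by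
    by_contra hne
    obtain ⟨y, hy, p, hp, hs, v, rfl, -⟩ := mem_closure_iff.1 hx _
      ((originClosed ι).isClosed.isOpen_compl.preimage continuous_proj) hne
    exact hy hp
  obtain ⟨j, hj, hxj⟩ := exists_mem_chartDom hxX isAdapted_refl (mem_univ _)
  obtain ⟨e, he, hes, hef, -⟩ := exists_excChart (isAdapted_refl (ι := ι)) hj
  have hC : IsClosed {w : ι → ℂ | j ∈ W ∧ ∀ i ∈ insert j Wᶜ, w i = 0} := by
    by_cases hjW : j ∈ W
    · simp only [hjW, true_and, ofPred_forall]
      exact isClosed_biInter fun i _ => isClosed_eq (continuous_apply i) continuous_const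
    · simp [hjW]
  have key : ∀ y ∈ e.source, y ∈ linearSub W ↔
      e y ∈ {w : ι → ℂ | j ∈ W ∧ ∀ i ∈ insert j Wᶜ, w i = 0} := by
    intro y hy
    rw [hes] at hy
    rw [hef]
    exact mem_linearSub_iff hy
  rw [key x (hes ▸ hxj)]
  exact (mem_closure_iff_of_chart e hC key (hes ▸ hxj)).1 hx

/-- The closed set `linearSub W`. -/
def linearSubClosed (W : Finset ι) : TopologicalSpace.Closeds (BlowUp ι (originClosed ι)) :=
  ⟨linearSub W, isClosed_linearSub W⟩

theorem proj_eq_zero_of_mem_linearSub {W : Finset ι} {x : BlowUp ι (originClosed ι)}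
    (hx : x ∈ linearSub W) : x.proj = 0 := by
  obtain ⟨p, hp, hs, v, rfl, -⟩ := hx
  exact hp

/-- Since the `W h` increase, once a member meets the chart `j` so do all the larger ones. The
additional codimension one comes from the equation of the exceptional divisor. -/
theorem hasFlagCharts_linearSub [DecidableEq ι] {W : ℕ → Finset ι} {b : ℕ}
    (hW : ∀ h h', 1 ≤ h → h ≤ h' → h' < b → W h ⊆ W h') :
    HasFlagCharts ι (fun h => linearSubClosed (W h)) 1 b fun h => (W h)ᶜ.card + 1 := by
  intro x
  have : Nonempty (BlowUp ι (originClosed ι)) := ⟨x⟩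
  by_cases hxX : x.proj ∈ originClosed ι
  · obtain ⟨j, hj, hxj⟩ := exists_mem_chartDom hxX isAdapted_refl (mem_univ _)
    obtain ⟨e, he, hes, hef, -⟩ := exists_excChart (isAdapted_refl (ι := ι)) hj
    refine ⟨e, he, hes ▸ hxj, fun h => j ∈ W h, fun h => insert j (W h)ᶜ, fun h h1 h2 y hy => ?_,
      fun h h1 h2 h3 => Finset.card_insert_of_notMem (by simpa using h3),
      fun h h' h1 h2 h3 h4 => ⟨hW h h' h1 h2 h3 h4, ?_⟩⟩
    · rw [hes] at hy
      rw [hef]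
      exact mem_linearSub_iff hy
    · exact Finset.insert_subset_insert _ (Finset.compl_subset_compl.2 (hW h h' h1 h2 h3))
  · obtain ⟨e, he, hes, hef⟩ := exists_offChart (X := originClosed ι)
      (isAdapted_refl (ι := ι)).1
    -- Off the exceptional divisor no member of the flag meets the chart.
    refine ⟨e, he, hes ▸ ⟨mem_univ _, hxX⟩, fun _ => False, fun _ => ∅, fun h h1 h2 y hy => ?_,
      fun _ _ _ h => h.elim, fun _ _ _ _ _ h => h.elim⟩
    rw [hes] at hy
    simp only [false_and, iff_false]
    exact fun h => hy.2 (proj_eq_zero_of_mem_linearSub h)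

theorem dnormal_eq_fderiv {X : Set (ι → ℂ)} (G : (ι → ℂ) → ι → ℂ) (p : ι → ℂ)
    (v : NormalSpace (ι := ι) X p) :
    dnormal G p v = fderiv ℂ G p (dnormal (id : (ι → ℂ) → ι → ℂ) p v) := by
  simp only [dnormal, dchart]
  rw [mfderiv_eq_fderiv, mfderiv_eq_fderiv, fderiv_id]
  rfl

/-- On the exceptional divisor the lift is the projectivization of the differential at the origin,
so an invariant coordinate subspace gives an invariant linear subspace. -/
theorem liftMap_mem_linearSub {G H : (ι → ℂ) → ι → ℂ} {U U' : Set (ι → ℂ)}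
    (h : IsBihol ι G H U U') (hX : ∀ x ∈ U, G x ∈ originClosed ι ↔ x ∈ originClosed ι)
    {W : Finset ι} (h0 : (0 : ι → ℂ) ∈ U)
    (hW : ∀ v : ι → ℂ, (∀ i, i ∉ W → v i = 0) → ∀ i, i ∉ W → fderiv ℂ G 0 v i = 0)
    {x : BlowUp ι (originClosed ι)} (hx : x ∈ linearSub W) : liftMap G x ∈ linearSub W := by
  classical
  obtain ⟨p, hp, hs, v, rfl, hv⟩ := hx
  have hp0 : p = 0 := hp
  subst hp0
  have s := liftMap_spec h hX (x := exc 0 hp hs v) h0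
  set y := liftMap G (exc 0 hp hs v : BlowUp ι (originClosed ι)) with hy
  have hyX : y.proj ∈ originClosed ι := by rw [s.proj_eq]; exact (hX 0 h0).2 hp
  obtain ⟨j, hj, hyj⟩ := exists_mem_chartDom hyX isAdapted_refl (mem_univ _)
  have hvG : ∀ i, i ∉ W → dnormal G 0 v.rep i = 0 := by
    intro i hi
    rw [dnormal_eq_fderiv]
    exact hW _ hv i hi
  have hxj := (s.mem_iff _ _ isAdapted_refl (mem_univ _) j hj).1 hyj
  have hjG : dnormal G 0 v.rep j ≠ 0 := hxj.2
  refine (mem_linearSub_iff hyj).2 ⟨?_, fun i hi => ?_⟩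
  · by_contra hjW
    exact hjG (hvG j hjW)
  · have e1 := s.chartFun_eq _ _ isAdapted_refl j hj hyj
    have e2 := congrFun e1 i
    refine e2.trans ?_
    change chartFun G Finset.univ j (exc 0 hp hs v : BlowUp ι (originClosed ι)) i = 0
    rw [Finset.mem_insert, Finset.mem_compl] at hi
    by_cases hij : i = j
    · simp [chartFun, hij]
    · simp [chartFun, hij, hvG i (hi.resolve_left hij)]

end BlowUp

end PointBlowUp

/-! ### Index sets of the tower, and the data carried by the induction. -/

namespace RhoPartition

variable {ρ : ℕ} [NeZero ρ] (P : RhoPartition ρ)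

theorem idx_fst (l : Fin ρ) (i : ℕ) : (P.idx l i).1 = l := rfl

theorem idx_snd (l : Fin ρ) (i : ℕ) : ((P.idx l i).2 : ℕ) = min (i - 1) (P.μ l - 1) := rfl

theorem idx_eta (x : P.Idx) : P.idx x.1 (x.2 + 1) = x := by
  obtain ⟨l, i⟩ := x
  refine Sigma.ext rfl (heq_of_eq (Fin.ext ?_))
  rw [idx_snd]
  have := i.2
  simp only [add_tsub_cancel_right]
  omega

theorem idx_eq_idx_iff {l : Fin ρ} {i i' : ℕ} (hi : 1 ≤ i) (hi' : 1 ≤ i') (hl : i ≤ P.μ l)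
    (hl' : i' ≤ P.μ l) : P.idx l i = P.idx l i' ↔ i = i' := by
  refine ⟨fun h => ?_, fun h => h ▸ rfl⟩
  have h1 : ((P.idx l i).2 : ℕ) = ((P.idx l i').2 : ℕ) := by rw [h]
  rw [idx_snd, idx_snd] at h1
  omega

theorem one_ne_zero_of_equalTop (h : P.EqualTop) : (1 : Fin ρ) ≠ 0 := by
  intro h0
  have := congrArg Fin.val h0
  rw [Fin.val_one', Fin.val_zero, Nat.mod_eq_of_lt h.1] at this
  exact one_ne_zero this

theorem le_length : P.μ 0 ≤ P.length := by
  unfold length; split_ifs <;> omega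

theorem length_le : P.length ≤ P.μ 0 + 1 := by
  unfold length; split_ifs <;> omega

theorem equalTop_of_lt (h : P.μ 0 < P.length) : P.EqualTop := by
  by_contra hne
  rw [length, if_neg hne] at h
  omega

theorem mem_split_of_lt {k : ℕ} (hk : k < P.μ 0) {x : P.Idx} : x ∈ P.split k ↔ (x.2 : ℕ) < k := by
  simp [split, hk]

theorem mem_split_of_le {k : ℕ} (hk : P.μ 0 ≤ k) {x : P.Idx} :
    x ∈ P.split k ↔ x ≠ P.idx 1 (P.μ 1) := by
  simp [split, not_lt.2 hk]

/-- Only the passage to `h' = μ_1` needs an argument. It occurs in case (E), and the index omitted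
there is at position `μ_2 = μ_1`, so it is in none of the earlier sets. -/
theorem split_mono {h h' : ℕ} (hh : h ≤ h') (hl : h' < P.length) : P.split h ⊆ P.split h' := by
  intro x hx
  by_cases h1 : h' < P.μ 0
  · rw [P.mem_split_of_lt (by omega)] at hx
    rw [P.mem_split_of_lt h1]
    omega
  · rw [P.mem_split_of_le (by omega)]
    by_cases h2 : h < P.μ 0
    · rw [P.mem_split_of_lt h2] at hx
      rintro rfl
      have he := P.equalTop_of_lt (by omega)
      have := P.pos 1
      have := he.2
      rw [idx_snd] at hx
      omega
    · rwa [P.mem_split_of_le (by omega)] at hx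

theorem idx_zero_mem_split {k i : ℕ} (hk : k < P.length) (hi : i ≤ k) (h1 : 1 ≤ k) :
    P.idx 0 i ∈ P.split k := by
  by_cases h2 : k < P.μ 0
  · rw [P.mem_split_of_lt h2, idx_snd]
    omega
  · rw [P.mem_split_of_le (by omega)]
    intro h
    exact P.one_ne_zero_of_equalTop (P.equalTop_of_lt (by omega)) (congrArg Sigma.fst h).symm

theorem card_normalIdx {k : ℕ} (hk : k < P.length) (h1 : 1 ≤ k) :
    (P.normalIdx k).card = (P.split k)ᶜ.card + 1 :=
  Finset.card_insert_of_notMem (by simpa using P.idx_zero_mem_split hk h1 h1)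

theorem normalIdx_zero : P.normalIdx 0 = Finset.univ := by
  have : P.split 0 = ∅ := by
    ext x
    rw [P.mem_split_of_lt (P.pos 0)]
    simp
  simp [normalIdx, this]

theorem normalIdx_anti {h h' : ℕ} (hh : h ≤ h') (hl : h' < P.length) :
    P.normalIdx h' ⊆ P.normalIdx h :=
  Finset.insert_subset_insert _ (Finset.compl_subset_compl.2 (P.split_mono hh hl))

theorem pivot_one : P.pivot 1 = P.idx 0 1 := if_pos (P.pos 0)

theorem pivot_mem (k : ℕ) : P.pivot (k + 1) ∈ P.normalIdx k := by
  refine Finset.mem_insert_of_mem (Finset.mem_compl.2 ?_)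
  by_cases h2 : k < P.μ 0
  · rw [P.mem_split_of_lt h2, pivot, if_pos (by omega), idx_snd]
    omega
  · rw [P.mem_split_of_le (by omega), pivot, if_neg (by omega)]
    simp

/-- By `mem_properTransform_iff`, a later center remains visible in the next canonical chart exactly
when the pivot is not one of its equations. Here the pivot belongs to the first block and to `P'_h`,
and `1 ≤ k` distinguishes it from the first coordinate. -/
theorem pivot_notMem (hμ : 2 ≤ P.μ 0) {k h : ℕ} (hk : 1 ≤ k) (hkh : k + 1 ≤ h)
    (hl : h < P.length) : P.pivot (k + 1) ∉ P.normalIdx h := by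
  have := P.length_le
  rw [pivot, if_pos (by omega), normalIdx, Finset.mem_insert, not_or, Finset.mem_compl, not_not]
  refine ⟨?_, P.idx_zero_mem_split hl hkh (by omega)⟩
  rw [P.idx_eq_idx_iff (by omega) le_rfl (by omega) (by omega)]
  omega

/-- The lifts of `F` to the manifolds of the sequence. -/
noncomputable def liftTower (F : (P.Idx → ℂ) → P.Idx → ℂ) : ∀ k, P.Mfd k → P.Mfd k
  | 0 => F
  | k + 1 => BlowUp.liftMap (X := (P.tower k).sub k) (liftTower F k)

/-- What is known about the `k`-th manifold independently of the next center. -/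
structure StageManifold (F H : (P.Idx → ℂ) → P.Idx → ℂ) (U U' : Set (P.Idx → ℂ)) (k : ℕ) :
    Prop where
  isManifold : IsManifold 𝓘(ℂ, P.Idx → ℂ) ω (P.Mfd k)
  t2Space : T2Space (P.Mfd k)
  secondCountable : SecondCountableTopology (P.Mfd k)
  contMDiff_proj : ContMDiff 𝓘(ℂ, P.Idx → ℂ) 𝓘(ℂ, P.Idx → ℂ) ω (P.proj k)
  exists_inv : ∃ g : (P.Idx → ℂ) → P.Mfd k,
    ContMDiffOn 𝓘(ℂ, P.Idx → ℂ) 𝓘(ℂ, P.Idx → ℂ) ω g {0}ᶜ ∧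
    (∀ z, z ≠ 0 → P.proj k (g z) = z) ∧ ∀ x, P.proj k x ≠ 0 → g (P.proj k x) = x
  dense : Dense {x : P.Mfd k | P.proj k x ≠ 0}
  exists_chart : ∃ χ, P.IsCanonicalChart k χ
  base_spec : ∀ e, (P.tower k).isBase e → e ∈ (P.tower k).dom ∧ (P.tower k).chart e = 0
  isBihol : IsBihol P.Idx (P.liftTower F k) (P.liftTower H k) (P.proj k ⁻¹' U) (P.proj k ⁻¹' U')
  semiconj : ∀ x, P.proj k x ∈ U → P.proj k (P.liftTower F k x) = F (P.proj k x)

/-- What is known about the `k`-th center. -/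
structure StageCenter (F : (P.Idx → ℂ) → P.Idx → ℂ) (U : Set (P.Idx → ℂ)) (k : ℕ) :
    Prop where
  adapted : ∀ p ∈ P.center k, ∃ (φ : OpenPartialHomeomorph (P.Mfd k) (P.Idx → ℂ))
    (S : Finset P.Idx), IsAdapted (P.center k) φ S ∧ p ∈ φ.source ∧ S.card = (P.normalIdx k).card
  chart_adapted : ∀ q ∈ (P.tower k).dom, q ∈ P.center k ↔
    ∀ i ∈ P.normalIdx k, (P.tower k).chart q i = 0
  proj_eq_zero : ∀ x ∈ P.center k, P.proj k x = 0
  lift_mem_iff : ∀ x, P.proj k x ∈ U → (P.liftTower F k x ∈ P.center k ↔ x ∈ P.center k)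

/-- What is known about the flag of the iterated proper transforms in the `k`-th manifold. -/
structure StageFlag (F H : (P.Idx → ℂ) → P.Idx → ℂ) (U U' : Set (P.Idx → ℂ)) (k : ℕ) :
    Prop where
  flags : HasFlagCharts P.Idx (P.tower k).sub k P.length fun h => (P.normalIdx h).card
  chart_flag : ∀ h, k ≤ h → h < P.length → ∀ q ∈ (P.tower k).dom, q ∈ (P.tower k).sub h ↔
    ∀ i ∈ P.normalIdx h, (P.tower k).chart q i = 0
  proj_eq_zero : ∀ h, k ≤ h → h < P.length → ∀ x ∈ (P.tower k).sub h, P.proj k x = 0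
  lift_mem : ∀ h, k ≤ h → h < P.length → ∀ x, P.proj k x ∈ U → x ∈ (P.tower k).sub h →
    P.liftTower F k x ∈ (P.tower k).sub h
  lift_inv_mem : ∀ h, k ≤ h → h < P.length → ∀ x, P.proj k x ∈ U' → x ∈ (P.tower k).sub h →
    P.liftTower H k x ∈ (P.tower k).sub h

variable {P} {F H : (P.Idx → ℂ) → P.Idx → ℂ} {U U' : Set (P.Idx → ℂ)}

theorem StageFlag.stageCenter {k : ℕ} (hF : P.StageFlag F H U U' k)
    (hA : P.StageManifold F H U U' k) (hk : k < P.length) : P.StageCenter F U k where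
  adapted p hp := by
    obtain ⟨φ, hφ, hpφ, A, T, h1, h2, -⟩ := hF.flags p
    have hA : A k := ((h1 k le_rfl hk p hpφ).1 hp).1
    exact ⟨φ, T k, ⟨hφ, fun q hq => (h1 k le_rfl hk q hq).trans (and_iff_right hA)⟩, hpφ,
      h2 k le_rfl hk hA⟩
  chart_adapted := hF.chart_flag k le_rfl hk
  proj_eq_zero := hF.proj_eq_zero k le_rfl hk
  lift_mem_iff := hA.isBihol.mem_iff (hF.lift_mem k le_rfl hk) (hF.lift_inv_mem k le_rfl hk)

theorem stageManifold_zero (h : IsBihol P.Idx F H U U') : P.StageManifold F H U U' 0 where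
  isManifold := inferInstanceAs (IsManifold 𝓘(ℂ, P.Idx → ℂ) ω (P.Idx → ℂ))
  t2Space := inferInstanceAs (T2Space (P.Idx → ℂ))
  secondCountable := inferInstanceAs (SecondCountableTopology (P.Idx → ℂ))
  contMDiff_proj := contMDiff_id
  exists_inv := ⟨id, contMDiffOn_id, fun _ _ => rfl, fun _ _ => rfl⟩
  dense := by
    refine (dense_forall_ne_zero P.Idx).mono fun w hw => ?_
    have hw' : ∀ h : P.Idx, (w : P.Idx → ℂ) h ≠ 0 := hw
    exact fun h0 => hw' (P.idx 0 1) (congrFun h0 _)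
  exists_chart := ⟨OpenPartialHomeomorph.refl _, StructureGroupoid.id_mem_maximalAtlas _, rfl, rfl,
    fun _ _ => rfl⟩
  base_spec e he := ⟨mem_univ _, he⟩
  isBihol := h
  semiconj _ _ := rfl

theorem stageCenter_zero (h : IsBihol P.Idx F H U U') (h0 : 0 ∈ U) (hF0 : F 0 = 0) :
    P.StageCenter F U 0 where
  adapted p hp := ⟨OpenPartialHomeomorph.refl _, Finset.univ, BlowUp.isAdapted_refl, mem_univ _,
    by rw [normalIdx_zero]⟩
  chart_adapted q _ := by
    rw [normalIdx_zero]
    exact (BlowUp.isAdapted_refl (ι := P.Idx)).2 q (mem_univ _)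
  proj_eq_zero x hx := hx
  lift_mem_iff := by
    have key : ∀ x : P.Idx → ℂ, x ∈ U → (F x = 0 ↔ x = 0) := by
      intro x hx
      refine ⟨fun hx0 => ?_, fun hx0 => by rw [hx0, hF0]⟩
      rw [← h.left_inv x hx, hx0, ← hF0, h.left_inv 0 h0]
      exact hF0.symm
    exact key

end RhoPartition

/-! ### From one stage of the tower to the next. -/

namespace BlowUp

variable {ι : Type} [Fintype ι] {M : Type} [TopologicalSpace M] [ChartedSpace (ι → ℂ) M]
  {X : TopologicalSpace.Closeds M}

theorem chartDom_congr {φ φ' : M → ι → ℂ} {V : Set M} (hV : IsOpen V) (h : EqOn φ φ' V) (j : ι) :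
    (chartDom φ V j : Set (BlowUp ι X)) = chartDom φ' V j := by
  ext x
  by_cases hx : x.proj ∈ V
  · exact mem_chartDom_congr j (h.eventuallyEq_of_mem (hV.mem_nhds hx)) Iff.rfl
  · exact ⟨fun h => absurd (proj_mem_of_mem_chartDom h) hx,
      fun h => absurd (proj_mem_of_mem_chartDom h) hx⟩

theorem eqOn_chartFun {φ φ' : M → ι → ℂ} {V : Set M} (hV : IsOpen V) (h : EqOn φ φ' V)
    (S : Finset ι) (j : ι) :
    EqOn (chartFun φ S j : BlowUp ι X → ι → ℂ) (chartFun φ' S j) (chartDom φ V j) := fun _ hx =>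
  chartFun_congr S j (h.eventuallyEq_of_mem (hV.mem_nhds (proj_mem_of_mem_chartDom hx)))

/-- The point in the direction of the coordinate vector `∂/∂w_j` at the center of a chart. -/
theorem chartFun_single [DecidableEq ι] {φ : OpenPartialHomeomorph M (ι → ℂ)} {S : Finset ι}
    (hφ : IsAdapted (X : Set M) φ S) {j : ι} (hj : j ∈ S) {p : M} (hp : p ∈ φ.source)
    (h0 : φ p = 0) (hX : p ∈ X) (hs : IsSubmanifoldAt ι (X : Set M) p)
    (u : TangentSpace 𝓘(ℂ, ι → ℂ) p)
    (hu : (Submodule.Quotient.mk u : NormalSpace (ι := ι) (X : Set M) p) ≠ 0)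
    (hdu : dchart φ p u = Pi.single j 1) :
    (exc p hX hs (Projectivization.mk ℂ _ hu) : BlowUp ι X) ∈ (chartDom φ φ.source j : Set _) ∧
      chartFun φ S j (exc p hX hs (Projectivization.mk ℂ _ hu) : BlowUp ι X) = 0 := by
  obtain ⟨a, ha⟩ := Projectivization.exists_smul_eq_mk_rep ℂ _ hu
  have ha' : (Projectivization.mk ℂ _ hu).rep
      = (Submodule.Quotient.mk ((a : ℂ) • u) : NormalSpace (ι := ι) (X : Set M) p) := by
    rw [← ha, Units.smul_def, Submodule.Quotient.mk_smul]
  have key : ∀ h ∈ S, dnormal φ p (Projectivization.mk ℂ _ hu).rep h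
      = a * (Pi.single j 1 : ι → ℂ) h := by
    intro h hh
    rw [ha', dnormal_mk hφ hp hX _ hh, map_smul, hdu]
    rfl
  refine ⟨⟨hp, ?_⟩, ?_⟩
  · rw [key j hj]; simp
  · funext h
    simp only [chartFun, Pi.zero_apply]
    split_ifs with h1 h2
    · rfl
    · rw [key h h2]; simp [h1]
    · rw [h0]; rfl

end BlowUp

namespace RhoPartition

variable {ρ : ℕ} [NeZero ρ] {P : RhoPartition ρ} {F H : (P.Idx → ℂ) → P.Idx → ℂ}
  {U U' : Set (P.Idx → ℂ)}

theorem StageManifold.exists_adapted_chart {k : ℕ} (hA : P.StageManifold F H U U' k)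
    (hB : P.StageCenter F U k) :
    ∃ χ, P.IsCanonicalChart k χ ∧ IsAdapted (P.center k) χ (P.normalIdx k) := by
  obtain ⟨χ, hχ⟩ := hA.exists_chart
  refine ⟨χ, hχ, hχ.mem_maximalAtlas, fun q hq => ?_⟩
  have hq' : q ∈ (P.tower k).dom := hχ.source_eq ▸ hq
  rw [hB.chart_adapted q hq', hχ.eqOn hq']

/-- The center lies over the origin, so the blow-up changes nothing outside the singular divisor and
the inverse of `π_k` lifts. The remaining fields come from the results on a single blow-up, applied
to a canonical chart, which is adapted to the center. -/
theorem StageManifold.succ {k : ℕ} (hA : P.StageManifold F H U U' k)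
    (hB : P.StageCenter F U k) : P.StageManifold F H U U' (k + 1) := by
  have := hA.isManifold
  have := hA.t2Space
  have := hA.secondCountable
  have hproj : ContMDiff 𝓘(ℂ, P.Idx → ℂ) 𝓘(ℂ, P.Idx → ℂ) ω (P.proj (k + 1)) :=
    hA.contMDiff_proj.comp (BlowUp.contMDiff_proj (X := (P.tower k).sub k))
  obtain ⟨χ, hχ, had⟩ := hA.exists_adapted_chart hB
  have hdom : IsOpen (P.tower k).dom := hχ.source_eq ▸ χ.open_source
  obtain ⟨g, hg1, hg2, hg3⟩ := hA.exists_inv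
  have hgX : ∀ z, z ≠ 0 → g z ∉ (P.tower k).sub k := fun z hz hc =>
    hz (by rw [← hg2 z hz]; exact hB.proj_eq_zero _ hc)
  have hne : Nonempty (BlowUp P.Idx ((P.tower k).sub k)) :=
    ⟨.off (g (Pi.single (P.idx 0 1) 1)) (hgX _ (by simp))⟩
  have hlift := BlowUp.isBihol_liftMap (X := (P.tower k).sub k) hA.isBihol hB.lift_mem_iff
  refine ⟨BlowUp.isManifold (X := (P.tower k).sub k), BlowUp.t2Space (X := (P.tower k).sub k),
    BlowUp.secondCountableTopology (X := (P.tower k).sub k), hproj, ?_, ?_, ?_, ?_, hlift, ?_⟩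
  · refine ⟨fun z => (BlowUp.ofOff (g z) : BlowUp P.Idx ((P.tower k).sub k)), ?_,
      fun z hz => ?_, fun x hx => ?_⟩
    · exact (BlowUp.contMDiffOn_ofOff (X := (P.tower k).sub k)).comp hg1 fun z hz => hgX z hz
    · change P.proj k (BlowUp.proj (BlowUp.ofOff (g z) : BlowUp P.Idx ((P.tower k).sub k))) = z
      rw [BlowUp.proj_ofOff (hgX z hz), hg2 z hz]
    · have h1 := hg3 _ hx
      have h2 : BlowUp.proj (X := (P.tower k).sub k) x ∉ (P.tower k).sub k :=
        fun hc => hx (hB.proj_eq_zero _ hc)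
      refine BlowUp.eq_of_proj_eq (X := (P.tower k).sub k) ?_ ?_
      · exact (BlowUp.proj_ofOff (hgX _ hx)).trans h1
      · rw [BlowUp.proj_ofOff (hgX _ hx)]
        exact hgX _ hx
  · exact BlowUp.dense_preimage_proj (X := (P.tower k).sub k) hA.dense
  · obtain ⟨e, he, hes, hef, het⟩ := BlowUp.exists_excChart had (P.pivot_mem k)
    have hd : (P.tower (k + 1)).dom = e.source := by
      rw [hes]
      refine (BlowUp.chartDom_congr (X := (P.tower k).sub k) hdom hχ.eqOn.symm _).trans ?_
      rw [← hχ.source_eq]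
    refine ⟨e, he, hd.symm, ?_, fun x hx => (hef x).trans ?_⟩
    · rw [het, hχ.target_eq]
      simp
    · refine BlowUp.eqOn_chartFun (X := (P.tower k).sub k) hdom hχ.eqOn _ _ ?_
      rw [← hχ.source_eq, ← hes]
      exact hd ▸ hx
  · rintro e ⟨p, hp, hs, hbase, u, hu, hdu, rfl⟩
    obtain ⟨hpd, hp0⟩ := hA.base_spec p hbase
    have hev : χ =ᶠ[𝓝 p] (P.tower k).chart :=
      hχ.eqOn.eventuallyEq_of_mem (hdom.mem_nhds hpd)
    have h0 : χ p = 0 := by rw [hχ.eqOn hpd, hp0]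
    have hdu' : dchart χ p u = Pi.single (P.pivot (k + 1)) 1 := by
      rw [← hdu, dchart, dchart, hev.mfderiv_eq]
    have hpχ : p ∈ χ.source := hχ.source_eq ▸ hpd
    obtain ⟨h1, h2⟩ := BlowUp.chartFun_single had (P.pivot_mem k) hpχ h0 hp hs u hu hdu'
    refine ⟨(BlowUp.mem_chartDom_congr (V := χ.source) (V' := (P.tower k).dom) (P.pivot (k + 1))
      (x := (BlowUp.exc p hp hs (Projectivization.mk ℂ _ hu) : BlowUp P.Idx ((P.tower k).sub k)))
      hev ?_).1 h1, (BlowUp.chartFun_congr _ _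
      (x := (BlowUp.exc p hp hs (Projectivization.mk ℂ _ hu) : BlowUp P.Idx ((P.tower k).sub k)))
      hev).symm.trans h2⟩
    rw [hχ.source_eq]
  · intro x hx
    have h1 := BlowUp.proj_liftMap (X := (P.tower k).sub k) hA.isBihol hB.lift_mem_iff
      (x := x) hx
    change P.proj k (BlowUp.proj (BlowUp.liftMap _ x)) = _
    rw [h1]
    exact hA.semiconj _ hx

/-- The pivot is a normal index, so the coordinate vector `∂/∂w_j` is not tangent to the center and
does define a normal direction. -/
theorem StageManifold.exists_base_succ {k : ℕ} (hA : P.StageManifold F H U U' k)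
    (hB : P.StageCenter F U k) {e : P.Mfd k} (he : (P.tower k).isBase e) :
    ∃ e' : P.Mfd (k + 1), (P.tower (k + 1)).isBase e' ∧
      BlowUp.proj (X := (P.tower k).sub k) e' = e := by
  have := hA.isManifold
  obtain ⟨χ, hχ, had⟩ := hA.exists_adapted_chart hB
  obtain ⟨hpd, hp0⟩ := hA.base_spec e he
  have hdom : IsOpen (P.tower k).dom := hχ.source_eq ▸ χ.open_source
  have hev : χ =ᶠ[𝓝 e] (P.tower k).chart :=
    hχ.eqOn.eventuallyEq_of_mem (hdom.mem_nhds hpd)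
  have heχ : e ∈ χ.source := hχ.source_eq ▸ hpd
  have heX : e ∈ (P.tower k).sub k := by
    refine (hB.chart_adapted e hpd).2 fun i _ => ?_
    rw [hp0]; rfl
  obtain ⟨u, hu⟩ := (dchart_bijective hχ.mem_maximalAtlas heχ).2 (Pi.single (P.pivot (k + 1)) 1)
  have hne : (Submodule.Quotient.mk u : NormalSpace (ι := P.Idx) (P.center k) e) ≠ 0 := by
    intro h0
    rw [Submodule.Quotient.mk_eq_zero, mem_tangentOf had heχ heX] at h0
    have := h0 _ (P.pivot_mem k)
    rw [hu] at this
    simp at this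
  refine ⟨BlowUp.exc e heX ⟨χ, _, had, heχ⟩ (Projectivization.mk ℂ _ hne),
    ⟨e, heX, ⟨χ, _, had, heχ⟩, he, u, hne, ?_, rfl⟩, rfl⟩
  rw [← hu, dchart, dchart, hev.mfderiv_eq]

/-- Proper transforms inherit the flag charts and the invariance. The lift of `H` is treated on the
same footing as that of `F`, because an equivalence, and not just an inclusion, is needed in order
to lift again. -/
theorem StageFlag.succ (hμ : 2 ≤ P.μ 0) {k : ℕ} (hk1 : 1 ≤ k) (hk : k < P.length)
    (hA : P.StageManifold F H U U' k) (hA' : P.StageManifold H F U' U k)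
    (hF : P.StageFlag F H U U' k) : P.StageFlag F H U U' (k + 1) := by
  have := hA.isManifold
  have hB := hF.stageCenter hA hk
  obtain ⟨χ, hχ, had⟩ := hA.exists_adapted_chart hB
  have hdom : IsOpen (P.tower k).dom := hχ.source_eq ▸ χ.open_source
  have hsub : (P.tower (k + 1)).sub = fun h => BlowUp.properTransform (ι := P.Idx)
      (X := (P.tower k).sub k) ((P.tower k).sub h : Set (P.Mfd k)) := by
    funext h
    exact if_neg (by omega)
  refine ⟨?_, ?_, ?_, ?_, ?_⟩
  · rw [hsub]
    exact BlowUp.hasFlagCharts_properTransform hk hF.flags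
  · intro h h1 h2 q hq
    rw [hsub]
    have hq' : q ∈ (BlowUp.chartDom χ χ.source (P.pivot (k + 1)) :
        Set (BlowUp P.Idx ((P.tower k).sub k))) := by
      rw [BlowUp.chartDom_congr (X := (P.tower k).sub k) χ.open_source
        (hχ.source_eq.symm ▸ hχ.eqOn) _, hχ.source_eq]
      exact hq
    have e1 : BlowUp.chartFun χ (P.normalIdx k) (P.pivot (k + 1)) q = (P.tower (k + 1)).chart q :=
      BlowUp.eqOn_chartFun (X := (P.tower k).sub k) χ.open_source
        (hχ.source_eq.symm ▸ hχ.eqOn) _ _ hq'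
    rw [← e1]
    -- In the canonical chart every remaining member of the flag is present, and stays so since the
    -- pivot is not among its equations.
    refine (BlowUp.mem_properTransform_iff had (P.pivot_mem k) (A := True) (T := P.normalIdx h)
      (fun _ => P.normalIdx_anti (by omega) h2) (fun q hq => ?_) hq').trans ?_
    · have hqd : q ∈ (P.tower k).dom := hχ.source_eq ▸ hq
      rw [true_and, hχ.eqOn hqd]
      exact hF.chart_flag h (by omega) h2 q hqd
    · simp [P.pivot_notMem hμ hk1 h1 h2]
  · intro h h1 h2 x hx
    rw [hsub] at hx
    exact hF.proj_eq_zero h (by omega) h2 _ (BlowUp.proj_mem_of_mem_properTransform hx)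
  · intro h h1 h2 x hx hxs
    rw [hsub] at hxs ⊢
    exact BlowUp.liftMap_mem_properTransform hA.isBihol hB.lift_mem_iff
      (hF.lift_mem h (by omega) h2) hx hxs
  · intro h h1 h2 x hx hxs
    rw [hsub] at hxs ⊢
    exact BlowUp.liftMap_mem_properTransform hA'.isBihol
      (hA.isBihol.mem_iff_symm hB.lift_mem_iff) (hF.lift_inv_mem h (by omega) h2) hx hxs

/-- The base case is the stage 1: the flag lives on the first exceptional divisor, and its
invariance is that of the coordinate subspaces under the differentials of `F` and `H` at the origin.
-/
theorem stageFlag_one (h : IsBihol P.Idx F H U U') (h0 : 0 ∈ U) (hF0 : F 0 = 0)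
    (hW : ∀ k, 1 ≤ k → k < P.length → ∀ v : P.Idx → ℂ, (∀ i, i ∉ P.split k → v i = 0) →
      ∀ i, i ∉ P.split k → fderiv ℂ F 0 v i = 0)
    (hW' : ∀ k, 1 ≤ k → k < P.length → ∀ v : P.Idx → ℂ, (∀ i, i ∉ P.split k → v i = 0) →
      ∀ i, i ∉ P.split k → fderiv ℂ H 0 v i = 0) :
    P.StageFlag F H U U' 1 := by
  have hH0 : H 0 = 0 := by
    have := h.left_inv 0 h0
    rwa [hF0] at this
  have h0' : (0 : P.Idx → ℂ) ∈ U' := by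
    have := h.mapsTo h0
    rwa [hF0] at this
  have hB := stageCenter_zero h h0 hF0
  have hB' := stageCenter_zero h.symm h0' hH0
  have hsub : (P.tower 1).sub = fun h => BlowUp.linearSubClosed (P.split h) := by
    funext h
    exact TopologicalSpace.Closeds.ext (BlowUp.isClosed_linearSub (P.split h)).closure_eq
  refine ⟨?_, ?_, ?_, ?_, ?_⟩
  · rw [hsub]
    intro p
    obtain ⟨φ, hφ, hp, A, T, a1, a2, a3⟩ := BlowUp.hasFlagCharts_linearSub (W := P.split)
      (b := P.length) (fun h h' _ h2 h3 => P.split_mono h2 h3) p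
    refine ⟨φ, hφ, hp, A, T, a1, fun h h1 h2 h3 => ?_, a3⟩
    exact (a2 h h1 h2 h3).trans (P.card_normalIdx h2 h1).symm
  · intro k h1 h2 q hq
    rw [hsub]
    refine (BlowUp.mem_linearSub_iff hq).trans ?_
    have hp1 : P.pivot (0 + 1) = P.idx 0 1 := P.pivot_one
    rw [hp1, and_iff_right (P.idx_zero_mem_split h2 h1 h1)]
    have e0 : ∀ (S : Finset P.Idx) (j : P.Idx), S = Finset.univ → j = P.idx 0 1 →
        (BlowUp.chartFun id S j : BlowUp P.Idx (BlowUp.originClosed P.Idx) → P.Idx → ℂ) =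
          BlowUp.chartFun id Finset.univ (P.idx 0 1) := by
      rintro S j rfl rfl
      rfl
    have e1 : (P.tower 1).chart q =
        BlowUp.chartFun (X := BlowUp.originClosed P.Idx) id Finset.univ (P.idx 0 1) q :=
      congrFun (e0 _ _ P.normalIdx_zero P.pivot_one) q
    rw [e1]
    exact Iff.rfl
  · intro k h1 h2 x hx
    rw [hsub] at hx
    exact BlowUp.proj_eq_zero_of_mem_linearSub hx
  · intro k h1 h2 x hx hxs
    rw [hsub] at hxs ⊢
    exact BlowUp.liftMap_mem_linearSub h hB.lift_mem_iff h0 (hW k h1 h2) hxs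
  · intro k h1 h2 x hx hxs
    rw [hsub] at hxs ⊢
    exact BlowUp.liftMap_mem_linearSub h.symm hB'.lift_mem_iff h0' (hW' k h1 h2) hxs

end RhoPartition

/-- Inverse function theorem. Both domains are cut down to the points where `F` and its local
inverse are analytic, at the point and at its image, so that they still correspond to each other. -/
theorem exists_isBihol {ι : Type} [Fintype ι] {F : (ι → ℂ) → ι → ℂ} (hF : AnalyticAt ℂ F 0)
    (hF0 : F 0 = 0) (hinv : IsUnit (fderiv ℂ F 0).toLinearMap) :
    ∃ (H : (ι → ℂ) → ι → ℂ) (U U' : Set (ι → ℂ)), IsBihol ι F H U U' ∧ 0 ∈ U ∧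
      ∀ v, fderiv ℂ F 0 (fderiv ℂ H 0 v) = v := by
  have hbij : Function.Bijective (fderiv ℂ F 0).toLinearMap :=
    (Module.End.isUnit_iff _).1 hinv
  let L : (ι → ℂ) ≃L[ℂ] (ι → ℂ) := (LinearEquiv.ofBijective _ hbij).toContinuousLinearEquiv
  have hL : (L : (ι → ℂ) →L[ℂ] (ι → ℂ)) = fderiv ℂ F 0 := by
    ext v i; rfl
  have hd : HasFDerivAt F (L : (ι → ℂ) →L[ℂ] (ι → ℂ)) 0 := by
    rw [hL]; exact hF.differentiableAt.hasFDerivAt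
  have hc : ContDiffAt ℂ ω F 0 := hF.contDiffAt
  set e := hc.toOpenPartialHomeomorph F hd (by simp) with he
  have he0 : (0 : ι → ℂ) ∈ e.source := hc.mem_toOpenPartialHomeomorph_source hd (by simp)
  have heF : ∀ x, e x = F x := fun x => rfl
  have hs0 : e.symm 0 = 0 := by
    have := e.left_inv he0
    rwa [heF, hF0] at this
  have ht0 : (0 : ι → ℂ) ∈ e.target := by
    have := e.map_source he0
    rwa [heF, hF0] at this
  have hsd : HasFDerivAt e.symm (L.symm : (ι → ℂ) →L[ℂ] (ι → ℂ)) 0 := by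
    refine e.hasFDerivAt_symm ht0 ?_
    rw [hs0]; exact hd
  have hsc : AnalyticAt ℂ e.symm 0 := by
    refine ContDiffAt.analyticAt (e.contDiffAt_symm (f₀' := L) ht0 ?_ ?_)
    · rw [hs0]; exact hd
    · rw [hs0]; exact hc
  have o1 : IsOpen {x | AnalyticAt ℂ F x} := isOpen_analyticAt ℂ F
  have o2 : IsOpen {x | AnalyticAt ℂ e.symm x} := isOpen_analyticAt ℂ e.symm
  refine ⟨e.symm, (e.source ∩ e ⁻¹' {x | AnalyticAt ℂ e.symm x}) ∩ {x | AnalyticAt ℂ F x},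
    (e.target ∩ e.symm ⁻¹' {x | AnalyticAt ℂ F x}) ∩ {x | AnalyticAt ℂ e.symm x},
    ⟨(e.isOpen_inter_preimage o2).inter o1, (e.symm.isOpen_inter_preimage o1).inter o2,
      ?_, ?_, fun x hx => e.left_inv hx.1.1, fun x hx => e.right_inv hx.1.1, ?_, ?_⟩,
    ⟨⟨he0, ?_⟩, hF⟩, fun v => ?_⟩
  · intro x hx
    refine ⟨⟨e.map_source hx.1.1, ?_⟩, hx.1.2⟩
    change AnalyticAt ℂ F (e.symm (e x))
    rw [e.left_inv hx.1.1]; exact hx.2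
  · intro x hx
    refine ⟨⟨e.map_target hx.1.1, ?_⟩, hx.1.2⟩
    change AnalyticAt ℂ e.symm (e (e.symm x))
    rw [e.right_inv hx.1.1]; exact hx.2
  · intro x hx
    have h2 : AnalyticAt ℂ F x := hx.2
    exact (h2.contDiffAt (n := ω)).contMDiffAt.contMDiffWithinAt
  · intro x hx
    have h2 : AnalyticAt ℂ e.symm x := hx.2
    exact (h2.contDiffAt (n := ω)).contMDiffAt.contMDiffWithinAt
  · change AnalyticAt ℂ e.symm (e 0)
    rw [heF, hF0]; exact hsc
  · rw [hsd.fderiv, ← hL]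
    exact L.apply_symm_apply v

/-! ### Linear algebra of the Jordan form. -/

namespace RhoPartition

variable {ρ : ℕ} [NeZero ρ] {P : RhoPartition ρ}

section Jordan

variable {lam : Fin ρ → ℂ}

/-- `idx` counts positions from 1 while `x.2` counts from 0, so `P.idx x.1 (x.2 + 2)` is the
successor of `x` in its block. -/
theorem jordan_mulVec (v : P.Idx → ℂ) (x : P.Idx) : (P.jordan lam).mulVec v x =
    lam x.1 * v x + if (x.2 : ℕ) + 1 < P.μ x.1 then v (P.idx x.1 (x.2 + 2)) else 0 := by
  classical
  have h1 : ∀ y, P.jordan lam x y * v y = (if y = x then lam x.1 * v x else 0) +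
      if y = P.idx x.1 (x.2 + 2) ∧ (x.2 : ℕ) + 1 < P.μ x.1 then v (P.idx x.1 (x.2 + 2)) else 0 := by
    intro y
    have hiff : (x.1 = y.1 ∧ (y.2 : ℕ) = x.2 + 1) ↔
        (y = P.idx x.1 (x.2 + 2) ∧ (x.2 : ℕ) + 1 < P.μ x.1) := by
      obtain ⟨l, i⟩ := x
      obtain ⟨m, j⟩ := y
      constructor
      · rintro ⟨h, hj⟩
        dsimp only at h hj
        subst h
        have := j.2
        refine ⟨Sigma.ext rfl (heq_of_eq (Fin.ext ?_)), by dsimp only; omega⟩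
        rw [idx_snd]
        dsimp only
        omega
      · rintro ⟨h, hi⟩
        rw [h]
        refine ⟨rfl, ?_⟩
        rw [idx_snd]
        dsimp only at hi ⊢
        omega
    simp only [jordan, Matrix.of_apply]
    by_cases hxy : x = y
    · subst hxy
      have : ¬ (x = P.idx x.1 (x.2 + 2) ∧ (x.2 : ℕ) + 1 < P.μ x.1) := by
        rw [← hiff]; omega
      simp [this]
    · rw [if_neg hxy, if_neg (Ne.symm hxy)]
      by_cases h : y = P.idx x.1 (x.2 + 2) ∧ (x.2 : ℕ) + 1 < P.μ x.1
      · rw [if_pos (hiff.2 h), if_pos h, h.1]; ring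
      · rw [if_neg (mt hiff.1 h), if_neg h]; ring
  rw [Matrix.mulVec, dotProduct, Finset.sum_congr rfl fun y _ => h1 y, Finset.sum_add_distrib]
  congr 1
  · simp
  · split_ifs with h <;> simp [h]

/-- The component at `x` involves only `x` and its successor, and the complement of `P'_k` is closed
under successors. When it is a single index, that index ends its block. -/
theorem jordan_mulVec_split {k : ℕ} {v : P.Idx → ℂ}
    (hv : ∀ i, i ∉ P.split k → v i = 0) {x : P.Idx} (hx : x ∉ P.split k) :
    (P.jordan lam).mulVec v x = 0 := by
  rw [jordan_mulVec, hv x hx, mul_zero, zero_add]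
  split_ifs with h
  · refine hv _ fun hc => ?_
    by_cases hk : k < P.μ 0
    · rw [P.mem_split_of_lt hk] at hx hc
      rw [idx_snd] at hc
      omega
    · rw [P.mem_split_of_le (by omega), not_not] at hx
      subst hx
      rw [idx_snd, idx_fst] at h
      have := P.pos 1
      omega
  · rfl

theorem fderiv_split {F : (P.Idx → ℂ) → P.Idx → ℂ}
    (hJordan : (fderiv ℂ F 0).toLinearMap = Matrix.toLin' (P.jordan lam)) (k : ℕ) (v : P.Idx → ℂ)
    (hv : ∀ i, i ∉ P.split k → v i = 0) (i : P.Idx) (hi : i ∉ P.split k) :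
    fderiv ℂ F 0 v i = 0 := by
  have : fderiv ℂ F 0 v = (P.jordan lam).mulVec v := by
    have := congrArg (fun T => T v) hJordan
    simpa using this
  rw [this]
  exact jordan_mulVec_split hv hi

/-- An injective endomorphism mapping a finite-dimensional subspace into itself maps it onto itself.
-/
theorem fderiv_inv_split {F : (P.Idx → ℂ) → P.Idx → ℂ}
    (hJordan : (fderiv ℂ F 0).toLinearMap = Matrix.toLin' (P.jordan lam))
    {K : (P.Idx → ℂ) →L[ℂ] (P.Idx → ℂ)} (hK : ∀ v, fderiv ℂ F 0 (K v) = v) (k : ℕ)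
    (v : P.Idx → ℂ) (hv : ∀ i, i ∉ P.split k → v i = 0) (i : P.Idx) (hi : i ∉ P.split k) :
    K v i = 0 := by
  let T := (fderiv ℂ F 0).toLinearMap
  have hsurj : Function.Surjective T := fun v => ⟨K v, hK v⟩
  have hinj : Function.Injective T := LinearMap.injective_iff_surjective.2 hsurj
  let W : Submodule ℂ (P.Idx → ℂ) :=
    { carrier := {v | ∀ i, i ∉ P.split k → v i = 0}
      add_mem' := fun ha hb i hi => by rw [Pi.add_apply, ha i hi, hb i hi, add_zero]
      zero_mem' := fun i _ => rfl
      smul_mem' := fun c v hv i hi => by rw [Pi.smul_apply, hv i hi, smul_zero] }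
  have hW : ∀ v ∈ W, T v ∈ W := fun v hv => fderiv_split hJordan k v hv
  have h1 : Function.Injective (T.restrict hW) := fun a b hab =>
    Subtype.ext (hinj (congrArg Subtype.val hab))
  obtain ⟨w, hw⟩ := LinearMap.injective_iff_surjective.1 h1 ⟨v, hv⟩
  have hw' : T w = v := congrArg Subtype.val hw
  have : K v = w := hinj ((hK v).trans hw'.symm)
  rw [this]
  exact w.2 i hi

/-- If the longest block had length one, the matrix would be diagonal. -/
theorem two_le_of_not_isDiagonalizable {T : Module.End ℂ (P.Idx → ℂ)}
    (hJordan : T = Matrix.toLin' (P.jordan lam)) (hnd : ¬ IsDiagonalizable T) : 2 ≤ P.μ 0 := by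
  by_contra hμ
  refine hnd ⟨Pi.basisFun ℂ P.Idx, fun x => lam x.1, fun x => ?_⟩
  rw [hJordan, Matrix.toLin'_apply]
  funext y
  rw [jordan_mulVec]
  have h1 := P.antitone (Fin.zero_le y.1)
  rw [if_neg (by omega), add_zero, Pi.basisFun_apply, Pi.smul_apply, smul_eq_mul]
  by_cases hxy : y = x
  · rw [hxy]
  · simp [hxy]

/-- The first basis vector of a block is an eigenvector with eigenvalue `lam l`. -/
theorem lam_ne_zero {T : Module.End ℂ (P.Idx → ℂ)}
    (hJordan : T = Matrix.toLin' (P.jordan lam)) (hinv : IsUnit T) (l : Fin ρ) : lam l ≠ 0 := by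
  classical
  intro h0
  have hbij : Function.Bijective T := (Module.End.isUnit_iff _).1 hinv
  have : T (Pi.single (P.idx l 1) 1) = 0 := by
    rw [hJordan, Matrix.toLin'_apply]
    funext y
    rw [jordan_mulVec, Pi.zero_apply]
    have h1 : lam y.1 * (Pi.single (P.idx l 1) (1 : ℂ) : P.Idx → ℂ) y = 0 := by
      by_cases hy : y = P.idx l 1
      · rw [hy, idx_fst, h0, zero_mul]
      · simp [hy]
    rw [h1, zero_add]
    split_ifs with h
    · have hne : P.idx y.1 (y.2 + 2) ≠ P.idx l 1 := by
        intro he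
        have h2 : ((P.idx y.1 (y.2 + 2)).2 : ℕ) = ((P.idx l 1).2 : ℕ) := by rw [he]
        rw [idx_snd, idx_snd] at h2
        omega
      simp [hne]
    · rfl
  have h2 := hbij.1 (this.trans (map_zero T).symm)
  have h3 := congrFun h2 (P.idx l 1)
  simp at h3

end Jordan

/-! ### The whole tower, uniqueness of lifts, distinguished points. -/

variable {F H : (P.Idx → ℂ) → P.Idx → ℂ} {U U' : Set (P.Idx → ℂ)}

theorem StageFlag.symm {k : ℕ} (h : P.StageFlag F H U U' k) : P.StageFlag H F U' U k :=
  ⟨h.flags, h.chart_flag, h.proj_eq_zero, h.lift_inv_mem, h.lift_mem⟩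

theorem stage_all (hμ : 2 ≤ P.μ 0) (h : IsBihol P.Idx F H U U') (h0 : 0 ∈ U) (hF0 : F 0 = 0)
    (hW : ∀ k, 1 ≤ k → k < P.length → ∀ v : P.Idx → ℂ, (∀ i, i ∉ P.split k → v i = 0) →
      ∀ i, i ∉ P.split k → fderiv ℂ F 0 v i = 0)
    (hW' : ∀ k, 1 ≤ k → k < P.length → ∀ v : P.Idx → ℂ, (∀ i, i ∉ P.split k → v i = 0) →
      ∀ i, i ∉ P.split k → fderiv ℂ H 0 v i = 0) (k : ℕ) (hk : k ≤ P.length) :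
    P.StageManifold F H U U' k ∧ (k < P.length → P.StageCenter F U k) := by
  have hH0 : H 0 = 0 := by
    have := h.left_inv 0 h0
    rwa [hF0] at this
  have h0' : (0 : P.Idx → ℂ) ∈ U' := by
    have := h.mapsTo h0
    rwa [hF0] at this
  -- The induction starts at stage 1, where the flag first exists. The manifold data are carried for
  -- `H` too, since `StageFlag.succ` lifts both maps.
  have key : ∀ k, k + 1 ≤ P.length → P.StageManifold F H U U' (k + 1) ∧
      P.StageManifold H F U' U (k + 1) ∧ P.StageFlag F H U U' (k + 1) := by
    intro k
    induction k with
    | zero =>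
      intro _
      exact ⟨(stageManifold_zero h).succ (stageCenter_zero h h0 hF0),
        (stageManifold_zero h.symm).succ (stageCenter_zero h.symm h0' hH0),
        stageFlag_one h h0 hF0 hW hW'⟩
    | succ k ih =>
      intro hk
      obtain ⟨h1, h2, h3⟩ := ih (by omega)
      exact ⟨h1.succ (h3.stageCenter h1 (by omega)), h2.succ (h3.symm.stageCenter h2 (by omega)),
        h3.succ hμ (by omega) (by omega) h1 h2⟩
  cases k with
  | zero => exact ⟨stageManifold_zero h, fun _ => stageCenter_zero h h0 hF0⟩
  | succ k =>
    obtain ⟨h1, -, h3⟩ := key k hk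
    exact ⟨h1, fun hk' => h3.stageCenter h1 hk'⟩

theorem StageManifold.eq_of_proj_eq {k : ℕ} (hA : P.StageManifold F H U U' k) {x y : P.Mfd k}
    (h : P.proj k x = P.proj k y) (hx : P.proj k x ≠ 0) : x = y := by
  obtain ⟨g, -, -, hg⟩ := hA.exists_inv
  rw [← hg x hx, ← hg y (h ▸ hx), h]

theorem StageManifold.isOpen_preimage {k : ℕ} (hA : P.StageManifold F H U U' k)
    (h : IsBihol P.Idx F H U U') : IsOpen (P.proj k ⁻¹' U) :=
  h.isOpen_source.preimage hA.contMDiff_proj.continuous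

theorem StageManifold.isLift {k : ℕ} (hA : P.StageManifold F H U U' k)
    (h : IsBihol P.Idx F H U U') {E : Set (P.Mfd k)} (hE : ∀ x ∈ E, P.proj k x ∈ U)
    (hG : MapsTo (P.liftTower F k) E E) : P.IsLift k F E (P.liftTower F k) := by
  have hU : P.proj k ⁻¹' U ∈ 𝓝ˢ E := (hA.isOpen_preimage h).mem_nhdsSet.2 hE
  refine ⟨hG, ?_, ?_⟩
  · filter_upwards [hU] with x hx
    exact (hA.isBihol.contMDiffOn.contMDiffAt
      ((hA.isOpen_preimage h).mem_nhds hx)).mdifferentiableAt (by simp)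
  · filter_upwards [hU] with x hx
    exact (hA.semiconj x hx).symm

/-- Off the singular divisor the projection is injective, so the semiconjugacy determines a lift.
This part is dense and the manifold is Hausdorff. -/
theorem StageManifold.isLift_unique {k : ℕ} (hA : P.StageManifold F H U U' k)
    (h : IsBihol P.Idx F H U U') (h0 : 0 ∈ U) (hF0 : F 0 = 0) {E : Set (P.Mfd k)}
    (hE : ∀ x ∈ E, P.proj k x ∈ U) {G' : P.Mfd k → P.Mfd k} (hG' : P.IsLift k F E G') :
    G' =ᶠ[𝓝ˢ E] P.liftTower F k := by
  have := hA.t2Space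
  have hU : P.proj k ⁻¹' U ∈ 𝓝ˢ E := (hA.isOpen_preimage h).mem_nhdsSet.2 hE
  have hW := (hG'.holomorphic.and hG'.semiconj).and hU
  obtain ⟨W, hWo, hEW, hW⟩ := mem_nhdsSet_iff_exists.1 hW
  refine mem_nhdsSet_iff_exists.2 ⟨W, hWo, hEW, fun x hx => ?_⟩
  have key : ∀ y ∈ W, P.proj k y ≠ 0 → G' y = P.liftTower F k y := by
    intro y hy hy0
    obtain ⟨⟨-, h2⟩, h3⟩ := hW hy
    -- `F` is injective on `U`, so images of points off the singular divisor remain off it.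
    have h4 : F (P.proj k y) ≠ 0 := by
      intro hc
      refine hy0 ?_
      rw [← h.left_inv _ h3, hc, ← hF0, h.left_inv 0 h0, hF0]
    refine hA.eq_of_proj_eq ?_ ?_
    · rw [← h2, hA.semiconj y h3]
    · rw [← h2]; exact h4
  have c1 : ContinuousAt G' x := (hW hx).1.1.continuousAt
  have c2 : ContinuousAt (P.liftTower F k) x := (hA.isBihol.contMDiffOn.contMDiffAt
    ((hA.isOpen_preimage h).mem_nhds (hW hx).2)).continuousAt
  change G' x = P.liftTower F k x
  by_contra hne
  have h5 := (c1.prodMk c2).eventually ((isOpen_ne_fun continuous_fst continuous_snd).mem_nhds hne)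
  obtain ⟨y, ⟨hy1, hy2⟩, hy3⟩ := mem_closure_iff_nhds.1 (hA.dense x) _
    (inter_mem h5 (hWo.mem_nhds hx))
  exact hy1 (key y hy2 hy3)

theorem exists_base_all {n : ℕ} (hn : ∀ k ≤ n, P.StageManifold F H U U' k)
    (hc : ∀ k < n, P.StageCenter F U k) : ∀ k ≤ n, ∃ e, (P.tower k).isBase e := by
  intro k
  induction k with
  | zero => exact fun _ => ⟨(0 : P.Idx → ℂ), rfl⟩
  | succ k ih =>
    intro hk
    obtain ⟨e, he⟩ := ih (by omega)
    obtain ⟨e', he', -⟩ := (hn k (by omega)).exists_base_succ (hc k (by omega)) he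
    exact ⟨e', he'⟩

/-- Distinguished points project to distinguished points and the lifts commute with the projections,
so being fixed descends from the last stage. -/
theorem lift_base_all {n : ℕ} (hn : ∀ k ≤ n, P.StageManifold F H U U' k)
    (hc : ∀ k < n, P.StageCenter F U k) (h0 : 0 ∈ U)
    (hfix : ∀ e, (P.tower n).isBase e → P.liftTower F n e = e) :
    ∀ k ≤ n, ∀ e, (P.tower k).isBase e → P.liftTower F k e = e := by
  intro k hk
  induction hk using Nat.decreasingInduction with
  | self => exact hfix
  | of_succ k hk ih =>
    intro e he
    have hA := hn k (by omega)
    have := hA.isManifold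
    have hB := hc k (by omega)
    obtain ⟨e', he', hee⟩ := hA.exists_base_succ hB he
    have h1 := ih e' he'
    have heX : P.proj k e = 0 := by
      obtain ⟨h2, h3⟩ := hA.base_spec e he
      refine hB.proj_eq_zero _ ((hB.chart_adapted e h2).2 fun i _ => ?_)
      rw [h3]; rfl
    have h4 := BlowUp.proj_liftMap (X := (P.tower k).sub k) hA.isBihol hB.lift_mem_iff (x := e')
      (by
        change P.proj k (BlowUp.proj (X := (P.tower k).sub k) e') ∈ U
        rw [hee, heX]; exact h0)
    have h5 : BlowUp.liftMap (X := (P.tower k).sub k) (P.liftTower F k) e' = e' := h1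
    rw [h5, hee] at h4
    exact h4.symm

end RhoPartition

/-! ### Taylor estimates near a coordinate axis. -/

/-- The second order Taylor expansion of an analytic function of one variable. -/
theorem AnalyticAt.exists_norm_taylor_two_le {g : ℂ → ℂ} (hg : AnalyticAt ℂ g 0) (h0 : g 0 = 0) :
    ∃ C, 0 ≤ C ∧ ∃ δ > 0, ∀ t : ℂ, ‖t‖ < δ →
      ‖g t - deriv g 0 * t - iteratedDeriv 2 g 0 / 2 * t ^ 2‖ ≤ C * ‖t‖ ^ 3 := by
  have h3 := hg.hasFPowerSeriesAt.isBigO_sub_partialSum_pow 3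
  obtain ⟨C1, hC1p, hC1⟩ := h3.exists_pos
  obtain ⟨δ, hδ, h4⟩ := Metric.eventually_nhds_iff.1 hC1.bound
  refine ⟨C1, hC1p.le, δ, hδ, fun t ht => ?_⟩
  have h5 := h4 (y := t) (by simpa using ht)
  have e : (FormalMultilinearSeries.ofScalars ℂ fun n => iteratedDeriv n g 0 / (n.factorial : ℂ)
      : FormalMultilinearSeries ℂ ℂ ℂ).partialSum 3 t =
        deriv g 0 * t + iteratedDeriv 2 g 0 / 2 * t ^ 2 := by
    simp [FormalMultilinearSeries.partialSum, Finset.sum_range_succ,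
      FormalMultilinearSeries.ofScalars, h0, mul_comm]
  rw [zero_add, e, norm_pow, norm_norm] at h5
  rwa [sub_sub]

/-- The mean value estimate for an analytic map near the origin. -/
theorem AnalyticAt.exists_norm_sub_fderiv_le {ι : Type} [Fintype ι]
    {F : (ι → ℂ) → ι → ℂ} (hF : AnalyticAt ℂ F 0) :
    ∃ C, 0 ≤ C ∧ ∃ δ > 0, ∀ z y : ι → ℂ, ‖z‖ < δ → ‖y‖ ≤ ‖z‖ →
      ‖F z - F y - fderiv ℂ F 0 (z - y)‖ ≤ C * ‖z‖ * ‖z - y‖ := by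
  obtain ⟨C2, hC2p, hC2⟩ := (hF.fderiv.differentiableAt.isBigO_sub).exists_pos
  obtain ⟨δ2, hδ2, h5⟩ := Metric.eventually_nhds_iff.1 (hC2.bound.and hF.eventually_analyticAt)
  refine ⟨C2, hC2p.le, δ2, hδ2, fun z y hz hyz => ?_⟩
  have hball : ∀ u ∈ Metric.closedBall (0 : ι → ℂ) ‖z‖, dist u 0 < δ2 := fun u hu =>
    lt_of_le_of_lt hu hz
  refine (convex_closedBall (0 : ι → ℂ) ‖z‖).norm_image_sub_le_of_norm_hasFDerivWithin_le'
      (f' := fderiv ℂ F) (fun u hu => ?_) (fun u hu => ?_) (by simpa using hyz) (by simp)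
  · exact (h5 (hball u hu)).2.differentiableAt.hasFDerivAt.hasFDerivWithinAt
  · refine (h5 (hball u hu)).1.trans ?_
    rw [sub_zero]
    exact mul_le_mul_of_nonneg_left (by simpa using hu) hC2p.le

/-- Second order expansion of an analytic map near a coordinate axis. -/
theorem AnalyticAt.exists_norm_sub_le {ι : Type} [Fintype ι] [DecidableEq ι]
    {F : (ι → ℂ) → ι → ℂ} (hF : AnalyticAt ℂ F 0) (hF0 : F 0 = 0) (j x : ι) :
    ∃ C, 0 ≤ C ∧ ∃ δ > 0, ∀ z : ι → ℂ, ‖z‖ < δ → ∀ ε, 0 ≤ ε →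
      (∀ i, i ≠ j → ‖z i‖ ≤ ε * ‖z j‖) → ‖z‖ ≤ ‖z j‖ →
      ‖F z x - fderiv ℂ F 0 z x -
        iteratedDeriv 2 (fun t : ℂ => F (Pi.single j t) x) 0 / 2 * z j ^ 2‖ ≤
        C * (ε + ‖z j‖) * ‖z j‖ ^ 2 := by
  have hs : HasDerivAt (fun t : ℂ => (Pi.single j t : ι → ℂ)) (Pi.single j 1) 0 :=
    (ContinuousLinearMap.single ℂ (fun _ : ι => ℂ) j).hasDerivAt
  have hga : AnalyticAt ℂ (fun t : ℂ => F (Pi.single j t) x) 0 := by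
    have h1 : AnalyticAt ℂ (fun t : ℂ => (Pi.single j t : ι → ℂ)) 0 :=
      (ContinuousLinearMap.single ℂ (fun _ : ι => ℂ) j).analyticAt 0
    have h2 : AnalyticAt ℂ F ((fun t : ℂ => (Pi.single j t : ι → ℂ)) 0) := by simpa using hF
    exact (analyticAt_pi_iff.1 (h2.comp h1)) x
  have hgd : deriv (fun t : ℂ => F (Pi.single j t) x) 0 = fderiv ℂ F 0 (Pi.single j 1) x := by
    have h2 : HasFDerivAt F (fderiv ℂ F 0) ((fun t : ℂ => (Pi.single j t : ι → ℂ)) 0) := by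
      simpa using hF.differentiableAt.hasFDerivAt
    exact (hasDerivAt_pi.1 (h2.comp_hasDerivAt (0 : ℂ) hs) x).deriv
  obtain ⟨C1, hC1, δ1, hδ1, h4⟩ := AnalyticAt.exists_norm_taylor_two_le hga (by simp [hF0])
  obtain ⟨C2, hC2, δ2, hδ2, h5⟩ := AnalyticAt.exists_norm_sub_fderiv_le hF
  refine ⟨C1 + C2, by positivity, min δ1 δ2, lt_min hδ1 hδ2, fun z hz ε hε hzε hzj => ?_⟩
  generalize iteratedDeriv 2 (fun t : ℂ => F (Pi.single j t) x) 0 / 2 = a at h4 ⊢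
  rw [hgd] at h4
  generalize hL : fderiv ℂ F 0 = L at h4 h5 ⊢
  have htz : ‖z j‖ ≤ ‖z‖ := norm_le_pi_norm z j
  -- Compare `z` with its projection to the axis, which is close to it because `z` lies in a thin
  -- cone.
  have hr : ‖z - Pi.single j (z j)‖ ≤ ε * ‖z j‖ := by
    refine (pi_norm_le_iff_of_nonneg (by positivity)).2 fun i => ?_
    by_cases hi : i = j
    · subst hi
      rw [Pi.sub_apply, Pi.single_eq_same, sub_self, norm_zero]
      positivity
    · rw [Pi.sub_apply, Pi.single_eq_of_ne hi, sub_zero]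
      exact hzε i hi
  have h6 := h5 z (Pi.single j (z j)) (lt_of_lt_of_le hz (min_le_right _ _))
    (by rw [Pi.norm_single]; exact htz)
  have h7 := h4 (z j) (lt_of_le_of_lt htz (lt_of_lt_of_le hz (min_le_left _ _)))
  have h8 : L (Pi.single j (z j)) x = L (Pi.single j 1) x * z j := by
    have : (Pi.single j (z j) : ι → ℂ) = z j • (Pi.single j 1 : ι → ℂ) := by
      funext i
      by_cases hi : i = j
      · subst hi; simp
      · simp [hi]
    rw [this, L.map_smul, Pi.smul_apply, smul_eq_mul, mul_comm]
  have h9 : ‖F z x - F (Pi.single j (z j)) x - (L z x - L (Pi.single j 1) x * z j)‖ ≤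
      C2 * ‖z‖ * ‖z - Pi.single j (z j)‖ := by
    refine le_trans (le_of_eq ?_) ((norm_le_pi_norm _ x).trans h6)
    rw [← h8, L.map_sub]
    rfl
  -- The first term is the nonlinear variation between `z` and the axis, controlled by the mean
  -- value estimate; the second is the one-variable Taylor remainder on the axis.
  have h10 : F z x - L z x - a * z j ^ 2 =
      (F z x - F (Pi.single j (z j)) x - (L z x - L (Pi.single j 1) x * z j)) +
        (F (Pi.single j (z j)) x - L (Pi.single j 1) x * z j - a * z j ^ 2) := by
    ring
  rw [h10]
  refine (norm_add_le _ _).trans ((add_le_add h9 h7).trans ?_)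
  have h11 : C2 * ‖z‖ * ‖z - Pi.single j (z j)‖ ≤ C2 * ‖z j‖ * (ε * ‖z j‖) := by gcongr
  have h12 : 0 ≤ C1 * ε * ‖z j‖ ^ 2 := by positivity
  have h13 : 0 ≤ C2 * ‖z j‖ * ‖z j‖ ^ 2 := by positivity
  refine (add_le_add_left h11 _).trans ?_
  have : (C1 + C2) * (ε + ‖z j‖) * ‖z j‖ ^ 2 = C2 * ‖z j‖ * (ε * ‖z j‖) + C1 * ‖z j‖ ^ 3 +
    (C1 * ε * ‖z j‖ ^ 2 + C2 * ‖z j‖ * ‖z j‖ ^ 2) := by ring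
  rw [this]
  exact le_add_of_nonneg_right (by positivity)

theorem BlowUp.chartFun_off {ι : Type} [Fintype ι] [DecidableEq ι] {M : Type} [TopologicalSpace M]
    [ChartedSpace (ι → ℂ) M] {X : TopologicalSpace.Closeds M} (φ : M → ι → ℂ) (S : Finset ι) (j : ι)
    (q : M) (hq : q ∉ X) (h : ι) :
    BlowUp.chartFun φ S j (BlowUp.off q hq : BlowUp ι X) h =
      if h ∈ S ∧ h ≠ j then φ q h / φ q j else φ q h := by
  simp only [BlowUp.chartFun]
  congr

/-! ### The canonical coordinates as quotients of monomials. -/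

namespace RhoPartition

variable {ρ : ℕ} [NeZero ρ] (P : RhoPartition ρ)

/-- The points at which the coordinates of the canonical charts are quotients of those of `ℂⁿ`. -/
def IsRegular (z : P.Idx → ℂ) : Prop :=
  (∀ i, z (P.idx 0 i) ≠ 0) ∧ (P.EqualTop → z (P.idx 1 (P.μ 1)) ≠ 0)

/-- The `k`-th canonical coordinates, `1 ≤ k`, in terms of the coordinates of `ℂⁿ`. -/
noncomputable def theta (k : ℕ) (z : P.Idx → ℂ) : P.Idx → ℂ := fun x =>
  if x = P.idx 0 1 then z (P.idx 0 1) ^ 2 / z (P.pivot k)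
  else if x.1 = 0 ∧ (x.2 : ℕ) + 1 ≤ k then z x / z (P.idx 0 x.2)
  else z x / z (P.idx 0 (min (x.2 + 1) k))

theorem theta_apply (k : ℕ) (z : P.Idx → ℂ) (x : P.Idx) : P.theta k z x =
    if x = P.idx 0 1 then z (P.idx 0 1) ^ 2 / z (P.pivot k)
    else if x.1 = 0 ∧ (x.2 : ℕ) + 1 ≤ k then z x / z (P.idx 0 x.2)
    else z x / z (P.idx 0 (min (x.2 + 1) k)) := rfl

variable {P}

theorem snd_lt (x : P.Idx) : (x.2 : ℕ) < P.μ 0 :=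
  lt_of_lt_of_le x.2.2 (P.antitone (Fin.zero_le x.1))

theorem eq_idx_zero_iff {x : P.Idx} {i : ℕ} (h1 : 1 ≤ i) (hi : i ≤ P.μ 0) :
    x = P.idx 0 i ↔ x.1 = 0 ∧ (x.2 : ℕ) + 1 = i := by
  constructor
  · rintro rfl
    refine ⟨rfl, ?_⟩
    rw [idx_snd]; omega
  · rintro ⟨h2, h3⟩
    obtain ⟨l, i'⟩ := x
    dsimp only at h2 h3
    subst h2 h3
    exact (P.idx_eta _).symm

/-- Each blow-up divides the normal coordinates by the pivot coordinate, which is the quotient of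
the new pivot variable by the old one. The division therefore replaces the old pivot variable by the
new one in the denominators concerned. -/
theorem chart_eq_theta {F : (P.Idx → ℂ) → P.Idx → ℂ} {U : Set (P.Idx → ℂ)} {n : ℕ}
    (hn : n ≤ P.length) (hc : ∀ k < n, P.StageCenter F U k) :
    ∀ k, k + 1 ≤ n → ∀ x : P.Mfd (k + 1), P.IsRegular (P.proj (k + 1) x) →
      x ∈ (P.tower (k + 1)).dom ∧ (P.tower (k + 1)).chart x = P.theta (k + 1) (P.proj (k + 1) x) := by
  intro k
  induction k with
  | zero =>
    intro _ x hx
    cases x with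
    | exc p hp hs v =>
      have : (show P.Idx → ℂ from p) = 0 := hp
      exact absurd (congrFun this (P.idx 0 1)) (hx.1 1)
    | off q hq =>
      have hq1 : (q : P.Idx → ℂ) (P.idx 0 1) ≠ 0 := hx.1 1
      have hp1 : P.pivot (0 + 1) = P.idx 0 1 := P.pivot_one
      refine ⟨⟨mem_univ _, ?_⟩, ?_⟩
      · rw [hp1]; exact hq1
      · funext h
        refine (BlowUp.chartFun_off _ _ _ q hq h).trans ?_
        have key : ∀ z : P.Idx → ℂ, z (P.idx 0 1) ≠ 0 →
            (if h ∈ P.normalIdx 0 ∧ h ≠ P.pivot (0 + 1) then z h / z (P.pivot (0 + 1)) else z h) =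
              P.theta (0 + 1) z h := by
          intro z hz
          rw [theta_apply, hp1, normalIdx_zero]
          by_cases hh : h = P.idx 0 1
          · rw [if_neg (by simp [hh]), if_pos hh, hh]
            field_simp
          · have h2 : ¬ (h.1 = 0 ∧ (h.2 : ℕ) + 1 ≤ 0 + 1) := by
              rintro ⟨h3, h4⟩
              exact hh ((eq_idx_zero_iff le_rfl (P.pos 0)).2 ⟨h3, by omega⟩)
            have h3 : min ((h.2 : ℕ) + 1) (0 + 1) = 1 := by omega
            rw [if_pos ⟨Finset.mem_univ _, hh⟩, if_neg hh, if_neg h2, h3]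
        exact key q hq1
  | succ k ih =>
    intro hk x hx
    cases x with
    | exc p hp hs v =>
      have h0 := (hc (k + 1) (by omega)).proj_eq_zero p hp
      exact absurd (congrFun h0 (P.idx 0 1)) (hx.1 1)
    | off q hq =>
      obtain ⟨hd, hch⟩ := ih (by omega) q hx
      set z := P.proj (k + 1) q with hz
      have hz1 := hx.1
      change ∀ i, z (P.idx 0 i) ≠ 0 at hz1
      have hlen := P.length_le
      set j := P.pivot (k + 1 + 1) with hj
      -- The coordinate to divide by is the quotient of two consecutive pivot variables, also at the
      -- last blow-up of case (E), where the new pivot is in the second block.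
      have hj1 : j ≠ P.idx 0 1 ∧ (P.tower (k + 1)).chart q j = z j / z (P.pivot (k + 1)) ∧ z j ≠ 0 := by
        rw [hch, theta]
        by_cases hkμ : k + 1 + 1 ≤ P.μ 0
        · have e1 : j = P.idx 0 (k + 1 + 1) := if_pos hkμ
          have e2 : P.pivot (k + 1) = P.idx 0 (k + 1) := if_pos (by omega)
          have e3 : j ≠ P.idx 0 1 := by
            rw [e1, Ne, P.idx_eq_idx_iff (by omega) le_rfl hkμ (P.pos 0)]; omega
          have e4 : (j.2 : ℕ) = k + 1 := by rw [e1, idx_snd]; omega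
          refine ⟨e3, ?_, by rw [e1]; exact hz1 _⟩
          rw [if_neg e3, if_neg (by rw [e4]; omega), e4, e2]
          congr 3
          omega
        · have hE := P.equalTop_of_lt (by omega)
          have e1 : j = P.idx 1 (P.μ 1) := if_neg hkμ
          have e2 : P.pivot (k + 1) = P.idx 0 (k + 1) := if_pos (by omega)
          have e5 : j.1 ≠ 0 := by
            rw [e1]; exact P.one_ne_zero_of_equalTop hE
          have e3 : j ≠ P.idx 0 1 := fun h => e5 (by rw [h]; rfl)
          have e4 : (j.2 : ℕ) = P.μ 1 - 1 := by rw [e1, idx_snd]; omega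
          have e6 := hE.2
          have e7 := P.pos 0
          refine ⟨e3, ?_, by rw [e1]; exact hx.2 hE⟩
          rw [if_neg e3, if_neg (fun h => e5 h.1), e4, e2]
          congr 3
          omega
      obtain ⟨hj1, hj2, hj3⟩ := hj1
      have hpk : P.pivot (k + 1) = P.idx 0 (k + 1) := if_pos (by omega)
      have hzp : z (P.pivot (k + 1)) ≠ 0 := by rw [hpk]; exact hz1 _
      refine ⟨⟨hd, ?_⟩, ?_⟩
      · rw [← hj, hj2]
        exact div_ne_zero hj3 hzp
      · funext h
        refine (BlowUp.chartFun_off _ _ _ q hq h).trans ?_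
        change _ = P.theta (k + 1 + 1) z h
        rw [← hj]
        rw [hj2, hch]
        simp only [theta, ← hj]
        by_cases hh : h = P.idx 0 1
        · rw [if_pos ⟨by rw [hh]; exact Finset.mem_insert_self _ _, by rw [hh]; exact hj1.symm⟩,
            if_pos hh, if_pos hh]
          field_simp
        · simp only [if_neg hh]
          have hmem : h ∈ P.normalIdx (k + 1) ↔ h ∉ P.split (k + 1) := by
            simp [normalIdx, hh]
          by_cases hkμ : k + 1 + 1 ≤ P.μ 0
          · have e1 : j = P.idx 0 (k + 1 + 1) := if_pos hkμ
            have e2 : h = j ↔ h.1 = 0 ∧ (h.2 : ℕ) + 1 = k + 1 + 1 := by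
              rw [e1, eq_idx_zero_iff (by omega) hkμ]
            have e0 : (h ∈ P.normalIdx (k + 1) ∧ h ≠ j) ↔
                ¬ (h.2 : ℕ) < k + 1 ∧ ¬ (h.1 = 0 ∧ (h.2 : ℕ) + 1 = k + 1 + 1) := by
              rw [hmem, P.mem_split_of_lt (by omega), Ne, e2]
            by_cases a1 : (h.2 : ℕ) < k + 1
            · rw [if_neg (fun hc => (e0.1 hc).1 a1)]
              have e3 : (h.1 = 0 ∧ (h.2 : ℕ) + 1 ≤ k + 1) ↔ (h.1 = 0 ∧ (h.2 : ℕ) + 1 ≤ k + 1 + 1) :=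
                ⟨fun h => ⟨h.1, by omega⟩, fun h => ⟨h.1, by omega⟩⟩
              have e4 : min ((h.2 : ℕ) + 1) (k + 1) = min ((h.2 : ℕ) + 1) (k + 1 + 1) := by omega
              simp only [e3, e4]
            -- The pivot itself is not divided: its denominator is already the preceding variable of
            -- the first block, and it passes from the third clause of `theta` to the second.
            · by_cases a2 : h.1 = 0 ∧ (h.2 : ℕ) + 1 = k + 1 + 1
              · have e4 : min ((h.2 : ℕ) + 1) (k + 1) = h.2 := by omega
                rw [if_neg (fun hc => (e0.1 hc).2 a2), if_neg (fun hc => by omega),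
                  if_pos ⟨a2.1, by omega⟩, e4]
              -- A normal coordinate other than the pivot and the first one: its denominator
              -- advances by one position in the first block.
              · have e4 : min ((h.2 : ℕ) + 1) (k + 1) = k + 1 := by omega
                have e5 : min ((h.2 : ℕ) + 1) (k + 1 + 1) = k + 1 + 1 := by omega
                rw [if_pos (e0.2 ⟨a1, a2⟩), if_neg (fun hc => by omega),
                  if_neg (fun hc => a2 ⟨hc.1, by omega⟩), e4, e5, ← e1, ← hpk]
                field_simp
          -- In the additional blow-up the only normal coordinates are the first one and the pivot,
          -- so all coordinates but the first are unchanged.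
          · have hE := P.equalTop_of_lt (by omega)
            have hlt := snd_lt h
            have e1 : j = P.idx 1 (P.μ 1) := if_neg hkμ
            have e0 : ¬ (h ∈ P.normalIdx (k + 1) ∧ h ≠ j) := by
              rw [hmem, P.mem_split_of_le (by omega), not_not, e1]
              exact fun hc => hc.2 hc.1
            rw [if_neg e0]
            have e3 : (h.1 = 0 ∧ (h.2 : ℕ) + 1 ≤ k + 1) ↔ (h.1 = 0 ∧ (h.2 : ℕ) + 1 ≤ k + 1 + 1) :=
              ⟨fun h => ⟨h.1, by omega⟩, fun h => ⟨h.1, by omega⟩⟩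
            have e4 : min ((h.2 : ℕ) + 1) (k + 1) = min ((h.2 : ℕ) + 1) (k + 1 + 1) := by omega
            simp only [e3, e4]

end RhoPartition

/-! ### Asymptotic expansions of quotients. -/

open Asymptotics

/-- Expansion of a quotient. -/
theorem isBigO_div_sub {α : Type} {L : Filter α} {N : α → ℝ} (hN : Tendsto N L (𝓝 0)) {m : ℕ}
    {A a₁ a₂ B b : α → ℂ} {β : ℂ} (hβ : β ≠ 0)
    (hA : (fun w => A w - (a₁ w + a₂ w)) =O[L] fun w => N w ^ (m + 2))
    (h₁ : a₁ =O[L] fun w => N w ^ m) (h₂ : a₂ =O[L] fun w => N w ^ (m + 1))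
    (hB : (fun w => B w - (β + b w)) =O[L] fun w => N w ^ 2) (hb : b =O[L] N) :
    (fun w => A w / B w - (a₁ w / β + a₂ w / β - a₁ w * b w / β ^ 2)) =O[L]
      fun w => N w ^ (m + 2) := by
  have hNO : N =O[L] fun _ => (1 : ℝ) := hN.isBigO_one ℝ
  have hb0 : Tendsto b L (𝓝 0) := hb.trans_tendsto hN
  have hB0 : Tendsto B L (𝓝 β) := by
    have h1 : Tendsto (fun w => B w - (β + b w)) L (𝓝 0) :=
      hB.trans_tendsto (by simpa using hN.pow 2)
    have h2 := h1.add (tendsto_const_nhds (x := β) |>.add hb0)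
    simpa using h2
  have hBne : ∀ᶠ w in L, B w ≠ 0 := hB0.eventually_ne hβ
  have hBinv : (fun w => (B w)⁻¹) =O[L] fun _ => (1 : ℝ) := (hB0.inv₀ hβ).isBigO_one ℝ
  have e1 : (fun w => a₂ w * b w) =O[L] fun w => N w ^ (m + 2) := by
    refine (h₂.mul hb).congr_right fun w => by ring
  have e2 : (fun w => a₁ w * b w) =O[L] fun w => N w ^ (m + 1) := by
    refine (h₁.mul hb).congr_right fun w => by ring
  have e3 : (fun w => a₁ w * b w * b w) =O[L] fun w => N w ^ (m + 2) := by
    refine (e2.mul hb).congr_right fun w => by ring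
  have e4 : (fun w => N w ^ (m + 1)) =O[L] fun w => N w ^ m := by
    simpa [pow_succ] using (isBigO_refl (fun w => N w ^ m) L).mul hNO
  have hP : (fun w => a₁ w / β + a₂ w / β - a₁ w * b w / β ^ 2) =O[L] fun w => N w ^ m := by
    simp only [div_eq_mul_inv]
    refine IsBigO.sub (IsBigO.add ?_ ?_) ?_
    · exact (h₁.const_mul_left β⁻¹).congr_left fun w => mul_comm _ _
    · exact ((h₂.trans e4).const_mul_left β⁻¹).congr_left fun w => mul_comm _ _
    · exact ((e2.trans e4).const_mul_left (β ^ 2)⁻¹).congr_left fun w => mul_comm _ _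
  have e5 : (fun w => (a₁ w / β + a₂ w / β - a₁ w * b w / β ^ 2) * (B w - (β + b w))) =O[L]
      fun w => N w ^ (m + 2) := (hP.mul hB).congr_right fun w => by ring
  -- With `P` the claimed approximation, this is `A - P B`: the error of `A`, two cross terms, and
  -- `P` times the error of `B`. Multiplying by the bounded function `B⁻¹` finishes.
  have e6 : (fun w => (A w - (a₁ w + a₂ w)) - β⁻¹ * (a₂ w * b w) +
      (β ^ 2)⁻¹ * (a₁ w * b w * b w) -
        (a₁ w / β + a₂ w / β - a₁ w * b w / β ^ 2) * (B w - (β + b w))) =O[L]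
      fun w => N w ^ (m + 2) :=
    ((hA.sub (e1.const_mul_left _)).add (e3.const_mul_left _)).sub e5
  have e7 := e6.mul hBinv
  simp only [mul_one] at e7
  refine e7.congr' ?_ EventuallyEq.rfl
  filter_upwards [hBne] with w hw
  field_simp
  ring

/-- First order expansion of a quotient. -/
theorem isBigO_div_sub_div {α : Type} {L : Filter α} {N : α → ℝ} (hN : Tendsto N L (𝓝 0)) {m : ℕ}
    {A a₁ B : α → ℂ} {β : ℂ} (hβ : β ≠ 0)
    (hA : (fun w => A w - a₁ w) =O[L] fun w => N w ^ (m + 1))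
    (h₁ : a₁ =O[L] fun w => N w ^ m) (hB : (fun w => B w - β) =O[L] N) :
    (fun w => A w / B w - a₁ w / β) =O[L] fun w => N w ^ (m + 1) := by
  have hB0 : Tendsto B L (𝓝 β) := by
    have h2 := (hB.trans_tendsto hN).add (tendsto_const_nhds (x := β))
    simpa using h2
  have hBne : ∀ᶠ w in L, B w ≠ 0 := hB0.eventually_ne hβ
  have hBinv : (fun w => (B w)⁻¹) =O[L] fun _ => (1 : ℝ) := (hB0.inv₀ hβ).isBigO_one ℝ
  have e1 : (fun w => a₁ w * (B w - β)) =O[L] fun w => N w ^ (m + 1) :=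
    (h₁.mul hB).congr_right fun w => by ring
  have e2 := (hA.sub (e1.const_mul_left β⁻¹)).mul hBinv
  simp only [mul_one] at e2
  refine e2.congr' ?_ EventuallyEq.rfl
  filter_upwards [hBne] with w hw
  field_simp
  ring

/-! ### Inverting the canonical coordinates, and `F` at regular points. -/

namespace RhoPartition

variable {ρ : ℕ} [NeZero ρ] {P : RhoPartition ρ}

theorem one_le_length : 1 ≤ P.length := by
  have := P.pos 0
  unfold length
  split_ifs <;> omega

theorem pivot_length_of_equalTop (hE : P.EqualTop) : P.pivot P.length = P.idx 1 (P.μ 1) := by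
  rw [pivot, length, if_pos hE, if_neg (by omega)]

theorem pivot_length_of_not_equalTop (hE : ¬ P.EqualTop) : P.pivot P.length = P.idx 0 (P.μ 0) := by
  rw [pivot, length, if_neg hE, if_pos le_rfl]

theorem theta_idx_one (k : ℕ) (u : P.Idx → ℂ) :
    P.theta k u (P.idx 0 1) = u (P.idx 0 1) ^ 2 / u (P.pivot k) := if_pos rfl

theorem theta_idx_succ (u : P.Idx → ℂ) {i : ℕ} (h1 : 1 ≤ i) (hi : i + 1 ≤ P.μ 0) :
    P.theta P.length u (P.idx 0 (i + 1)) = u (P.idx 0 (i + 1)) / u (P.idx 0 i) := by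
  have e1 : P.idx 0 (i + 1) ≠ P.idx 0 1 := by
    rw [Ne, P.idx_eq_idx_iff (by omega) le_rfl hi (P.pos 0)]; omega
  have e2 : ((P.idx 0 (i + 1)).2 : ℕ) = i := by rw [idx_snd]; omega
  have := P.le_length
  rw [theta_apply, if_neg e1, if_pos ⟨rfl, by omega⟩, e2]

theorem theta_idx_of_ne (u : P.Idx → ℂ) {l : Fin ρ} (hl : l ≠ 0) {i : ℕ} (h1 : 1 ≤ i)
    (hi : i ≤ P.μ l) :
    P.theta P.length u (P.idx l i) = u (P.idx l i) / u (P.idx 0 i) := by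
  have e1 : P.idx l i ≠ P.idx 0 1 := fun h => hl (congrArg Sigma.fst h)
  have e2 : ((P.idx l i).2 : ℕ) = i - 1 := by rw [idx_snd]; omega
  have := P.le_length
  have h2 : P.μ l ≤ P.μ 0 := P.antitone (Fin.zero_le l)
  have e3 : min (((P.idx l i).2 : ℕ) + 1) P.length = i := by omega
  rw [theta_apply, if_neg e1, if_neg (fun h => hl h.1), e3]

theorem forall_idx {p : P.Idx → Prop} (h : ∀ l i, 1 ≤ i → i ≤ P.μ l → p (P.idx l i)) (x : P.Idx) :
    p x := by
  rw [← P.idx_eta x]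
  exact h _ _ (by omega) x.2.2

theorem isRegular_iff {z : P.Idx → ℂ} : P.IsRegular z ↔
    (∀ i, 1 ≤ i → i ≤ P.μ 0 → z (P.idx 0 i) ≠ 0) ∧ (P.EqualTop → z (P.idx 1 (P.μ 1)) ≠ 0) := by
  refine and_congr_left fun _ => ⟨fun h i _ _ => h i, fun h i => ?_⟩
  have := P.pos 0
  have e : P.idx 0 i = P.idx 0 (min (max i 1) (P.μ 0)) := by
    refine Sigma.ext rfl (heq_of_eq (Fin.ext ?_))
    rw [idx_snd, idx_snd]
    omega
  rw [e]
  exact h _ (by omega) (by omega)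

theorem IsRegular.pivot_ne_zero {z : P.Idx → ℂ} (hz : P.IsRegular z) : z (P.pivot P.length) ≠ 0 := by
  by_cases hE : P.EqualTop
  · rw [pivot_length_of_equalTop hE]; exact hz.2 hE
  · rw [pivot_length_of_not_equalTop hE]; exact hz.1 _

section Relations

variable {z w : P.Idx → ℂ} (hz : P.IsRegular z) (hw : P.theta P.length z = w)
include hz hw

/-- This and the next two relations express `z` through `w` without fractions; they are all that is
used about `theta` in the estimates. -/
theorem eq_mul_idx_zero {i : ℕ} (h1 : 1 ≤ i) (hi : i + 1 ≤ P.μ 0) :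
    z (P.idx 0 (i + 1)) = w (P.idx 0 (i + 1)) * z (P.idx 0 i) := by
  rw [← hw, theta_idx_succ z h1 hi, div_mul_cancel₀ _ (hz.1 i)]

theorem eq_mul_idx {l : Fin ρ} (hl : l ≠ 0) {i : ℕ} (h1 : 1 ≤ i) (hi : i ≤ P.μ l) :
    z (P.idx l i) = w (P.idx l i) * z (P.idx 0 i) := by
  rw [← hw, theta_idx_of_ne z hl h1 hi, div_mul_cancel₀ _ (hz.1 i)]

theorem sq_eq_mul_pivot : z (P.idx 0 1) ^ 2 = w (P.idx 0 1) * z (P.pivot P.length) := by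
  rw [← hw, theta_idx_one, div_mul_cancel₀ _ hz.pivot_ne_zero]

theorem norm_idx_zero_le (hw1 : ‖w‖ ≤ 1) {i : ℕ} (h1 : 1 ≤ i) (hi : i ≤ P.μ 0) :
    ‖z (P.idx 0 i)‖ ≤ ‖z (P.idx 0 1)‖ := by
  induction i, h1 using Nat.le_induction with
  | base => exact le_rfl
  | succ i h1 ih =>
    rw [eq_mul_idx_zero hz hw h1 hi, norm_mul]
    calc _ ≤ 1 * ‖z (P.idx 0 i)‖ :=
          mul_le_mul_of_nonneg_right ((norm_le_pi_norm w _).trans hw1) (norm_nonneg _)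
      _ ≤ _ := by rw [one_mul]; exact ih (by omega)

/-- Every coordinate other than the first is a product containing some factor `w x` and a variable
of the first block. So for small `w` the point `z` lies in a thin cone around the first axis. -/
theorem norm_apply_le_mul (hw1 : ‖w‖ ≤ 1) (x : P.Idx) (hx : x ≠ P.idx 0 1) :
    ‖z x‖ ≤ ‖w‖ * ‖z (P.idx 0 1)‖ := by
  revert hx
  refine forall_idx (p := fun x => x ≠ P.idx 0 1 → ‖z x‖ ≤ ‖w‖ * ‖z (P.idx 0 1)‖) ?_ x
  intro l i h1 hi hx
  by_cases hl : l = 0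
  · subst hl
    obtain ⟨i, rfl⟩ : ∃ j, i = j + 1 := ⟨i - 1, by omega⟩
    have h1' : 1 ≤ i := by
      by_contra h
      exact hx (by congr 1; omega)
    rw [eq_mul_idx_zero hz hw h1' hi, norm_mul]
    exact mul_le_mul (norm_le_pi_norm w _) (norm_idx_zero_le hz hw hw1 h1' (by omega))
      (norm_nonneg _) (norm_nonneg _)
  · rw [eq_mul_idx hz hw hl h1 hi, norm_mul]
    exact mul_le_mul (norm_le_pi_norm w _)
      (norm_idx_zero_le hz hw hw1 h1 (hi.trans (P.antitone (Fin.zero_le l))))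
      (norm_nonneg _) (norm_nonneg _)

theorem norm_le_norm_idx_one (hw1 : ‖w‖ ≤ 1) : ‖z‖ ≤ ‖z (P.idx 0 1)‖ := by
  refine (pi_norm_le_iff_of_nonneg (norm_nonneg _)).2 fun x => ?_
  by_cases hx : x = P.idx 0 1
  · rw [hx]
  · refine (norm_apply_le_mul hz hw hw1 x hx).trans ?_
    exact mul_le_of_le_one_left (norm_nonneg _) hw1

/-- Divide `z_1² = w_1 z_p` by `z_1`, using that no coordinate exceeds `z_1` in modulus. -/
theorem norm_idx_one_le (hw1 : ‖w‖ ≤ 1) : ‖z (P.idx 0 1)‖ ≤ ‖w‖ := by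
  have h1 := congrArg norm (sq_eq_mul_pivot hz hw)
  rw [norm_pow, norm_mul] at h1
  have h2 : 0 < ‖z (P.idx 0 1)‖ := norm_pos_iff.2 (hz.1 1)
  have h3 : ‖z (P.idx 0 1)‖ ^ 2 ≤ ‖w‖ * ‖z (P.idx 0 1)‖ := by
    rw [h1]
    exact mul_le_mul (norm_le_pi_norm w _)
      ((norm_le_pi_norm z _).trans (norm_le_norm_idx_one hz hw hw1)) (norm_nonneg _) (norm_nonneg _)
  rw [sq] at h3
  exact le_of_mul_le_mul_right h3 h2

end Relations

/-- Near the origin, the canonical coordinates `w` determine regular points `z w` of `ℂⁿ`, at which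
`F` has the Jordan linear part given by `lam`, and quadratic part given by `a`. -/
structure RegularExpansion (P : RhoPartition ρ) (lam : Fin ρ → ℂ) (a : P.Idx → ℂ)
    (F z : (P.Idx → ℂ) → P.Idx → ℂ) (L : Filter (P.Idx → ℂ)) : Prop where
  le : L ≤ 𝓝 0
  regular : ∀ᶠ w in L, P.IsRegular (z w)
  theta_eq : ∀ᶠ w in L, P.theta P.length (z w) = w
  isBigO : ∀ l i, 1 ≤ i → i ≤ P.μ l →
    (fun w => F (z w) (P.idx l i) - (lam l * z w (P.idx l i) +
      if i < P.μ l then z w (P.idx l (i + 1)) else 0) - a (P.idx l i) * z w (P.idx 0 1) ^ 2)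
    =O[L] fun w => ‖w‖ * ‖z w (P.idx 0 1)‖ ^ 2
  two_le : 2 ≤ P.μ 0
  lam_ne_zero : ∀ l, lam l ≠ 0

/-- In the cone around the first axis, with opening `‖w‖`, every nonlinear term other than the
`z_1²` one is `O(‖w‖ |z_1|²)`. The cubic terms are included, since `|z_1| ≤ ‖w‖`. -/
theorem regularExpansion {lam : Fin ρ → ℂ} {F z : (P.Idx → ℂ) → P.Idx → ℂ}
    {L : Filter (P.Idx → ℂ)} (hF : AnalyticAt ℂ F 0) (hF0 : F 0 = 0)
    (hJordan : (fderiv ℂ F 0).toLinearMap = Matrix.toLin' (P.jordan lam))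
    (hL : L ≤ 𝓝 0) (hz : ∀ᶠ w in L, P.IsRegular (z w))
    (hw : ∀ᶠ w in L, P.theta P.length (z w) = w) (h2 : 2 ≤ P.μ 0) (hlam : ∀ l, lam l ≠ 0) :
    P.RegularExpansion lam (P.quadCoeff F) F z L := by
  refine ⟨hL, hz, hw, fun l i h1 hi => ?_, h2, hlam⟩
  obtain ⟨C, hC, δ, hδ, h⟩ := AnalyticAt.exists_norm_sub_le hF hF0 (P.idx 0 1) (P.idx l i)
  have hN : ∀ᶠ w in L, ‖w‖ < min δ 1 := by
    filter_upwards [hL (Metric.ball_mem_nhds (0 : P.Idx → ℂ) (lt_min hδ one_pos))] with w hw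
    exact mem_ball_zero_iff.1 hw
  -- The cone opening and the size of `z_1` each contribute one `‖w‖`.
  refine IsBigO.of_bound (C * 2) ?_
  filter_upwards [hz, hw, hN] with w hz hw hN
  have hw1 : ‖w‖ ≤ 1 := (lt_of_lt_of_le hN (min_le_right _ _)).le
  have e1 := norm_le_norm_idx_one hz hw hw1
  have e2 := norm_idx_one_le hz hw hw1
  have e3 := h (z w) (lt_of_le_of_lt (e1.trans e2) (lt_of_lt_of_le hN (min_le_left _ _))) ‖w‖
    (norm_nonneg _) (norm_apply_le_mul hz hw hw1) e1
  have e4 : fderiv ℂ F 0 (z w) (P.idx l i) = lam l * z w (P.idx l i) +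
      if i < P.μ l then z w (P.idx l (i + 1)) else 0 := by
    have e5 : fderiv ℂ F 0 (z w) = (P.jordan lam).mulVec (z w) := by
      rw [← Matrix.toLin'_apply, ← hJordan]; rfl
    have e6 : ((P.idx l i).2 : ℕ) = i - 1 := by rw [idx_snd]; omega
    have e7 : (P.idx l i).1 = l := rfl
    have e8 : i - 1 + 1 = i := by omega
    have e9 : i - 1 + 2 = i + 1 := by omega
    rw [e5, jordan_mulVec, e6, e7, e8, e9]
  rw [e4] at e3
  refine e3.trans ?_
  rw [norm_mul, norm_norm, norm_pow, norm_norm]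
  calc C * (‖w‖ + ‖z w (P.idx 0 1)‖) * ‖z w (P.idx 0 1)‖ ^ 2
      ≤ C * (‖w‖ + ‖w‖) * ‖z w (P.idx 0 1)‖ ^ 2 := by gcongr
    _ = _ := by ring

end RhoPartition

/-! ### Expansions of the components of `F` divided by variables of the first block. -/

open Asymptotics

namespace RhoPartition

variable {ρ : ℕ} [NeZero ρ] {P : RhoPartition ρ}

theorem lt_of_not_equalTop (hE : ¬ P.EqualTop) {l : Fin ρ} (hl : l ≠ 0) : P.μ l < P.μ 0 := by
  by_contra hc
  have h4 : l.val ≠ 0 := fun h => hl (Fin.ext h)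
  have h5 : 1 < ρ := by have := l.2; omega
  have h6 : (1 : Fin ρ) ≤ l := by
    have h7 : ((1 : Fin ρ) : ℕ) = 1 % ρ := rfl
    rw [Fin.le_def, h7, Nat.mod_eq_of_lt h5]; omega
  have h7 := P.antitone h6
  exact hE ⟨h5, le_antisymm (P.antitone (Fin.zero_le _)) (by omega)⟩

namespace RegularExpansion

variable {lam : Fin ρ → ℂ} {a : P.Idx → ℂ} {F z : (P.Idx → ℂ) → P.Idx → ℂ}
  {L : Filter (P.Idx → ℂ)} (h : P.RegularExpansion lam a F z L)
include h

theorem tendsto_norm : Tendsto (fun w : P.Idx → ℂ => ‖w‖) L (𝓝 0) := by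
  have : Tendsto (fun w : P.Idx → ℂ => ‖w‖) (𝓝 0) (𝓝 ‖(0 : P.Idx → ℂ)‖) :=
    continuous_norm.tendsto 0
  rw [norm_zero] at this
  exact this.mono_left h.le

theorem apply_isBigO (x : P.Idx) : (fun w : P.Idx → ℂ => w x) =O[L] fun w => ‖w‖ :=
  IsBigO.of_bound 1 (Eventually.of_forall fun w => by
    rw [one_mul, norm_norm]; exact norm_le_pi_norm w x)

theorem pow_succ_isBigO (m : ℕ) :
    (fun w : P.Idx → ℂ => ‖w‖ ^ (m + 1)) =O[L] fun w => ‖w‖ ^ m := by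
  have := (isBigO_refl (fun w : P.Idx → ℂ => ‖w‖ ^ m) L).mul (h.tendsto_norm.isBigO_one ℝ)
  simpa [pow_succ] using this

theorem apply_mul_isBigO (x : P.Idx) {f : (P.Idx → ℂ) → ℂ} {m : ℕ} (hf : f =O[L] fun w => ‖w‖ ^ m) :
    (fun w => w x * f w) =O[L] fun w => ‖w‖ ^ (m + 1) :=
  ((h.apply_isBigO x).mul hf).congr_right fun w => by ring

/-- The last quotient `z₁² / z_i`. -/
theorem sq_div_last (hE : ¬ P.EqualTop) :
    (fun w => z w (P.idx 0 1) ^ 2 / z w (P.idx 0 (P.μ 0))) =ᶠ[L] fun w => w (P.idx 0 1) := by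
  filter_upwards [h.regular, h.theta_eq] with w hz hw
  have := sq_eq_mul_pivot hz hw
  rw [pivot_length_of_not_equalTop hE] at this
  rw [this, mul_div_cancel_right₀ _ (hz.1 _)]

/-- The purpose of the additional blow-up: what would have been a linear contribution of the
quadratic part of `F` becomes a product of two coordinates. -/
theorem sq_div_last_of_equalTop (hE : P.EqualTop) :
    (fun w => z w (P.idx 0 1) ^ 2 / z w (P.idx 0 (P.μ 0))) =ᶠ[L]
      fun w => w (P.idx 0 1) * w (P.idx 1 (P.μ 1)) := by
  filter_upwards [h.regular, h.theta_eq] with w hz hw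
  have h1 := sq_eq_mul_pivot hz hw
  have h2 := eq_mul_idx hz hw (P.one_ne_zero_of_equalTop hE) (P.pos 1) le_rfl
  rw [pivot_length_of_equalTop hE, h2, hE.2, ← mul_assoc] at h1
  rw [h1, mul_div_cancel_right₀ _ (hz.1 _), hE.2]

theorem sq_div_succ {i : ℕ} (h1 : 1 ≤ i) (hi : i + 1 ≤ P.μ 0) :
    (fun w => z w (P.idx 0 1) ^ 2 / z w (P.idx 0 i)) =ᶠ[L]
      fun w => w (P.idx 0 (i + 1)) * (z w (P.idx 0 1) ^ 2 / z w (P.idx 0 (i + 1))) := by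
  filter_upwards [h.regular, h.theta_eq] with w hz hw
  have h2 := eq_mul_idx_zero hz hw h1 hi
  have h3 := hz.1 i
  have h4 := hz.1 (i + 1)
  rw [eq_comm, mul_div_assoc', div_eq_div_iff h4 h3, h2]
  ring

/-- Descending induction on the position in the first block: each step down contributes another
factor `w_{i+1}`. Hence the quadratic part of `F` is felt only near the ends of the long blocks, as
the refinements to orders two and three make precise. -/
theorem sq_div_isBigO {i : ℕ} (h1 : 1 ≤ i) (hi : i ≤ P.μ 0) :
    (fun w => z w (P.idx 0 1) ^ 2 / z w (P.idx 0 i)) =O[L] fun w => ‖w‖ ^ 1 := by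
  revert h1
  induction hi using Nat.decreasingInduction with
  | self =>
    intro _
    by_cases hE : P.EqualTop
    · refine (h.sq_div_last_of_equalTop hE).trans_isBigO ?_
      refine (h.apply_mul_isBigO (m := 1) _ ?_).trans (h.pow_succ_isBigO 1)
      simpa using h.apply_isBigO _
    · refine (h.sq_div_last hE).trans_isBigO ?_
      simpa using h.apply_isBigO _
  | of_succ i hi ih =>
    intro h1
    exact (h.sq_div_succ h1 hi).trans_isBigO
      ((h.apply_mul_isBigO _ (ih (by omega))).trans (h.pow_succ_isBigO 1))

theorem sq_div_isBigO_two {i : ℕ} (h1 : 1 ≤ i) (hi : i ≤ P.μ 0) (hE : P.EqualTop ∨ i + 1 ≤ P.μ 0) :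
    (fun w => z w (P.idx 0 1) ^ 2 / z w (P.idx 0 i)) =O[L] fun w => ‖w‖ ^ 2 := by
  by_cases hi' : i + 1 ≤ P.μ 0
  · exact (h.sq_div_succ h1 hi').trans_isBigO
      (h.apply_mul_isBigO _ (h.sq_div_isBigO (by omega) hi'))
  · obtain rfl : i = P.μ 0 := by omega
    refine (h.sq_div_last_of_equalTop (hE.resolve_right hi')).trans_isBigO ?_
    refine h.apply_mul_isBigO (m := 1) _ ?_
    simpa using h.apply_isBigO _

theorem sq_div_isBigO_three {i : ℕ} (h1 : 1 ≤ i) (hi : i + 1 ≤ P.μ 0)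
    (hE : P.EqualTop ∨ i + 2 ≤ P.μ 0) :
    (fun w => z w (P.idx 0 1) ^ 2 / z w (P.idx 0 i)) =O[L] fun w => ‖w‖ ^ 3 :=
  (h.sq_div_succ h1 hi).trans_isBigO
    (h.apply_mul_isBigO _ (h.sq_div_isBigO_two (by omega) hi hE))

/-- The expansion of `F_{l,i} / z_{0,i}`. -/
theorem div_isBigO {l : Fin ρ} {i : ℕ} (h1 : 1 ≤ i) (hi : i ≤ P.μ l) :
    (fun w => F (z w) (P.idx l i) / z w (P.idx 0 i) -
      ((lam l * z w (P.idx l i) + if i < P.μ l then z w (P.idx l (i + 1)) else 0) /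
        z w (P.idx 0 i) + a (P.idx l i) * (z w (P.idx 0 1) ^ 2 / z w (P.idx 0 i))))
    =O[L] fun w => ‖w‖ * ‖z w (P.idx 0 1) ^ 2 / z w (P.idx 0 i)‖ := by
  obtain ⟨C, hC⟩ := (h.isBigO l i h1 hi).bound
  refine IsBigO.of_bound C ?_
  filter_upwards [hC] with w hw
  have e : F (z w) (P.idx l i) / z w (P.idx 0 i) -
      ((lam l * z w (P.idx l i) + if i < P.μ l then z w (P.idx l (i + 1)) else 0) /
        z w (P.idx 0 i) + a (P.idx l i) * (z w (P.idx 0 1) ^ 2 / z w (P.idx 0 i))) =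
      (F (z w) (P.idx l i) - (lam l * z w (P.idx l i) +
      if i < P.μ l then z w (P.idx l (i + 1)) else 0) - a (P.idx l i) * z w (P.idx 0 1) ^ 2) /
        z w (P.idx 0 i) := by ring
  rw [e, norm_div, norm_mul, norm_norm, norm_norm, norm_div, norm_pow]
  rw [norm_mul, norm_norm, norm_pow, norm_norm] at hw
  rw [← mul_div_assoc, ← mul_div_assoc]
  gcongr

theorem div_zero_isBigO {i : ℕ} (h1 : 1 ≤ i) (hi : i ≤ P.μ 0) :
    (fun w => F (z w) (P.idx 0 i) / z w (P.idx 0 i) -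
      (lam 0 + ((if i < P.μ 0 then w (P.idx 0 (i + 1)) else 0) +
        a (P.idx 0 i) * (z w (P.idx 0 1) ^ 2 / z w (P.idx 0 i)))))
    =O[L] fun w => ‖w‖ ^ 2 := by
  have e1 : (fun w => ‖w‖ * ‖z w (P.idx 0 1) ^ 2 / z w (P.idx 0 i)‖) =O[L] fun w => ‖w‖ ^ 2 :=
    ((isBigO_refl (fun w : P.Idx → ℂ => ‖w‖) L).mul (h.sq_div_isBigO h1 hi).norm_left).congr_right
      fun w => by ring
  refine ((h.div_isBigO h1 hi).trans e1).congr' ?_ EventuallyEq.rfl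
  filter_upwards [h.regular, h.theta_eq] with w hz hw
  congr 1
  rw [← add_assoc]
  congr 1
  split_ifs with hi'
  · rw [eq_mul_idx_zero hz hw h1 hi', ← add_mul, mul_div_cancel_right₀ _ (hz.1 i)]
  · rw [add_zero, add_zero, mul_div_cancel_right₀ _ (hz.1 i)]

/-- The expansion of `F_{0,i} / z_{0,i}` for `i < μ_0`. -/
theorem div_zero_isBigO_of_lt {i : ℕ} (h1 : 1 ≤ i) (hi : i + 1 ≤ P.μ 0) :
    (fun w => F (z w) (P.idx 0 i) / z w (P.idx 0 i) - (lam 0 + w (P.idx 0 (i + 1))))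
    =O[L] fun w => ‖w‖ ^ 2 := by
  refine ((h.div_zero_isBigO h1 (by omega)).add ((h.sq_div_isBigO_two h1 (by omega)
    (Or.inr hi)).const_mul_left (a (P.idx 0 i)))).congr_left fun w => ?_
  rw [if_pos (by omega)]
  ring

theorem div_zero_last_isBigO (hE : ¬ P.EqualTop) :
    (fun w => F (z w) (P.idx 0 (P.μ 0)) / z w (P.idx 0 (P.μ 0)) -
      (lam 0 + a (P.idx 0 (P.μ 0)) * w (P.idx 0 1))) =O[L] fun w => ‖w‖ ^ 2 := by
  refine (h.div_zero_isBigO (P.pos 0) le_rfl).congr' ?_ EventuallyEq.rfl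
  filter_upwards [h.sq_div_last hE] with w hw
  rw [if_neg (lt_irrefl _), hw, zero_add]

theorem div_zero_last_isBigO_of_equalTop (hE : P.EqualTop) :
    (fun w => F (z w) (P.idx 0 (P.μ 0)) / z w (P.idx 0 (P.μ 0)) - (lam 0 + 0))
      =O[L] fun w => ‖w‖ ^ 2 := by
  refine ((h.div_zero_isBigO (P.pos 0) le_rfl).add ((h.sq_div_isBigO_two (P.pos 0) le_rfl
    (Or.inl hE)).const_mul_left (a (P.idx 0 (P.μ 0))))).congr_left fun w => ?_
  rw [if_neg (lt_irrefl _)]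
  ring

theorem div_zero_sub_isBigO {i : ℕ} (h1 : 1 ≤ i) (hi : i ≤ P.μ 0) :
    (fun w => F (z w) (P.idx 0 i) / z w (P.idx 0 i) - lam 0) =O[L] fun w => ‖w‖ := by
  have e0 : (fun w : P.Idx → ℂ => ‖w‖ ^ 2) =O[L] fun w => ‖w‖ := by
    simpa using h.pow_succ_isBigO 1
  have e1 : (fun w => (if i < P.μ 0 then w (P.idx 0 (i + 1)) else 0)) =O[L]
      fun w : P.Idx → ℂ => ‖w‖ := by
    split_ifs
    · exact h.apply_isBigO _
    · exact isBigO_zero _ _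
  have e2 : (fun w => z w (P.idx 0 1) ^ 2 / z w (P.idx 0 i)) =O[L] fun w => ‖w‖ := by
    simpa using h.sq_div_isBigO h1 hi
  refine (((h.div_zero_isBigO h1 hi).trans e0).add (e1.add
    (e2.const_mul_left (a (P.idx 0 i))))).congr_left fun w => ?_
  ring

/-- The expansion of the quotient `F_q / z_q`, where `q` is the last coordinate of the second
block. -/
theorem div_last_isBigO (hE : P.EqualTop) :
    (fun w => F (z w) (P.idx 1 (P.μ 1)) / z w (P.idx 1 (P.μ 1)) -
      (lam 1 + a (P.idx 1 (P.μ 1)) * w (P.idx 0 1))) =O[L] fun w => ‖w‖ ^ 2 := by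
  obtain ⟨C, hC0, hC⟩ := (h.isBigO 1 (P.μ 1) (P.pos 1) le_rfl).exists_nonneg
  refine IsBigO.of_bound C ?_
  filter_upwards [hC.bound, h.regular, h.theta_eq] with w hC hz hw
  -- Here `z_1²` is exactly `w_1` times the denominator, so division by it costs nothing.
  have h1 := sq_eq_mul_pivot hz hw
  rw [pivot_length_of_equalTop hE] at h1
  have h2 := hz.2 hE
  rw [if_neg (lt_irrefl _), add_zero, norm_mul, norm_norm, ← norm_pow, norm_norm, h1] at hC
  have e : F (z w) (P.idx 1 (P.μ 1)) / z w (P.idx 1 (P.μ 1)) -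
      (lam 1 + a (P.idx 1 (P.μ 1)) * w (P.idx 0 1)) =
      (F (z w) (P.idx 1 (P.μ 1)) - lam 1 * z w (P.idx 1 (P.μ 1)) -
        a (P.idx 1 (P.μ 1)) * (w (P.idx 0 1) * z w (P.idx 1 (P.μ 1)))) /
        z w (P.idx 1 (P.μ 1)) := by
    field_simp
    ring
  rw [e, norm_div, div_le_iff₀ (norm_pos_iff.2 h2), norm_pow, norm_norm]
  refine hC.trans ?_
  rw [norm_mul, sq]
  have h3 : ‖w (P.idx 0 1)‖ ≤ ‖w‖ := norm_le_pi_norm w _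
  calc C * (‖w‖ * (‖w (P.idx 0 1)‖ * ‖z w (P.idx 1 (P.μ 1))‖))
      ≤ C * (‖w‖ * (‖w‖ * ‖z w (P.idx 1 (P.μ 1))‖)) := by gcongr
    _ = _ := by ring

/-- The expansion of `F_{l,i} / z_{0,i}` in a block other than the first one. -/
theorem div_ne_isBigO {l : Fin ρ} (hl : l ≠ 0) {i : ℕ} (h1 : 1 ≤ i) (hi : i ≤ P.μ l)
    (hE : P.EqualTop ∨ i + 1 ≤ P.μ 0) :
    (fun w => F (z w) (P.idx l i) / z w (P.idx 0 i) -
      (lam l * w (P.idx l i) + ((if i < P.μ l then w (P.idx 0 (i + 1)) * w (P.idx l (i + 1)) else 0)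
        + a (P.idx l i) * (z w (P.idx 0 1) ^ 2 / z w (P.idx 0 i)))))
    =O[L] fun w => ‖w‖ ^ 3 := by
  have hi0 : P.μ l ≤ P.μ 0 := P.antitone (Fin.zero_le l)
  have e1 : (fun w => ‖w‖ * ‖z w (P.idx 0 1) ^ 2 / z w (P.idx 0 i)‖) =O[L] fun w => ‖w‖ ^ 3 :=
    ((isBigO_refl (fun w : P.Idx → ℂ => ‖w‖) L).mul
      (h.sq_div_isBigO_two h1 (hi.trans hi0) hE).norm_left).congr_right fun w => by ring
  refine ((h.div_isBigO h1 hi).trans e1).congr' ?_ EventuallyEq.rfl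
  filter_upwards [h.regular, h.theta_eq] with w hz hw
  congr 1
  rw [← add_assoc]
  congr 1
  have h2 := hz.1 i
  rw [eq_mul_idx hz hw hl h1 hi]
  split_ifs with hi'
  · rw [eq_mul_idx hz hw hl (by omega) hi', eq_mul_idx_zero hz hw h1 (by omega)]
    field_simp
  · field_simp
    ring

theorem div_ne_isBigO_of_lt {l : Fin ρ} (hl : l ≠ 0) {i : ℕ} (h1 : 1 ≤ i) (hi : i < P.μ l) :
    (fun w => F (z w) (P.idx l i) / z w (P.idx 0 i) -
      (lam l * w (P.idx l i) + w (P.idx 0 (i + 1)) * w (P.idx l (i + 1))))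
    =O[L] fun w => ‖w‖ ^ 3 := by
  have hi0 : P.μ l ≤ P.μ 0 := P.antitone (Fin.zero_le l)
  -- In case (G) the block is shorter than the first one, so two positions are left after `i` in the
  -- first block and the quadratic contribution is cubic in `w`.
  have hE : P.EqualTop ∨ i + 2 ≤ P.μ 0 := by
    by_contra hc
    rw [not_or, not_le] at hc
    have := P.lt_of_not_equalTop hc.1 hl
    omega
  refine ((h.div_ne_isBigO hl h1 hi.le (Or.inr (by omega))).add ((h.sq_div_isBigO_three h1
    (by omega) hE).const_mul_left (a (P.idx l i)))).congr_left fun w => ?_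
  rw [if_pos hi]
  ring

theorem div_ne_last_isBigO {l : Fin ρ} (hl : l ≠ 0) (hi : P.μ l + 1 ≤ P.μ 0)
    (hE : P.EqualTop ∨ P.μ l + 2 ≤ P.μ 0) :
    (fun w => F (z w) (P.idx l (P.μ l)) / z w (P.idx 0 (P.μ l)) -
      (lam l * w (P.idx l (P.μ l)) + 0)) =O[L] fun w => ‖w‖ ^ 3 := by
  refine ((h.div_ne_isBigO hl (P.pos l) le_rfl (Or.inr hi)).add ((h.sq_div_isBigO_three (P.pos l)
    hi hE).const_mul_left (a (P.idx l (P.μ l))))).congr_left fun w => ?_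
  rw [if_neg (lt_irrefl _)]
  ring

theorem div_ne_last_isBigO_of_succ_eq {l : Fin ρ} (hl : l ≠ 0) (hi : P.μ l + 1 = P.μ 0)
    (hE : ¬ P.EqualTop) :
    (fun w => F (z w) (P.idx l (P.μ l)) / z w (P.idx 0 (P.μ l)) -
      (lam l * w (P.idx l (P.μ l)) + a (P.idx l (P.μ l)) * w (P.idx 0 1) * w (P.idx 0 (P.μ 0))))
      =O[L] fun w => ‖w‖ ^ 3 := by
  refine (h.div_ne_isBigO hl (P.pos l) le_rfl (Or.inr hi.le)).congr' ?_ EventuallyEq.rfl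
  filter_upwards [h.sq_div_succ (P.pos l) hi.le, h.sq_div_last hE] with w h1 h2
  rw [if_neg (lt_irrefl _), h1, hi, h2]
  ring

theorem div_ne_last_isBigO_of_eq {l : Fin ρ} (hl : l ≠ 0) (hi : P.μ l = P.μ 0)
    (hE : P.EqualTop) :
    (fun w => F (z w) (P.idx l (P.μ l)) / z w (P.idx 0 (P.μ l)) -
      (lam l * w (P.idx l (P.μ l)) + a (P.idx l (P.μ l)) * w (P.idx 0 1) * w (P.idx 1 (P.μ 1))))
      =O[L] fun w => ‖w‖ ^ 3 := by
  refine (h.div_ne_isBigO hl (P.pos l) le_rfl (Or.inl hE)).congr' ?_ EventuallyEq.rfl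
  filter_upwards [h.sq_div_last_of_equalTop hE] with w h2
  rw [← hi] at h2
  rw [if_neg (lt_irrefl _), h2]
  ring

end RegularExpansion

end RhoPartition

/-! ### Expansions of the last lift at regular points. -/

open Asymptotics

namespace RhoPartition

variable {ρ : ℕ} [NeZero ρ] {P : RhoPartition ρ}

/-- The eigenvalues of the differential of the last lift. -/
noncomputable def liftEigenvalue (P : RhoPartition ρ) (lam : Fin ρ → ℂ) (x : P.Idx) : ℂ :=
  if x = P.idx 0 1 then P.lamTilde lam else lam x.1 / lam 0

namespace RegularExpansion

variable {lam : Fin ρ → ℂ} {a : P.Idx → ℂ} {F z : (P.Idx → ℂ) → P.Idx → ℂ}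
  {L : Filter (P.Idx → ℂ)} (h : P.RegularExpansion lam a F z L)
include h

theorem const_isBigO (c : ℂ) : (fun _ => c) =O[L] fun w : P.Idx → ℂ => ‖w‖ ^ 0 := by
  simp only [pow_zero]
  exact isBigO_const_const c one_ne_zero L

/-- `theta` is a quotient of monomials, so evaluating it at `F z` multiplies its value `w` at `z` by
a quotient of ratios `F_x / z_x`. In the first block this extracts the factor `w x` exactly, whence
the factored error terms. -/
theorem theta_one_eq : (fun w => P.theta P.length (F (z w)) (P.idx 0 1)) =ᶠ[L]
    fun w => w (P.idx 0 1) * ((F (z w) (P.idx 0 1) / z w (P.idx 0 1)) ^ 2 /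
      (F (z w) (P.pivot P.length) / z w (P.pivot P.length))) := by
  filter_upwards [h.regular, h.theta_eq] with w hz hw
  have e := theta_idx_one P.length (z w)
  rw [hw] at e
  have h2 := hz.1 1
  have h3 := hz.pivot_ne_zero
  rw [theta_idx_one, e]
  field_simp

theorem theta_succ_eq {i : ℕ} (h1 : 1 ≤ i) (hi : i + 1 ≤ P.μ 0) :
    (fun w => P.theta P.length (F (z w)) (P.idx 0 (i + 1))) =ᶠ[L]
    fun w => w (P.idx 0 (i + 1)) * ((F (z w) (P.idx 0 (i + 1)) / z w (P.idx 0 (i + 1))) /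
      (F (z w) (P.idx 0 i) / z w (P.idx 0 i))) := by
  filter_upwards [h.regular, h.theta_eq] with w hz hw
  have e := theta_idx_succ (z w) h1 hi
  rw [hw] at e
  have h2 := hz.1 i
  have h3 := hz.1 (i + 1)
  rw [theta_idx_succ _ h1 hi, e]
  field_simp

theorem theta_ne_eq {l : Fin ρ} (hl : l ≠ 0) {i : ℕ} (h1 : 1 ≤ i) (hi : i ≤ P.μ l) :
    (fun w => P.theta P.length (F (z w)) (P.idx l i)) =ᶠ[L]
    fun w => (F (z w) (P.idx l i) / z w (P.idx 0 i)) / (F (z w) (P.idx 0 i) / z w (P.idx 0 i)) := by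
  filter_upwards [h.regular] with w hz
  have h2 := hz.1 i
  rw [theta_idx_of_ne _ hl h1 hi]
  field_simp

theorem mul_isBigO {f g : (P.Idx → ℂ) → ℂ} {x : P.Idx} {u : (P.Idx → ℂ) → ℂ} {m : ℕ}
    (hf : f =ᶠ[L] fun w => w x * u w) (hu : (fun w => u w - g w) =O[L] fun w => ‖w‖ ^ m) :
    (fun w => f w - w x * g w) =O[L] fun w => ‖w x‖ * ‖w‖ ^ m := by
  have h1 : (fun w : P.Idx → ℂ => w x) =O[L] fun w => ‖w x‖ :=
    (isBigO_refl _ _).norm_right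
  refine (h1.mul hu).congr' ?_ EventuallyEq.rfl
  filter_upwards [hf] with w hw
  rw [hw]; ring

theorem sq_isBigO : (fun w => (F (z w) (P.idx 0 1) / z w (P.idx 0 1)) ^ 2 -
    (lam 0 ^ 2 + 2 * lam 0 * w (P.idx 0 2))) =O[L] fun w => ‖w‖ ^ (0 + 2) := by
  have h1 := h.div_zero_isBigO_of_lt le_rfl h.two_le
  have h0 := h.div_zero_sub_isBigO le_rfl (P.pos 0)
  have h3 : (fun w => F (z w) (P.idx 0 1) / z w (P.idx 0 1) + lam 0) =O[L]
      fun _ => (1 : ℝ) := by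
    refine ((h0.trans (h.tendsto_norm.isBigO_one ℝ)).add
      (isBigO_const_const (2 * lam 0) one_ne_zero L)).congr_left fun w => by ring
  have h4 : (fun w => w (P.idx 0 2) * (F (z w) (P.idx 0 1) / z w (P.idx 0 1) - lam 0)) =O[L]
      fun w => ‖w‖ ^ 2 := ((h.apply_isBigO _).mul h0).congr_right fun w => by ring
  -- With `R = F_1 / z_1`: `R² - λ² - 2λ w_2 = (R - λ - w_2)(R + λ) + w_2 (R - λ)`.
  refine (((h1.mul h3).congr_right fun w => mul_one _).add h4).congr_left fun w => ?_
  ring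

theorem sq_sub_isBigO : (fun w => (F (z w) (P.idx 0 1) / z w (P.idx 0 1)) ^ 2 - lam 0 ^ 2) =O[L]
    fun w => ‖w‖ ^ (0 + 1) := by
  refine ((h.sq_isBigO.trans (h.pow_succ_isBigO 1)).add
    (((h.apply_isBigO (P.idx 0 2)).const_mul_left (2 * lam 0)).congr_right
      fun w => (pow_one _).symm)).congr_left fun w => ?_
  ring

theorem theta_isBigO_one {β : ℂ} (hβ : β ≠ 0) {b : (P.Idx → ℂ) → ℂ}
    (hB : (fun w => F (z w) (P.pivot P.length) / z w (P.pivot P.length) - (β + b w)) =O[L]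
      fun w => ‖w‖ ^ 2) (hb : b =O[L] fun w => ‖w‖) :
    (fun w => P.theta P.length (F (z w)) (P.idx 0 1) - w (P.idx 0 1) *
      (lam 0 ^ 2 / β + 2 * lam 0 * w (P.idx 0 2) / β - lam 0 ^ 2 * b w / β ^ 2))
      =O[L] fun w => ‖w (P.idx 0 1)‖ * ‖w‖ ^ 2 := by
  refine h.mul_isBigO h.theta_one_eq (isBigO_div_sub (m := 0) h.tendsto_norm hβ h.sq_isBigO ?_ ?_ hB hb)
  · exact h.const_isBigO (lam 0 ^ 2)
  · simpa using (h.apply_isBigO (P.idx 0 2)).const_mul_left (2 * lam 0)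

theorem theta_isBigO_succ {i : ℕ} (h1 : 1 ≤ i) (hi : i + 1 ≤ P.μ 0) {c : (P.Idx → ℂ) → ℂ}
    (hc : (fun w => F (z w) (P.idx 0 (i + 1)) / z w (P.idx 0 (i + 1)) - (lam 0 + c w)) =O[L]
      fun w => ‖w‖ ^ 2) (hc' : c =O[L] fun w => ‖w‖) :
    (fun w => P.theta P.length (F (z w)) (P.idx 0 (i + 1)) - w (P.idx 0 (i + 1)) *
      (1 - 1 / lam 0 * w (P.idx 0 (i + 1)) + 1 / lam 0 * c w))
      =O[L] fun w => ‖w (P.idx 0 (i + 1))‖ * ‖w‖ ^ 2 := by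
  refine h.mul_isBigO (h.theta_succ_eq h1 hi) ?_
  refine (isBigO_div_sub (m := 0) h.tendsto_norm (h.lam_ne_zero 0) hc ?_ ?_
    (h.div_zero_isBigO_of_lt h1 hi) (h.apply_isBigO _)).congr_left fun w => ?_
  · exact h.const_isBigO (lam 0)
  · simpa using hc'
  · have := h.lam_ne_zero 0
    field_simp
    ring

theorem theta_isBigO_ne {l : Fin ρ} (hl : l ≠ 0) {i : ℕ} (h1 : 1 ≤ i) (hi : i ≤ P.μ l)
    {c b : (P.Idx → ℂ) → ℂ}
    (hc : (fun w => F (z w) (P.idx l i) / z w (P.idx 0 i) - (lam l * w (P.idx l i) + c w)) =O[L]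
      fun w => ‖w‖ ^ 3) (hc' : c =O[L] fun w => ‖w‖ ^ 2)
    (hB : (fun w => F (z w) (P.idx 0 i) / z w (P.idx 0 i) - (lam 0 + b w)) =O[L]
      fun w => ‖w‖ ^ 2) (hb : b =O[L] fun w => ‖w‖) :
    (fun w => P.theta P.length (F (z w)) (P.idx l i) -
      (lam l * w (P.idx l i) / lam 0 + c w / lam 0 - lam l * w (P.idx l i) * b w / lam 0 ^ 2))
      =O[L] fun w => ‖w‖ ^ 3 := by
  refine (isBigO_div_sub (m := 1) h.tendsto_norm (h.lam_ne_zero 0) hc ?_ hc' hB hb).congr' ?_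
    EventuallyEq.rfl
  · simpa using (h.apply_isBigO (P.idx l i)).const_mul_left (lam l)
  · filter_upwards [h.theta_ne_eq hl h1 hi] with w hw
    rw [hw]

/-- The ratio at the last pivot tends to `λ_2` in case (E) and to `λ_1` in case (G). This limit is
the only source of the difference between the two values of `λ̃_1`. -/
theorem pivot_isBigO : ∃ β ≠ 0, P.lamTilde lam = lam 0 ^ 2 / β ∧
    (fun w => F (z w) (P.pivot P.length) / z w (P.pivot P.length) - β) =O[L] fun w => ‖w‖ := by
  by_cases hE : P.EqualTop
  · refine ⟨lam 1, h.lam_ne_zero 1, if_pos hE, ?_⟩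
    rw [pivot_length_of_equalTop hE]
    refine (((h.div_last_isBigO hE).trans (h.pow_succ_isBigO 1)).add
      (((h.apply_isBigO (P.idx 0 1)).const_mul_left (a (P.idx 1 (P.μ 1)))).congr_right
        fun w => (pow_one _).symm)).congr (fun w => ?_) fun w => pow_one _
    ring
  · refine ⟨lam 0, h.lam_ne_zero 0, ?_, ?_⟩
    · rw [lamTilde, if_neg hE, sq, mul_div_cancel_right₀ _ (h.lam_ne_zero 0)]
    · rw [pivot_length_of_not_equalTop hE]
      exact h.div_zero_sub_isBigO (P.pos 0) le_rfl

/-- The linear part of the last lift. -/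
theorem theta_sub_isBigO (x : P.Idx) :
    (fun w => P.theta P.length (F (z w)) x - P.liftEigenvalue lam x * w x) =O[L]
      fun w => ‖w‖ ^ 2 := by
  have key : ∀ {f : (P.Idx → ℂ) → ℂ} {x : P.Idx} {u : (P.Idx → ℂ) → ℂ} {c : ℂ},
      (f =ᶠ[L] fun w => w x * u w) → ((fun w => u w - c) =O[L] fun w => ‖w‖ ^ 1) →
      (fun w => f w - c * w x) =O[L] fun w => ‖w‖ ^ 2 := by
    intro f x u c hf hu
    refine ((h.mul_isBigO hf hu).trans (((h.apply_isBigO x).norm_left.mul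
      (isBigO_refl _ L)))).congr (fun w => ?_) fun w => ?_
    · ring
    · ring
  refine forall_idx (p := fun x => (fun w => P.theta P.length (F (z w)) x -
    P.liftEigenvalue lam x * w x) =O[L] fun w => ‖w‖ ^ 2) (fun l i h1 hi => ?_) x
  by_cases hl : l = 0
  · subst hl
    obtain rfl | ⟨i, rfl, h1'⟩ : i = 1 ∨ ∃ j, i = j + 1 ∧ 1 ≤ j := by
      by_cases h2 : i = 1
      · exact Or.inl h2
      · exact Or.inr ⟨i - 1, by omega, by omega⟩
    · obtain ⟨β, hβ, e, hB⟩ := h.pivot_isBigO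
      rw [liftEigenvalue, if_pos rfl, e]
      refine key h.theta_one_eq (isBigO_div_sub_div (m := 0) h.tendsto_norm hβ h.sq_sub_isBigO ?_ hB)
      exact h.const_isBigO (lam 0 ^ 2)
    · have e1 : P.idx 0 (i + 1) ≠ P.idx 0 1 := by
        rw [Ne, P.idx_eq_idx_iff (by omega) le_rfl hi (P.pos 0)]; omega
      have e2 : P.liftEigenvalue lam (P.idx 0 (i + 1)) = lam 0 / lam 0 := if_neg e1
      rw [e2]
      refine key (h.theta_succ_eq h1' hi) (isBigO_div_sub_div (m := 0) h.tendsto_norm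
        (h.lam_ne_zero 0) ?_ ?_ (h.div_zero_sub_isBigO h1' (by omega)))
      · simpa using h.div_zero_sub_isBigO h1 hi
      · exact h.const_isBigO (lam 0)
  · have e1 : P.idx l i ≠ P.idx 0 1 := fun h => hl (congrArg Sigma.fst h)
    have hi0 : P.μ l ≤ P.μ 0 := P.antitone (Fin.zero_le l)
    -- This makes `z_1² / z_{1,i}` quadratic in `w`, so that no off-diagonal linear term survives.
    have hE : P.EqualTop ∨ i + 1 ≤ P.μ 0 := by
      by_cases hE : P.EqualTop
      · exact Or.inl hE
      · have := lt_of_not_equalTop hE hl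
        exact Or.inr (by omega)
    rw [liftEigenvalue, if_neg e1]
    have e2 : (fun w : P.Idx → ℂ => if i < P.μ l then w (P.idx 0 (i + 1)) * w (P.idx l (i + 1))
        else 0) =O[L] fun w => ‖w‖ ^ 2 := by
      split_ifs
      · exact h.apply_mul_isBigO (m := 1) _ (by simpa using h.apply_isBigO _)
      · exact isBigO_zero _ _
    have e3 : (fun w => F (z w) (P.idx l i) / z w (P.idx 0 i) - lam l * w (P.idx l i)) =O[L]
        fun w => ‖w‖ ^ 2 := by
      refine (((h.div_ne_isBigO hl h1 hi hE).trans (h.pow_succ_isBigO 2)).add (e2.add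
        ((h.sq_div_isBigO_two h1 (hi.trans hi0) hE).const_mul_left (a (P.idx l i))))).congr_left
          fun w => ?_
      ring
    refine (isBigO_div_sub_div (m := 1) h.tendsto_norm (h.lam_ne_zero 0) e3 ?_
      (h.div_zero_sub_isBigO h1 (hi.trans hi0))).congr' ?_ EventuallyEq.rfl
    · simpa using (h.apply_isBigO (P.idx l i)).const_mul_left (lam l)
    · filter_upwards [h.theta_ne_eq hl h1 hi] with w hw
      rw [hw]
      change _ = _ - lam l / lam 0 * _
      ring

/-- The images of regular points are regular. -/
theorem eventually_isRegular : ∀ᶠ w in L, P.IsRegular (F (z w)) := by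
  have h1 : ∀ᶠ w in L, ∀ i : Fin (P.μ 0), F (z w) (P.idx 0 (i + 1)) ≠ 0 := by
    refine eventually_all.2 fun i => ?_
    have e1 := (h.div_zero_sub_isBigO (i := i + 1) (by omega) i.2).trans_tendsto h.tendsto_norm
    have e2 := (tendsto_sub_nhds_zero_iff.1 e1).eventually_ne (h.lam_ne_zero 0)
    filter_upwards [e2] with w hw h0
    exact hw (by rw [h0, zero_div])
  have h2 : ∀ᶠ w in L, F (z w) (P.pivot P.length) ≠ 0 := by
    obtain ⟨β, hβ, _, hB⟩ := h.pivot_isBigO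
    have e1 := hB.trans_tendsto h.tendsto_norm
    have e2 := (tendsto_sub_nhds_zero_iff.1 e1).eventually_ne hβ
    filter_upwards [e2] with w hw h0
    exact hw (by rw [h0, zero_div])
  filter_upwards [h1, h2] with w h1 h2
  refine isRegular_iff.2 ⟨fun i hi hi' => ?_, fun hE => ?_⟩
  · have := h1 ⟨i - 1, by omega⟩
    rwa [show (i - 1) + 1 = i by omega] at this
  · rwa [pivot_length_of_equalTop hE] at h2

theorem tendsto_theta : Tendsto (fun w => P.theta P.length (F (z w))) L (𝓝 0) := by
  refine tendsto_pi_nhds.2 fun x => ?_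
  have h1 : (fun w => P.liftEigenvalue lam x * w x) =O[L] fun w : P.Idx → ℂ => ‖w‖ :=
    (h.apply_isBigO x).const_mul_left _
  have h2 := (((h.theta_sub_isBigO x).trans (h.pow_succ_isBigO 1)).congr_right
    fun w => pow_one _).add h1
  refine (h2.congr_left fun w => ?_).trans_tendsto h.tendsto_norm
  ring

end RegularExpansion

end RhoPartition

/-! ### Passage from regular points to a neighborhood. -/

open Asymptotics

/-- An estimate which holds on a dense set extends to a neighbourhood by continuity. -/
theorem isBigO_of_dense {ι : Type} [Fintype ι] {f g p : (ι → ℂ) → ℂ} {r : (ι → ℂ) → ℝ}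
    {D : Set (ι → ℂ)} (hD : Dense D) (hg : ∀ᶠ w in 𝓝 0, ContinuousAt g w) (hp : Continuous p)
    (hr : Continuous r) (h : (fun w => f w - p w) =O[𝓝[D] 0] r) (hgf : g =ᶠ[𝓝[D] 0] f) :
    (fun w => g w - p w) =O[𝓝 0] r := by
  obtain ⟨C, hC⟩ := h.bound
  refine IsBigO.of_bound C ?_
  have h1 : ∀ᶠ w in 𝓝 0, w ∈ D → ‖g w - p w‖ ≤ C * ‖r w‖ := by
    rw [← eventually_nhdsWithin_iff]
    filter_upwards [hC, hgf] with w h1 h2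
    rwa [h2]
  obtain ⟨O, hO, hOo, h0⟩ := eventually_nhds_iff.1 (h1.and hg)
  refine eventually_nhds_iff.2 ⟨O, fun w hw => ?_, hOo, h0⟩
  by_contra hc
  rw [not_le] at hc
  have c1 : ContinuousAt (fun w => ‖g w - p w‖) w := ((hO w hw).2.sub hp.continuousAt).norm
  have c2 : ContinuousAt (fun w => C * ‖r w‖) w := (continuous_const.mul hr.norm).continuousAt
  -- A violation of the bound is an open condition, so it would also occur at a point of the dense
  -- set.
  obtain ⟨y, ⟨hy1, hy2⟩, hy3⟩ := mem_closure_iff_nhds.1 (hD w) _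
    (inter_mem (c2.eventually_lt c1 hc) (hOo.mem_nhds hw))
  exact absurd ((hO y hy2).1 hy3) (not_le.2 hy1)

namespace RhoPartition

variable {ρ : ℕ} [NeZero ρ] {P : RhoPartition ρ}

section Expansion

variable {lam : Fin ρ → ℂ} {a : P.Idx → ℂ} {F z g : (P.Idx → ℂ) → P.Idx → ℂ}
  {D : Set (P.Idx → ℂ)} (h : P.RegularExpansion lam a F z (𝓝[D] 0)) (hD : Dense D)
  (hg : ∀ᶠ w in 𝓝 0, ContinuousAt g w)
  (hgf : g =ᶠ[𝓝[D] 0] fun w => P.theta P.length (F (z w)))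
include h hD hg hgf

theorem RegularExpansion.transfer {x : P.Idx} {p : (P.Idx → ℂ) → ℂ} {r : (P.Idx → ℂ) → ℝ}
    (hp : Continuous p) (hr : Continuous r)
    (hb : (fun w => P.theta P.length (F (z w)) x - p w) =O[𝓝[D] 0] r) :
    (fun w => g w x - p w) =O[𝓝 0] r := by
  refine isBigO_of_dense hD ?_ hp hr hb ?_
  · filter_upwards [hg] with w hw
    exact continuousAt_pi.1 hw x
  · filter_upwards [hgf] with w hw
    rw [hw]

theorem RegularExpansion.expansion_block {l : Fin ρ} (hl : l ≠ 0) {i : ℕ} (h1 : 1 ≤ i)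
    (hi : i < P.μ l) :
    (fun w => g w (P.idx l i) - (lam l / lam 0 * w (P.idx l i)
        - lam l / lam 0 ^ 2 * w (P.idx 0 (i + 1)) * w (P.idx l i)
        + 1 / lam 0 * w (P.idx 0 (i + 1)) * w (P.idx l (i + 1)))) =O[𝓝 0] fun w => ‖w‖ ^ 3 := by
  have hi0 : P.μ l ≤ P.μ 0 := P.antitone (Fin.zero_le l)
  refine h.transfer hD hg hgf (by fun_prop) (by fun_prop)
    ((h.theta_isBigO_ne hl h1 hi.le (h.div_ne_isBigO_of_lt hl h1 hi)
      (h.apply_mul_isBigO (m := 1) _ (by simpa using h.apply_isBigO _))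
      (h.div_zero_isBigO_of_lt h1 (by omega)) (h.apply_isBigO _)).congr_left fun w => ?_)
  ring

theorem RegularExpansion.expansion_block_last {l : Fin ρ} (hl : l ≠ 0) (hi : P.μ l + 1 ≤ P.μ 0)
    (hE : P.EqualTop ∨ P.μ l + 2 ≤ P.μ 0) :
    (fun w => g w (P.idx l (P.μ l)) - (lam l / lam 0 * w (P.idx l (P.μ l))
        - lam l / lam 0 ^ 2 * w (P.idx 0 (P.μ l + 1)) * w (P.idx l (P.μ l))))
      =O[𝓝 0] fun w => ‖w‖ ^ 3 := by
  refine h.transfer hD hg hgf (by fun_prop) (by fun_prop)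
    ((h.theta_isBigO_ne hl (P.pos l) le_rfl (h.div_ne_last_isBigO hl hi hE) (isBigO_zero _ _)
      (h.div_zero_isBigO_of_lt (P.pos l) hi) (h.apply_isBigO _)).congr_left fun w => ?_)
  ring

theorem RegularExpansion.expansion_succ {i : ℕ} (hi2 : 2 ≤ i) (hi : i + 1 ≤ P.μ 0) :
    (fun w => g w (P.idx 0 i) -
      w (P.idx 0 i) * (1 - 1 / lam 0 * w (P.idx 0 i) + 1 / lam 0 * w (P.idx 0 (i + 1))))
    =O[𝓝 0] fun w => ‖w (P.idx 0 i)‖ * ‖w‖ ^ 2 := by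
  obtain ⟨i, rfl⟩ : ∃ j, i = j + 1 := ⟨i - 1, by omega⟩
  exact h.transfer hD hg hgf (by fun_prop) (by fun_prop) (h.theta_isBigO_succ (by omega)
    (by omega) (h.div_zero_isBigO_of_lt (by omega) hi) (h.apply_isBigO _))

theorem RegularExpansion.expansionOfGt (hE : ¬ P.EqualTop) : P.ExpansionOfGt lam a g := by
  have hlam := h.lam_ne_zero 0
  have h2 := h.two_le
  have e1 : (fun w : P.Idx → ℂ => a (P.idx 0 (P.μ 0)) * w (P.idx 0 1)) =O[𝓝[D] 0] fun w => ‖w‖ :=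
    (h.apply_isBigO _).const_mul_left _
  refine ⟨?_, fun i hi hi' => h.expansion_succ hD hg hgf hi hi', ?_,
    fun l hl i h1 hi => h.expansion_block hD hg hgf hl h1 hi,
    fun l hl hi => h.expansion_block_last hD hg hgf hl hi.le (Or.inr hi), fun l hl hi => ?_⟩
  · refine h.transfer hD hg hgf (by fun_prop) (by fun_prop) ((h.theta_isBigO_one hlam
      (b := fun w => a (P.idx 0 (P.μ 0)) * w (P.idx 0 1)) ?_ e1).congr_left fun w => ?_)
    · rw [pivot_length_of_not_equalTop hE]
      exact h.div_zero_last_isBigO hE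
    · field_simp
      ring
  -- The last coordinate of the first block as a successor; `2 ≤ μ_1` ensures that the predecessor
  -- exists.
  · have e2 := h.theta_isBigO_succ (i := P.μ 0 - 1)
      (c := fun w => a (P.idx 0 (P.μ 0)) * w (P.idx 0 1)) (by omega) (by omega) (by
        rw [Nat.sub_add_cancel (by omega)]
        exact h.div_zero_last_isBigO hE) e1
    rw [Nat.sub_add_cancel (by omega)] at e2
    refine h.transfer hD hg hgf (by fun_prop) (by fun_prop) (e2.congr_left fun w => ?_)
    ring
  · have e3 : (fun w : P.Idx → ℂ => a (P.idx l (P.μ l)) * w (P.idx 0 1) * w (P.idx 0 (P.μ 0)))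
        =O[𝓝[D] 0] fun w => ‖w‖ ^ 2 :=
      (((h.apply_isBigO (P.idx 0 1)).const_mul_left _).mul (h.apply_isBigO _)).congr_right
        fun w => by ring
    refine h.transfer hD hg hgf (by fun_prop) (by fun_prop)
      ((h.theta_isBigO_ne hl (P.pos l) le_rfl (h.div_ne_last_isBigO_of_succ_eq hl hi hE) e3
        (h.div_zero_isBigO_of_lt (P.pos l) hi.le) (h.apply_isBigO _)).congr_left fun w => ?_)
    rw [hi]
    ring

theorem RegularExpansion.expansionOfEq (hE : P.EqualTop) : P.ExpansionOfEq lam a g := by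
  have hlam := h.lam_ne_zero 0
  have hlam1 := h.lam_ne_zero 1
  have h2 := h.two_le
  have hone := P.one_ne_zero_of_equalTop hE
  have e1 : (fun w : P.Idx → ℂ => a (P.idx 1 (P.μ 1)) * w (P.idx 0 1)) =O[𝓝[D] 0] fun w => ‖w‖ :=
    (h.apply_isBigO _).const_mul_left _
  refine ⟨?_, fun i hi hi' => h.expansion_succ hD hg hgf hi hi', ?_,
    fun l hl i h1 hi => h.expansion_block hD hg hgf hl h1 hi, ?_,
    fun l hi => h.expansion_block_last hD hg hgf (fun hl => ?_) hi (Or.inl hE),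
    fun l hl _ hi => ?_⟩
  · refine h.transfer hD hg hgf (by fun_prop) (by fun_prop) ((h.theta_isBigO_one hlam1
      (b := fun w => a (P.idx 1 (P.μ 1)) * w (P.idx 0 1)) ?_ e1).congr_left fun w => ?_)
    · rw [pivot_length_of_equalTop hE]
      exact h.div_last_isBigO hE
    · ring
  · have e2 := h.theta_isBigO_succ (i := P.μ 0 - 1) (c := fun _ => 0) (by omega) (by omega) (by
        rw [Nat.sub_add_cancel (by omega)]
        exact h.div_zero_last_isBigO_of_equalTop hE) (isBigO_zero _ _)
    rw [Nat.sub_add_cancel (by omega)] at e2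
    refine h.transfer hD hg hgf (by fun_prop) (by fun_prop) (e2.congr_left fun w => ?_)
    ring
  -- This coordinate is the last pivot, whose variable does not vanish at regular points, so its own
  -- factor can be extracted as in the first block.
  · have e2 : (fun w => P.theta P.length (F (z w)) (P.idx 1 (P.μ 1))) =ᶠ[𝓝[D] 0]
        fun w => w (P.idx 1 (P.μ 1)) * ((F (z w) (P.idx 1 (P.μ 1)) / z w (P.idx 1 (P.μ 1))) /
          (F (z w) (P.idx 0 (P.μ 0)) / z w (P.idx 0 (P.μ 0)))) := by
      filter_upwards [h.theta_ne_eq hone (P.pos 1) le_rfl, h.regular, h.theta_eq] with w h3 hz hw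
      have h4 := eq_mul_idx hz hw hone (P.pos 1) le_rfl
      have h5 := hz.2 hE
      have h6 := hz.1 (P.μ 1)
      have h7 : w (P.idx 1 (P.μ 1)) = z w (P.idx 1 (P.μ 1)) / z w (P.idx 0 (P.μ 1)) := by
        rw [h4, mul_div_cancel_right₀ _ h6]
      rw [h3, h7, ← hE.2]
      field_simp
    refine h.transfer hD hg hgf (by fun_prop) (by fun_prop) ((h.mul_isBigO e2
      (isBigO_div_sub (m := 0) h.tendsto_norm hlam (h.div_last_isBigO hE) (h.const_isBigO _)
        (by simpa using e1) (h.div_zero_last_isBigO_of_equalTop hE)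
        (isBigO_zero _ _))).congr_left fun w => ?_)
    ring
  · rw [hl] at hi
    exact lt_irrefl _ hi
  · have e3 : (fun w : P.Idx → ℂ => a (P.idx l (P.μ l)) * w (P.idx 0 1) * w (P.idx 1 (P.μ 1)))
        =O[𝓝[D] 0] fun w => ‖w‖ ^ 2 :=
      (((h.apply_isBigO (P.idx 0 1)).const_mul_left _).mul (h.apply_isBigO _)).congr_right
        fun w => by ring
    have e4 := h.div_zero_last_isBigO_of_equalTop hE
    rw [← hi] at e4
    refine h.transfer hD hg hgf (by fun_prop) (by fun_prop)
      ((h.theta_isBigO_ne hl (P.pos l) le_rfl (h.div_ne_last_isBigO_of_eq hl hi hE) e3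
        e4 (isBigO_zero _ _)).congr_left fun w => ?_)
    ring

/-- A quadratic error in each component is `o(‖w‖)`, so the linear parts already found form the
differential. -/
theorem RegularExpansion.hasFDerivAt (h0 : g 0 = 0) :
    HasFDerivAt g (ContinuousLinearMap.pi fun x => P.liftEigenvalue lam x •
      ContinuousLinearMap.proj (R := ℂ) (φ := fun _ : P.Idx => ℂ) x) 0 := by
  refine hasFDerivAt_pi.2 fun x => ?_
  have h1 := h.transfer hD hg hgf (by fun_prop) (by fun_prop) (h.theta_sub_isBigO x)
  refine HasFDerivAt.of_isLittleO ?_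
  have h2 : (fun w : P.Idx → ℂ => ‖w‖ ^ 2) =o[𝓝 0] fun w => w - 0 := by
    simpa using (isLittleO_norm_pow_id (E' := P.Idx → ℂ) one_lt_two)
  refine (h1.trans_isLittleO h2).congr_left fun w => ?_
  simp [h0]

end Expansion

/-! ### Diagonalizability and eigenvalues. -/

section Diagonal

variable {ι : Type} [Fintype ι] [DecidableEq ι] {T A : Module.End ℂ (ι → ℂ)} {d : ι → ℂ}

theorem isDiagonalizable_of_conj (hA : Function.Bijective A)
    (h : ∀ v i, A (T v) i = d i * A v i) : IsDiagonalizable T := by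
  let e := LinearEquiv.ofBijective A hA
  refine ⟨(Pi.basisFun ℂ ι).map e.symm, d, fun i => ?_⟩
  apply hA.1
  funext j
  have e1 : ∀ v, A (e.symm v) = v := fun v => e.apply_symm_apply v
  rw [Module.Basis.map_apply, h, map_smul, Pi.smul_apply, smul_eq_mul, e1, Pi.basisFun_apply]
  by_cases hj : j = i
  · rw [hj]
  · simp [hj]

theorem charpoly_of_conj (hA : Function.Bijective A)
    (h : ∀ v i, A (T v) i = d i * A v i) :
    T.charpoly = ∏ i, (Polynomial.X - Polynomial.C (d i)) := by
  let e := LinearEquiv.ofBijective A hA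
  have e1 : e.conj T = Matrix.toLin' (Matrix.diagonal d) := by
    refine LinearMap.ext fun v => funext fun i => ?_
    rw [LinearEquiv.conj_apply_apply, Matrix.toLin'_apply, Matrix.mulVec_diagonal]
    refine (h _ i).trans ?_
    congr 1
    exact congrFun (e.apply_symm_apply v) i
  rw [← LinearEquiv.charpoly_conj e T, e1, ← LinearMap.charpoly_toMatrix _ (Pi.basisFun ℂ ι),
    ← Matrix.toLin_eq_toLin', LinearMap.toMatrix_toLin, Matrix.charpoly_diagonal]

end Diagonal

/-- The first block contributes `λ̃_1` once and `λ_1 / λ_1 = 1` for its other positions. -/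
theorem prod_liftEigenvalue (lam : Fin ρ → ℂ) (hlam : lam 0 ≠ 0) :
    ∏ x, (Polynomial.X - Polynomial.C (P.liftEigenvalue lam x)) =
      (Polynomial.X - Polynomial.C (P.lamTilde lam)) *
        (Polynomial.X - Polynomial.C 1) ^ (P.μ 0 - 1) *
        ∏ l ∈ Finset.univ.erase 0, (Polynomial.X - Polynomial.C (lam l / lam 0)) ^ P.μ l := by
  rw [Fintype.prod_sigma, ← Finset.mul_prod_erase _ _ (Finset.mem_univ (0 : Fin ρ))]
  congr 1
  · have hpos := P.pos 0
    have e0 : ∀ i : Fin (P.μ 0), P.liftEigenvalue lam ⟨0, i⟩ =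
        if (i : ℕ) = 0 then P.lamTilde lam else 1 := by
      intro i
      rw [liftEigenvalue]
      have : ((⟨0, i⟩ : P.Idx) = P.idx 0 1) ↔ (i : ℕ) = 0 := by
        rw [eq_idx_zero_iff le_rfl hpos]
        simp
      simp only [this]
      split_ifs
      · rfl
      · exact div_self hlam
    simp only [e0]
    obtain ⟨m, hm⟩ : ∃ m, P.μ 0 = m + 1 := ⟨P.μ 0 - 1, by omega⟩
    rw [hm, Fin.prod_univ_succ]
    simp
  · refine Finset.prod_congr rfl fun l hl => ?_
    have hl0 := Finset.ne_of_mem_erase hl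
    have e0 : ∀ i : Fin (P.μ l), P.liftEigenvalue lam ⟨l, i⟩ = lam l / lam 0 := fun i =>
      if_neg fun h => hl0 (congrArg Sigma.fst h)
    simp only [e0, Finset.prod_const, Finset.card_univ, Fintype.card_fin]

end RhoPartition

/-! ### The last lift at the distinguished point. -/

open Asymptotics

namespace RhoPartition

variable {ρ : ℕ} [NeZero ρ] {P : RhoPartition ρ} {lam : Fin ρ → ℂ}
  {F H : (P.Idx → ℂ) → P.Idx → ℂ} {U U' : Set (P.Idx → ℂ)}

/-- Outside the singular divisor, itself with dense complement, the manifold is the punctured `ℂⁿ`,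
where the vectors without zero coordinates are dense. -/
theorem StageManifold.dense_isRegular {k : ℕ} (hA : P.StageManifold F H U U' k) :
    Dense {x : P.Mfd k | P.IsRegular (P.proj k x)} := by
  obtain ⟨g, hg, hg1, hg2⟩ := hA.exists_inv
  intro x
  refine mem_closure_iff_nhds.2 fun O hO => ?_
  obtain ⟨O', hO'O, hO', hxO'⟩ := mem_nhds_iff.1 hO
  obtain ⟨y, hyO, hy⟩ := mem_closure_iff_nhds.1 (hA.dense x) _ (hO'.mem_nhds hxO')
  have hy' : P.proj k y ∈ ({0}ᶜ : Set (P.Idx → ℂ)) := hy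
  have c : ContinuousAt g (P.proj k y) :=
    hg.continuousOn.continuousAt (isOpen_compl_singleton.mem_nhds hy')
  have h1 : g ⁻¹' O' ∈ 𝓝 (P.proj k y) := c.preimage_mem_nhds (by
    rw [hg2 y hy]; exact hO'.mem_nhds hyO)
  obtain ⟨t, ⟨ht1, ht2⟩, ht3⟩ := mem_closure_iff_nhds.1 (dense_forall_ne_zero P.Idx (P.proj k y)) _
    (inter_mem h1 (isOpen_compl_singleton.mem_nhds hy'))
  refine ⟨g t, hO'O ht1, ?_⟩
  change P.IsRegular (P.proj k (g t))
  rw [hg1 t ht2]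
  exact ⟨fun i => ht3 _, fun _ => ht3 _⟩

/-- The behaviour of the last lift at the distinguished point. -/
theorem lift_length (hF : AnalyticAt ℂ F 0) (hF0 : F 0 = 0)
    (hJordan : (fderiv ℂ F 0).toLinearMap = Matrix.toLin' (P.jordan lam))
    (hlam : ∀ l, lam l ≠ 0) (hμ : 2 ≤ P.μ 0) (h : IsBihol P.Idx F H U U') (h0 : 0 ∈ U)
    (hA : P.StageManifold F H U U' P.length)
    (hc : ∀ k < P.length, P.StageCenter F U k) {e : P.Mfd P.length}
    (he : e ∈ (P.tower P.length).dom) (he0 : (P.tower P.length).chart e = 0)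
    (hpe : P.proj P.length e = 0)
    {χ : OpenPartialHomeomorph (P.Mfd P.length) (P.Idx → ℂ)} (hχ : P.IsCanonicalChart P.length χ) :
    P.liftTower F P.length e = e ∧ ∃ (z : (P.Idx → ℂ) → P.Idx → ℂ) (D : Set (P.Idx → ℂ)),
      Dense D ∧ P.RegularExpansion lam (P.quadCoeff F) F z (𝓝[D] 0) ∧
      (∀ᶠ w in 𝓝 0, ContinuousAt (fun w => χ (P.liftTower F P.length (χ.symm w))) w) ∧
      (fun w => χ (P.liftTower F P.length (χ.symm w))) =ᶠ[𝓝[D] 0]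
        fun w => P.theta P.length (F (z w)) := by
  have := hA.isManifold
  have := hA.t2Space
  have hes : e ∈ χ.source := hχ.source_eq ▸ he
  have hχe : χ e = 0 := by rw [hχ.eqOn he, he0]
  have ht : ∀ w, w ∈ χ.target := fun w => hχ.target_eq ▸ mem_univ w
  have hs0 : χ.symm 0 = e := by rw [← hχe, χ.left_inv hes]
  have hsc : ∀ w, ContinuousAt χ.symm w := fun w => χ.continuousAt_symm (ht w)
  set G := P.liftTower F P.length with hG
  set z : (P.Idx → ℂ) → P.Idx → ℂ := fun w => P.proj P.length (χ.symm w) with hz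
  set D : Set (P.Idx → ℂ) := {w | P.IsRegular (z w)} with hDdef
  have hD : Dense D := by
    intro w
    refine mem_closure_iff_nhds.2 fun O hO => ?_
    obtain ⟨y, hy, -, hy'⟩ := exists_mem_of_dense χ.symm hA.dense_isRegular (ht w) hO
    exact ⟨y, hy, hy'⟩
  obtain ⟨m, hm⟩ : ∃ m, P.length = m + 1 := ⟨P.length - 1, by have := P.one_le_length; omega⟩
  have hchart : ∀ x : P.Mfd P.length, P.IsRegular (P.proj P.length x) →
      x ∈ (P.tower P.length).dom ∧
        (P.tower P.length).chart x = P.theta P.length (P.proj P.length x) := by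
    have := chart_eq_theta le_rfl hc m hm.ge
    rwa [← hm] at this
  have hθ : ∀ w ∈ D, P.theta P.length (z w) = w := by
    intro w hw
    obtain ⟨h1, h2⟩ := hchart (χ.symm w) hw
    rw [hz, ← h2, ← hχ.eqOn h1, χ.right_inv (ht w)]
  have hR : P.RegularExpansion lam (P.quadCoeff F) F z (𝓝[D] 0) :=
    regularExpansion hF hF0 hJordan nhdsWithin_le_nhds self_mem_nhdsWithin
      (eventually_nhdsWithin_of_forall hθ) hμ hlam
  have hzc : Continuous z := continuous_iff_continuousAt.2 fun w =>
    hA.contMDiff_proj.continuous.continuousAt.comp (hsc w)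
  have hz0 : z 0 = 0 := by rw [hz]; dsimp only; rw [hs0, hpe]
  have hzU : ∀ᶠ w in 𝓝 0, z w ∈ U :=
    hzc.continuousAt.preimage_mem_nhds (by rw [hz0]; exact h.isOpen_source.mem_nhds h0)
  have hGc : ∀ x, P.proj P.length x ∈ U → ContinuousAt G x := fun x hx =>
    (hA.isBihol.contMDiffOn.contMDiffAt ((hA.isOpen_preimage h).mem_nhds hx)).continuousAt
  -- `F` keeps nearby regular points regular, so the image is again in the canonical chart, with
  -- coordinates given by `theta`.
  have hGD : ∀ᶠ w in 𝓝[D] 0, G (χ.symm w) ∈ χ.source ∧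
      χ (G (χ.symm w)) = P.theta P.length (F (z w)) := by
    filter_upwards [hR.eventually_isRegular, nhdsWithin_le_nhds hzU] with w h1 h2
    have h3 : P.proj P.length (G (χ.symm w)) = F (z w) := hA.semiconj _ h2
    obtain ⟨h4, h5⟩ := hchart (G (χ.symm w)) (by rw [h3]; exact h1)
    exact ⟨hχ.source_eq ▸ h4, by rw [hχ.eqOn h4, h5, h3]⟩
  have hne : (𝓝[D] (0 : P.Idx → ℂ)).NeBot := mem_closure_iff_nhdsWithin_neBot.1 (hD 0)
  have hGs : ContinuousAt (fun w => G (χ.symm w)) 0 := by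
    refine ContinuousAt.comp (g := G) ?_ (hsc 0)
    rw [hs0]
    exact hGc e (by rw [hpe]; exact h0)
  -- The fixed point is found by a limit: along `D` the lifted points tend to `G e` by continuity of
  -- the lift, and to `e` because their coordinates tend to zero.
  have hGe : G e = e := by
    have t1 : Tendsto (fun w => G (χ.symm w)) (𝓝[D] 0) (𝓝 (G e)) := by
      have := hGs.tendsto.mono_left (nhdsWithin_le_nhds (s := D))
      rwa [hs0] at this
    have t2 : Tendsto (fun w => G (χ.symm w)) (𝓝[D] 0) (𝓝 e) := by
      have t3 : Tendsto (fun w => χ.symm (P.theta P.length (F (z w)))) (𝓝[D] 0) (𝓝 e) := by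
        have := (hsc 0).tendsto.comp hR.tendsto_theta
        rwa [hs0] at this
      refine t3.congr' ?_
      filter_upwards [hGD] with w hw
      rw [← hw.2, χ.left_inv hw.1]
    exact tendsto_nhds_unique t1 t2
  refine ⟨hGe, z, D, hD, hR, ?_, hGD.mono fun w hw => hw.2⟩
  have hsrc : ∀ᶠ w in 𝓝 0, G (χ.symm w) ∈ χ.source :=
    hGs.preimage_mem_nhds (by
      rw [hs0, hGe]; exact χ.open_source.mem_nhds hes)
  filter_upwards [hzU, hsrc] with w h1 h2
  refine ContinuousAt.comp (g := χ) (χ.continuousAt h2) ?_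
  exact ContinuousAt.comp (g := G) (hGc _ h1) (hsc w)

/-- The differential at a fixed point of a map whose expression in a chart has a diagonal
differential. -/
theorem differentialAt_conj {k : ℕ} [IsManifold 𝓘(ℂ, P.Idx → ℂ) ω (P.Mfd k)]
    {G : P.Mfd k → P.Mfd k} {e : P.Mfd k}
    {χ : OpenPartialHomeomorph (P.Mfd k) (P.Idx → ℂ)}
    (hχ : χ ∈ IsManifold.maximalAtlas 𝓘(ℂ, P.Idx → ℂ) ω (P.Mfd k)) (he : e ∈ χ.source)
    (hGe : G e = e) (hG : MDifferentiableAt 𝓘(ℂ, P.Idx → ℂ) 𝓘(ℂ, P.Idx → ℂ) G e)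
    {d : P.Idx → ℂ} (hd : HasFDerivAt (fun w => χ (G (χ.symm w)))
      (ContinuousLinearMap.pi fun x => d x •
        ContinuousLinearMap.proj (R := ℂ) (φ := fun _ : P.Idx => ℂ) x) (χ e))
    (v : P.Idx → ℂ) (i : P.Idx) :
    dchart χ e (P.differentialAt k G e v) i = d i * dchart χ e v i := by
  have h1 := IsManifold.maximalAtlas_subset_of_le (n := ω) (m := 1) le_top hχ
  have hm := mdifferentiableAt_of_mem_maximalAtlas h1 he
  have e1 : HasMFDerivAt 𝓘(ℂ, P.Idx → ℂ) 𝓘(ℂ, P.Idx → ℂ) χ (G e)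
      (mfderiv 𝓘(ℂ, P.Idx → ℂ) 𝓘(ℂ, P.Idx → ℂ) χ e) := by
    rw [hGe]; exact hm.hasMFDerivAt
  have e2 := HasMFDerivAt.comp e e1 hG.hasMFDerivAt
  have e3 := HasMFDerivAt.comp e hd.hasMFDerivAt hm.hasMFDerivAt
  have e4 : ((fun w => χ (G (χ.symm w))) ∘ χ) =ᶠ[𝓝 e] χ ∘ G := by
    filter_upwards [χ.open_source.mem_nhds he] with x hx
    change χ (G (χ.symm (χ x))) = χ (G x)
    rw [χ.left_inv hx]
  have e5 := hasMFDerivAt_unique e2 (e3.congr_of_eventuallyEq e4.symm)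
  have e6 := congrArg (fun T => T v i) e5
  exact e6

end RhoPartition

/-! ### Reading off the conclusions. -/

namespace RhoPartition

variable {ρ : ℕ} [NeZero ρ] {P : RhoPartition ρ}
  {F H : (P.Idx → ℂ) → P.Idx → ℂ} {U U' : Set (P.Idx → ℂ)} {k : ℕ}

theorem StageManifold.isBiholomorphicOff (hA : P.StageManifold F H U U' k) :
    P.IsBiholomorphicOff k := by
  obtain ⟨g, hg, hg1, hg2⟩ := hA.exists_inv
  exact ⟨hA.contMDiff_proj.mdifferentiable (by simp), g,
    hg.mdifferentiableOn (by simp), hg1, hg2⟩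

theorem StageCenter.isClosedSubmanifold (hB : P.StageCenter F U k) :
    IsClosedSubmanifold P.Idx (P.center k) (P.normalIdx k).card :=
  ⟨((P.tower k).sub k).isClosed, hB.adapted⟩

theorem StageCenter.proj_eq_zero_of_exc (hB : P.StageCenter F U k) {x : P.Mfd (k + 1)}
    (hx : x ∈ P.exc (k + 1)) : P.proj (k + 1) x = 0 :=
  hB.proj_eq_zero _ hx

theorem base_mem_exc {e : P.Mfd (k + 1)} (he : (P.tower (k + 1)).isBase e) :
    e ∈ P.exc (k + 1) := by
  obtain ⟨p, hp, hs, -, u, hu, -, rfl⟩ := he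
  exact hp

theorem StageCenter.mapsTo_exc (hA : P.StageManifold F H U U' k) (hB : P.StageCenter F U k)
    (h0 : 0 ∈ U) : MapsTo (P.liftTower F (k + 1)) (P.exc (k + 1)) (P.exc (k + 1)) := by
  intro x hx
  have := hA.isManifold
  have hxU : P.proj k (BlowUp.proj (X := (P.tower k).sub k) x) ∈ U := by
    have : P.proj k (BlowUp.proj (X := (P.tower k).sub k) x) = 0 := hB.proj_eq_zero _ hx
    rw [this]; exact h0
  have h4 := BlowUp.proj_liftMap (X := (P.tower k).sub k) hA.isBihol hB.lift_mem_iff (x := x) hxU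
  change BlowUp.proj (X := (P.tower k).sub k)
    (BlowUp.liftMap (X := (P.tower k).sub k) (P.liftTower F k) x) ∈ (P.tower k).sub k
  rw [h4]
  exact (hB.lift_mem_iff _ hxU).2 hx

theorem StageManifold.mapsTo_singularDivisor (hA : P.StageManifold F H U U' k) (h0 : 0 ∈ U)
    (hF0 : F 0 = 0) :
    MapsTo (P.liftTower F k) (P.singularDivisor k) (P.singularDivisor k) := by
  intro x hx
  have hx0 : P.proj k x = 0 := hx
  change P.proj k (P.liftTower F k x) = 0
  rw [hA.semiconj x (by rw [hx0]; exact h0), hx0, hF0]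

end RhoPartition

end HolBlowUp

open HolBlowUp Polynomial in
theorem theorem2p4 {ρ : ℕ} [NeZero ρ] (P : RhoPartition ρ) (lam : Fin ρ → ℂ)
    (F : (P.Idx → ℂ) → (P.Idx → ℂ)) (hF : AnalyticAt ℂ F 0) (hF0 : F 0 = 0)
    (hJordan : (fderiv ℂ F 0).toLinearMap = Matrix.toLin' (P.jordan lam))
    (hinv : IsUnit (fderiv ℂ F 0).toLinearMap)
    (hnd : ¬ IsDiagonalizable (fderiv ℂ F 0).toLinearMap) :
    (∀ k < P.length, IsClosedSubmanifold P.Idx (P.center k) (P.normalIdx k).card) ∧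
    ∀ k ≤ P.length,
      IsManifold 𝓘(ℂ, P.Idx → ℂ) ω (P.Mfd k) ∧ T2Space (P.Mfd k) ∧
      SecondCountableTopology (P.Mfd k) ∧ P.IsBiholomorphicOff k ∧
      ∃ (e : P.Mfd k) (χ : OpenPartialHomeomorph (P.Mfd k) (P.Idx → ℂ)),
        (P.tower k).isBase e ∧ P.IsCanonicalChart k χ ∧ e ∈ χ.source ∧ χ e = 0 ∧
        (1 ≤ k →
          e ∈ P.exc k ∧
          ∃ G : P.Mfd k → P.Mfd k,
            P.IsLift k F (P.exc k) G ∧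
            P.IsLift k F (P.singularDivisor k) G ∧
            (∀ G', P.IsLift k F (P.exc k) G' → G' =ᶠ[𝓝ˢ (P.exc k)] G) ∧
            (∀ G', P.IsLift k F (P.singularDivisor k) G' →
              G' =ᶠ[𝓝ˢ (P.singularDivisor k)] G) ∧
            G e = e ∧
            (k = P.length →
              IsDiagonalizable (P.differentialAt k G e) ∧
              (P.differentialAt k G e).charpoly =
                (X - C (P.lamTilde lam)) * (X - C 1) ^ (P.μ 0 - 1) *
                  ∏ l ∈ Finset.univ.erase 0, (X - C (lam l / lam 0)) ^ P.μ l ∧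
              (¬ P.EqualTop →
                P.ExpansionOfGt lam (P.quadCoeff F) fun w => χ (G (χ.symm w))) ∧
              (P.EqualTop →
                P.ExpansionOfEq lam (P.quadCoeff F) fun w => χ (G (χ.symm w))))) := by
  have hμ : 2 ≤ P.μ 0 := RhoPartition.two_le_of_not_isDiagonalizable hJordan hnd
  have hlam : ∀ l, lam l ≠ 0 := RhoPartition.lam_ne_zero hJordan hinv
  obtain ⟨H, U, U', h, h0, hK⟩ := exists_isBihol hF hF0 hinv
  have hall := RhoPartition.stage_all hμ h h0 hF0
    (fun k _ _ => RhoPartition.fderiv_split hJordan k)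
    (fun k _ _ => RhoPartition.fderiv_inv_split hJordan hK k)
  have hn : ∀ k ≤ P.length, P.StageManifold F H U U' k := fun k hk => (hall k hk).1
  have hc : ∀ k < P.length, P.StageCenter F U k := fun k hk => (hall k hk.le).2 hk
  have hpos := P.one_le_length
  have hbase : ∀ k, 1 ≤ k → k ≤ P.length → ∀ e, (P.tower k).isBase e →
      e ∈ P.exc k ∧ P.proj k e = 0 := by
    intro k hk1 hk e he
    obtain ⟨k, rfl⟩ : ∃ m, k = m + 1 := ⟨k - 1, by omega⟩
    have := RhoPartition.base_mem_exc he
    exact ⟨this, (hc k (by omega)).proj_eq_zero_of_exc this⟩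
  have hlast : ∀ e, (P.tower P.length).isBase e → ∀ χ, P.IsCanonicalChart P.length χ → _ :=
    fun e he χ hχ =>
      RhoPartition.lift_length hF hF0 hJordan hlam hμ h h0 (hn _ le_rfl) hc
        ((hn _ le_rfl).base_spec e he).1 ((hn _ le_rfl).base_spec e he).2
        (hbase _ hpos le_rfl e he).2 hχ
  -- The expansion is available only at the last stage; the fixed points at the earlier stages
  -- follow by projection.
  have hfix := RhoPartition.lift_base_all hn hc h0 (fun e he => by
    obtain ⟨χ, hχ⟩ := (hn _ le_rfl).exists_chart
    exact (hlast e he χ hχ).1)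
  refine ⟨fun k hk => (hc k hk).isClosedSubmanifold, fun k hk => ?_⟩
  have hA := hn k hk
  have := hA.isManifold
  obtain ⟨e, he⟩ := RhoPartition.exists_base_all hn hc k hk
  obtain ⟨χ, hχ⟩ := hA.exists_chart
  obtain ⟨hed, he0⟩ := hA.base_spec e he
  have hes : e ∈ χ.source := hχ.source_eq ▸ hed
  have hχe : χ e = 0 := by rw [hχ.eqOn hed, he0]
  refine ⟨hA.isManifold, hA.t2Space, hA.secondCountable, hA.isBiholomorphicOff, e, χ, he, hχ,
    hes, hχe, fun hk1 => ⟨(hbase k hk1 hk e he).1, P.liftTower F k, ?_⟩⟩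
  have hsub : ∀ x ∈ P.exc k, P.proj k x ∈ U := by
    obtain ⟨k, rfl⟩ : ∃ m, k = m + 1 := ⟨k - 1, by omega⟩
    intro x hx
    rw [(hc k (by omega)).proj_eq_zero_of_exc hx]
    exact h0
  have hsub' : ∀ x ∈ P.singularDivisor k, P.proj k x ∈ U := by
    intro x hx
    have hx0 : P.proj k x = 0 := hx
    rw [hx0]
    exact h0
  have hmaps : MapsTo (P.liftTower F k) (P.exc k) (P.exc k) := by
    obtain ⟨k, rfl⟩ : ∃ m, k = m + 1 := ⟨k - 1, by omega⟩
    exact RhoPartition.StageCenter.mapsTo_exc (hn k (by omega)) (hc k (by omega)) h0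
  -- One and the same map represents the germ at the exceptional divisor and its extension to the
  -- singular divisor.
  refine ⟨hA.isLift h hsub hmaps, hA.isLift h hsub' (hA.mapsTo_singularDivisor h0 hF0),
    fun G' hG' => hA.isLift_unique h h0 hF0 hsub hG',
    fun G' hG' => hA.isLift_unique h h0 hF0 hsub' hG', hfix k hk e he, ?_⟩
  rintro rfl
  obtain ⟨hGe, z, D, hD, hR, hg, hgf⟩ := hlast e he χ hχ
  have hG0 : (fun w => χ (P.liftTower F P.length (χ.symm w))) 0 = 0 := by
    have hs0 : χ.symm 0 = e := by rw [← hχe, χ.left_inv hes]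
    dsimp only
    rw [hs0, hGe, hχe]
  have hd := hR.hasFDerivAt hD hg hgf hG0
  have hGd : MDifferentiableAt 𝓘(ℂ, P.Idx → ℂ) 𝓘(ℂ, P.Idx → ℂ) (P.liftTower F P.length) e :=
    (hA.isBihol.contMDiffOn.contMDiffAt ((hA.isOpen_preimage h).mem_nhds
      (hsub e (hbase _ hk1 hk e he).1))).mdifferentiableAt (by simp)
  rw [← hχe] at hd
  have hconj := RhoPartition.differentialAt_conj hχ.mem_maximalAtlas hes hGe hGd hd
  have hbij := dchart_bijective hχ.mem_maximalAtlas hes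
  refine ⟨RhoPartition.isDiagonalizable_of_conj hbij hconj, ?_,
    fun hE => hR.expansionOfGt hD hg hgf hE, fun hE => hR.expansionOfEq hD hg hgf hE⟩
  rw [RhoPartition.charpoly_of_conj hbij hconj, RhoPartition.prod_liftEigenvalue lam (hlam 0)]
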